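/- Let $\Omega\subset\mathbb R^d$ be a bounded connected open set whose boundary satisfies the following assumption. $\partial\Omega$ is covered by open sets of two kinds: (i) finitely many open sets $\omega_i$, $i\in I_r$, such that $\partial\Omega\cap\omega_i$ is Lipschitz ($\Omega$ is, near each point of $\partial\Omega\cap\omega_i$ and after a rotation, the region strictly above the graph of a Lipschitz function); (ii) for finitely many indices $i\in I_c$, with integers $d_i'\ge 1$, $d_i''\ge 0$, $1+d'_i+d''_i=d$, a real $\alpha_i>1$, and reals $r_i,\epsilon_i>0$, open neighbourhoods $\omega_{i,p}$ of the points $p$ of a closed submanifold $S_i\subset\mathbb R^d$ of dimension $d_i''$, each carrying a smooth coordinate system $(x_1,x',x'')\in\mathbb R\times\mathbb R^{d_i'}\times\mathbb R^{d_i''}$ centred at $p$ in which $S_i\cap\omega_{i,p}=\{x\in\omega_{i,p}:\ x_1=0,\ x'=0\}$ and $$\Omega\cap\omega_{i,p}=\{(x_1,x',x''):\ 0<x_1<\epsilon_i,\ |x'|<x_1^{\alpha_i},\ |x''|<r_i\}.$$ Let $\rho$ be a measurable function on $\Omega$ with $m\le\rho\le M$ for some constants $m,M>0$ and $\int_\Omega\rho\,dx=1$.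 For $h\in\,]0,1]$ put $$k_{h}(x,y)=h^{-d}\phi\Big(\frac{x-y}h\Big)\min\Big(\frac{\rho(y)}{\rho(x)},1\Big),\qquad \phi=\frac{\mathbf 1_{B(0,1)}}{\mathrm{vol}\,B(0,1)},$$ $$T_{h}u(x)=\Big(1-\int_\Omega k_{h}(x,y)\,dy\Big)u(x)+\int_\Omega k_{h}(x,y)u(y)\,dy,$$ and $\mathcal E_h(f)=\langle(1-T_h)f,f\rangle_{L^2(\Omega,\rho\,dx)}$. Let $(f_h)_{h\in]0,1]}$ be a family of (complex-valued) functions in $L^2(\Omega)$ with $\|f_h\|_{L^2(\Omega)}\le1$ and $\mathcal E_h(f_h)\le h^2$ for all $h\in\,]0,1]$. Then there exist $C,C_0>0$ and $h_0\in\,]0,1]$ such that, with $$\Gamma_h=\bigcup_{i\in I_c}\{x\in\Omega:\ d(x,S_i)<C\,h^{1/\alpha_i}\},$$ for every $h\in\,]0,h_0]$ there is a decomposition $f_h=f_{h,\mathcal C}+f_{h,L}+f_{h,H}$ with $f_{h,\mathcal C},f_{h,L},f_{h,H}\in L^2(\Omega)$ such that - $\operatorname{supp}(f_{h,\mathcal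 C})\subset\Gamma_{2h}$; - $f_{h,L}$ and $f_{h,H}$ are supported in $\Omega\setminus\Gamma_h$, $f_{h,L}$ has a weak gradient in $L^2(\Omega)$, and $$\|\nabla f_{h,L}\|_{L^2(\Omega)}\le C_0,\qquad \|f_{h,H}\|_{L^2(\Omega)}\le C_0\,h.$$ Supports are essential supports relative to $\Omega$ (the complement in $\Omega$ of the largest open set on which the function vanishes almost everywhere). -/

import Mathlib

open MeasureTheory Set Filter Topology
open scoped ContDiff

noncomputable section

namespace CuspMetropolis

/-- The Euclidean space `ℝ^d`. -/
abbrev E (d : ℕ) : Type := EuclideanSpace ℝ (Fin d)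

/-! ### The Metropolis operator and its Dirichlet form -/

/-- The normalized indicator function of the open unit ball of `ℝ^d`. -/
def ballDensity {d : ℕ} (z : E d) : ℝ :=
  (volume.real (Metric.ball (0 : E d) 1))⁻¹ * (Metric.ball (0 : E d) 1).indicator 1 z

/-- `k_{h,ρ}(x,y) = h^{-d} φ((x-y)/h) min(ρ(y)/ρ(x), 1)`. -/
def metropolisKernel {d : ℕ} (ρ : E d → ℝ) (h : ℝ) (x y : E d) : ℝ :=
  (h ^ d)⁻¹ * ballDensity (h⁻¹ • (x - y)) * min (ρ y / ρ x) 1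

/-- `m_{h,ρ}(x) = 1 - ∫_Ω k_{h,ρ}(x,y) dy`. -/
def holdingProb {d : ℕ} (Ω : Set (E d)) (ρ : E d → ℝ) (h : ℝ) (x : E d) : ℝ :=
  1 - ∫ y in Ω, metropolisKernel ρ h x y

/-- The Metropolis operator `T_{h,ρ} u(x) = m_{h,ρ}(x) u(x) + ∫_Ω k_{h,ρ}(x,y) u(y) dy`. -/
def metropolisOp {d : ℕ} (Ω : Set (E d)) (ρ : E d → ℝ) (h : ℝ) (u : E d → ℂ) (x : E d) : ℂ :=
  (holdingProb Ω ρ h x : ℂ) * u x + ∫ y in Ω, (metropolisKernel ρ h x y : ℂ) * u y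

/-- The sesquilinear Dirichlet form `⟨(1 - T_{h,ρ}) f, g⟩` of `L²(Ω, ρ dx)`. -/
def dirichletForm {d : ℕ} (Ω : Set (E d)) (ρ : E d → ℝ) (h : ℝ) (f g : E d → ℂ) : ℂ :=
  ∫ x in Ω, (f x - metropolisOp Ω ρ h f x) * (starRingEnd ℂ) (g x) * (ρ x : ℂ)

/-- The Dirichlet energy `𝓔_{h,ρ}(f) = ⟨(1 - T_{h,ρ}) f, f⟩`, which is a real number since
`T_{h,ρ}` is self-adjoint. -/
def dirichletEnergy {d : ℕ} (Ω : Set (E d)) (ρ : E d → ℝ) (h : ℝ) (f : E d → ℂ) : ℝ :=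
  (dirichletForm Ω ρ h f f).re

/-! ### Domains with cusps -/

/-- Near the point `x`, after a rotation, `Ω` is the open region strictly above the graph of a
Lipschitz function. The vertical direction is `ν`, and `y - ⟪ν, y⟫ ν` is the orthogonal projection
of `y` to the horizontal hyperplane. -/
def IsLipschitzNear {d : ℕ} (Ω : Set (E d)) (x : E d) : Prop :=
  ∃ U : Set (E d), IsOpen U ∧ x ∈ U ∧ ∃ ν : E d, ‖ν‖ = 1 ∧
    ∃ (K : NNReal) (g : E d → ℝ), LipschitzWith K g ∧
      ∀ y ∈ U, y ∈ Ω ↔ g (y - inner ℝ ν y • ν) < inner ℝ ν y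

/-- The model cusp
`{(x₁, x', x'') ∈ ℝ × ℝ^d' × ℝ^d'' : 0 < x₁ < ε, |x'| < x₁^α, |x''| < r}`. -/
def modelCusp (d' d'' : ℕ) (α ε r : ℝ) : Set (ℝ × E d' × E d'') :=
  {x | 0 < x.1 ∧ x.1 < ε ∧ ‖x.2.1‖ < x.1 ^ α ∧ ‖x.2.2‖ < r}

/-- `φ` is a smooth coordinate system centred at `p`, defined on the open set `φ.source`, in which
`Ω` is the model cusp and `S` is the linear subspace `{x₁ = 0, x' = 0}`. -/
structure IsCuspChart {d d' d'' : ℕ} (Ω S : Set (E d)) (α ε r : ℝ) (p : E d)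
    (φ : OpenPartialHomeomorph (E d) (ℝ × E d' × E d'')) : Prop where
  mem_source : p ∈ φ.source
  map_center : φ p = 0
  smooth : ContDiffOn ℝ ∞ φ φ.source
  smooth_symm : ContDiffOn ℝ ∞ φ.symm φ.target
  image_domain : φ '' (Ω ∩ φ.source) = modelCusp d' d'' α ε r
  image_edge : φ '' (S ∩ φ.source) = {x | x ∈ φ.target ∧ x.1 = 0 ∧ x.2.1 = 0}

/-- The boundary of `Ω` is covered by open sets of two kinds: finitely many sets `ωr i` in which the
boundary of `Ω` is Lipschitz, and the coordinate patches `ωc i p` around the points `p` of finitely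
many closed submanifolds `S i` (of dimension `d'' i`), in which `Ω` is a cusp of exponent `α i`
with edge `S i`. -/
structure HasCuspidalBoundary {d : ℕ} (Ω : Set (E d)) {Ir Ic : Type*}
    (ωr : Ir → Set (E d)) (ωc : Ic → E d → Set (E d))
    (S : Ic → Set (E d)) (d' d'' : Ic → ℕ) (α : Ic → ℝ) : Prop where
  finite_regular : Finite Ir
  finite_cusp : Finite Ic
  isOpen_regular : ∀ i, IsOpen (ωr i)
  lipschitz : ∀ i, ∀ x ∈ frontier Ω ∩ ωr i, IsLipschitzNear Ω x
  dim_eq : ∀ i, 1 + d' i + d'' i = d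
  dim_pos : ∀ i, 1 ≤ d' i
  one_lt_exponent : ∀ i, 1 < α i
  isClosed_edge : ∀ i, IsClosed (S i)
  cusp : ∀ i, ∃ r > 0, ∃ ε > 0, ∀ p ∈ S i,
    ∃ φ : OpenPartialHomeomorph (E d) (ℝ × E (d' i) × E (d'' i)),
      φ.source = ωc i p ∧ IsCuspChart Ω (S i) (α i) ε r p φ
  cover : frontier Ω ⊆ (⋃ i, ωr i) ∪ ⋃ i, ⋃ p ∈ S i, ωc i p

/-- `Γ_h = ⋃ i, {x ∈ Ω : dist(x, S i) < C h^{1/α i}}`. -/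
def cuspRegion {d : ℕ} {Ic : Type*} (Ω : Set (E d)) (S : Ic → Set (E d)) (α : Ic → ℝ)
    (C h : ℝ) : Set (E d) :=
  ⋃ i, Ω ∩ Metric.thickening (C * h ^ (1 / α i)) (S i)

/-! ### Supports and weak gradients on an open set -/

/-- The support in `Ω` of a function defined almost everywhere on `Ω`: the complement in `Ω` of the
largest open set on which the function vanishes almost everywhere. -/
def essSupport {d : ℕ} (Ω : Set (E d)) (f : E d → ℂ) : Set (E d) :=
  {x | x ∈ Ω ∧ ∀ U ∈ 𝓝 x, ¬ (f =ᵐ[volume.restrict (Ω ∩ U)] 0)}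

/-- `G` is the gradient of `f` on the open set `Ω` in the sense of distributions. -/
def HasWeakGradient {d : ℕ} (Ω : Set (E d)) (f : E d → ℂ)
    (G : E d → EuclideanSpace ℂ (Fin d)) : Prop :=
  LocallyIntegrableOn f Ω ∧ LocallyIntegrableOn G Ω ∧
    ∀ ψ : E d → ℝ, ContDiff ℝ ∞ ψ → HasCompactSupport ψ → tsupport ψ ⊆ Ω → ∀ j : Fin d,
      ∫ x in Ω, (fderiv ℝ ψ x (EuclideanSpace.single j 1) : ℂ) * f x =
        -∫ x in Ω, (ψ x : ℂ) * G x j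

end CuspMetropolis

end

/-! Away from the cusps the energy bound is an H¹ bound at scales above h. By detailed balance the
energy is half the double integral of |u(y) - u(x)|² against a symmetric jump density, which is at
least a constant times h^{-d} when |x - y| < h. Let g be the average of u over Ω at scale h.
Wherever Ω fills a fixed proportion of the ball of radius h/2, Cauchy–Schwarz turns this into ‖g -
u‖ = O(h) and ‖∇g‖ = O(1) in L². The set `fatPart` guarantees such a proportion, and
`exists_lintegral_localAverage_bounds` is the resulting estimate.

A cusp of exponent α has width x₁^α at height x₁, so it is fat at scale h as soon as h ≤ x₁^α. Since
x₁ is comparable to the distance to the edge, this holds at distance at least C h^{1/α}. Hence the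
definition of Γ_h, and Ω \ Γ_h ⊆ `fatPart` with uniform constants by compactness
(`exists_diff_cuspRegion_subset_fatPart`).

One then takes f_L = χ g with χ a product of smooth cutoffs vanishing on Γ_h, f_H = u - g cut off
sharply (no derivative of it is needed), and lets f_C be the remainder, which lives where χ has not
yet reached 1. The difficulty is the term g ∇χ: the gradient of χ is only bounded by a sum of terms
κ / d(x, S_i), which are of order h^{-1/α_i} near Γ_h. It is controlled by Hardy's inequality: the
L² norm of g / d(x, S_i) off Γ_h is bounded by the H¹ norm of g on the fat part, uniformly in h.

Hardy's inequality holds with no boundary condition at the edge because the homogeneous dimension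
transverse to it, 1 + α d', exceeds 2. In the model cusp, comparing F(x) with F at the dilated point
(2x₁, 2^α x', x'') costs a gradient term, while the main term comes back multiplied by 2^{1 - α d'}
< 1 and is absorbed (`exists_lintegral_truncatedCusp_le`). Charts transport this to Ω, and
`lintegral_enorm_sq_fderiv_smul_le` applies it to χ g. -/

namespace CuspMetropolis

/-! ### Interior balls at scale h: model cusp, charts, Lipschitz points -/

/-- The points of `Ω` around which the ball of radius `h / 2` contains a ball of radius `c * h`
lying in `Ω`. -/
def fatPart {d : ℕ} (Ω : Set (E d)) (c h : ℝ) : Set (E d) :=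
  {x | x ∈ Ω ∧ ∃ z, Metric.ball z (c * h) ⊆ Ω ∧ dist x z + c * h < h / 2}

theorem isOpen_fatPart {d : ℕ} {Ω : Set (E d)} (hΩ : IsOpen Ω) (c h : ℝ) :
    IsOpen (fatPart Ω c h) := by
  have : fatPart Ω c h = Ω ∩ ⋃ z ∈ {z | Metric.ball z (c * h) ⊆ Ω},
      {x | dist x z + c * h < h / 2} := by
    ext x; simp [fatPart]
  rw [this]
  refine hΩ.inter (isOpen_biUnion fun z _ => ?_)
  exact isOpen_lt (by fun_prop) (by fun_prop)

theorem fatPart_subset {d : ℕ} (Ω : Set (E d)) (c h : ℝ) : fatPart Ω c h ⊆ Ω := fun _ hx => hx.1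

theorem fatPart_antitone {d : ℕ} (Ω : Set (E d)) {c c' h : ℝ} (hh : 0 ≤ h) (hc : c' ≤ c) :
    fatPart Ω c h ⊆ fatPart Ω c' h := by
  rintro x ⟨hx, z, hz, hd⟩
  have := mul_le_mul_of_nonneg_right hc hh
  exact ⟨hx, z, (Metric.ball_subset_ball this).trans hz, by linarith⟩

theorem cuspRegion_mono {d : ℕ} {Ic : Type*} (Ω : Set (E d)) (S : Ic → Set (E d)) (α : Ic → ℝ)
    {C C' h : ℝ} (hh : 0 ≤ h) (hC : C ≤ C') : cuspRegion Ω S α C h ⊆ cuspRegion Ω S α C' h :=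
  iUnion_mono fun _ => inter_subset_inter_right _ <| Metric.thickening_mono
    (mul_le_mul_of_nonneg_right hC (Real.rpow_nonneg hh _)) _

theorem exists_shrink {V : Type*} [NormedAddCommGroup V] [NormedSpace ℝ V] (v : V) {t : ℝ}
    (ht : 0 ≤ t) : ∃ w : V, dist w v ≤ t ∧ ‖w‖ ≤ max (‖v‖ - t) 0 := by
  rcases le_or_gt ‖v‖ t with h | h
  · exact ⟨0, by simpa using h, by simp⟩
  · have hv : 0 < ‖v‖ := ht.trans_lt h
    refine ⟨(1 - t / ‖v‖) • v, ?_, ?_⟩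
    · rw [dist_eq_norm, sub_smul, one_smul, sub_sub_cancel_left, norm_neg, norm_smul,
        Real.norm_of_nonneg (by positivity)]
      field_simp; rfl
    · have : 0 ≤ 1 - t / ‖v‖ := by rw [sub_nonneg, div_le_one hv]; exact h.le
      rw [norm_smul, Real.norm_of_nonneg this]
      refine le_max_of_le_left (le_of_eq ?_)
      field_simp

/-- Bernoulli's inequality for (1 - s/x)^α; the slope of x^α on (0, ε] is at most α ε^{α-1}. -/
theorem sub_le_rpow_sub {x s α ε : ℝ} (hα : 1 ≤ α) (hx : 0 < x) (hxε : x ≤ ε) (hs : 0 ≤ s)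
    (hsx : s ≤ x) : x ^ α - α * ε ^ (α - 1) * s ≤ (x - s) ^ α := by
  have h1 := one_add_mul_self_le_rpow_one_add (s := -(s / x))
    (by rw [neg_le_neg_iff, div_le_one hx]; exact hsx) hα
  have h2 : (x - s) ^ α = x ^ α * (1 + -(s / x)) ^ α := by
    rw [← Real.mul_rpow hx.le (by
      rw [← sub_eq_add_neg, sub_nonneg, div_le_one hx]; exact hsx)]
    congr 1; field_simp; ring
  have h3 : x ^ α = x ^ (α - 1) * x := by
    rw [← Real.rpow_add_one hx.ne', sub_add_cancel]
  have h4 : x ^ (α - 1) ≤ ε ^ (α - 1) := Real.rpow_le_rpow hx.le hxε (by linarith)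
  have h5 : x ^ α * (1 + α * -(s / x)) ≤ (x - s) ^ α := by
    rw [h2]; exact mul_le_mul_of_nonneg_left h1 (Real.rpow_nonneg hx.le _)
  have h6 : x ^ α * (1 + α * -(s / x)) = x ^ α - α * x ^ (α - 1) * s := by
    rw [h3]; field_simp; ring
  have h7 : α * x ^ (α - 1) * s ≤ α * ε ^ (α - 1) * s := by gcongr
  linarith

/-- The point is pushed inwards: x' and x'' are shortened by t/2 (or sent to 0) and x₁ is lowered by
κt, which keeps the ball below x₁ = ε. Lowering x₁ narrows the section by at most 2αbκt with b =
ε^{α-1}, and κ is small enough for this loss and the radius κt to fit into the t/2 that was gained.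
The hypothesis t ≤ x₁^α says that the section is at least as wide as t. -/
theorem exists_ball_subset_modelCusp {d' d'' : ℕ} {α ε r : ℝ} (hα : 1 ≤ α) (hε : 0 < ε) :
    ∃ κ > 0, ∀ t, 0 < t → t ≤ r → ∀ x ∈ modelCusp d' d'' α ε r, t ≤ x.1 ^ α →
      ∃ z, dist z x ≤ t ∧ Metric.ball z (κ * t) ⊆ modelCusp d' d'' α ε r := by
  set b := ε ^ (α - 1) with hb
  have hb0 : 0 < b := Real.rpow_pos_of_pos hε _
  set κ := (4 * (1 + α) * (1 + b))⁻¹ with hκ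
  have hκ0 : 0 < κ := by positivity
  have hκ1 : κ * (4 * (1 + α) * (1 + b)) = 1 := inv_mul_cancel₀ (by positivity)
  have hαb : 0 < α * b := by positivity
  have hκb : 0 < κ * b := by positivity
  have hκα : 0 ≤ κ * (α - 1) := mul_nonneg hκ0.le (by linarith)
  have hκαb : 0 < κ * (α * b) := by positivity
  have e1 : κ * (1 + 2 * α * b) ≤ 1 / 2 := by nlinarith
  have e2 : κ * b ≤ 1 / 4 := by nlinarith
  have e3 : κ ≤ 1 / 8 := by nlinarith
  refine ⟨κ, hκ0, fun t ht htr x hx htx => ?_⟩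
  obtain ⟨hx0, hxε, hx', hx''⟩ := hx
  obtain ⟨z', hz', hz'n⟩ := exists_shrink x.2.1 (t := t / 2) (by linarith)
  obtain ⟨z'', hz'', hz''n⟩ := exists_shrink x.2.2 (t := t / 2) (by linarith)
  have hκt : 0 < κ * t := by positivity
  have hκt8 : κ * t ≤ 1 / 8 * t := by gcongr
  have hxα : x.1 ^ α ≤ b * x.1 := by
    have : x.1 ^ α = x.1 ^ (α - 1) * x.1 := by
      rw [← Real.rpow_add_one hx0.ne', sub_add_cancel]
    rw [this, hb]
    gcongr
  -- Lowering x₁ by 2κt keeps it nonnegative, since t ≤ x₁^α ≤ b x₁ and κb ≤ 1/4.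
  have hs : 2 * (κ * t) ≤ x.1 := by
    have : κ * t ≤ κ * (b * x.1) := by gcongr; linarith
    nlinarith
  refine ⟨(x.1 - κ * t, z', z''), ?_, ?_⟩
  · rw [Prod.dist_eq, Prod.dist_eq]
    refine max_le ?_ (max_le (by linarith) (by linarith))
    rw [Real.dist_eq, sub_sub_cancel_left, abs_neg, abs_of_pos hκt]
    linarith
  · intro y hy
    rw [Metric.mem_ball, Prod.dist_eq, Prod.dist_eq, max_lt_iff, max_lt_iff] at hy
    obtain ⟨hy1, hy2, hy3⟩ := hy
    simp only at hy1 hy2 hy3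
    rw [Real.dist_eq, abs_lt] at hy1
    have hy2' : ‖y.2.1‖ < ‖z'‖ + κ * t := by
      have := norm_le_norm_add_norm_sub' y.2.1 z'
      rw [dist_eq_norm] at hy2; linarith
    have hy3' : ‖y.2.2‖ < ‖z''‖ + κ * t := by
      have := norm_le_norm_add_norm_sub' y.2.2 z''
      rw [dist_eq_norm] at hy3; linarith
    have hpow := sub_le_rpow_sub hα hx0 hxε.le (s := 2 * (κ * t)) (by linarith) hs
    rw [← hb] at hpow
    have hmono : (x.1 - 2 * (κ * t)) ^ α ≤ y.1 ^ α :=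
      Real.rpow_le_rpow (by linarith) (by linarith) (by linarith)
    have e1t : κ * (1 + 2 * α * b) * t ≤ 1 / 2 * t := by gcongr
    refine ⟨by linarith, by linarith, ?_, ?_⟩
    · rcases max_choice (‖x.2.1‖ - t / 2) 0 with h | h <;> rw [h] at hz'n <;> nlinarith
    · rcases max_choice (‖x.2.2‖ - t / 2) 0 with h | h <;> rw [h] at hz''n <;> linarith

section chart

variable {d d' d'' : ℕ} {Ω S : Set (E d)} {α ε r : ℝ} {p : E d}
  {φ : OpenPartialHomeomorph (E d) (ℝ × E d' × E d'')}

theorem IsCuspChart.exists_lipschitz (h : IsCuspChart Ω S α ε r p φ) {x : E d}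
    (hx : x ∈ φ.source) : ∃ L : NNReal, 1 ≤ L ∧ ∃ R > 0,
      Metric.ball x R ⊆ φ.source ∧ LipschitzOnWith L φ (Metric.ball x R) ∧
      Metric.ball (φ x) R ⊆ φ.target ∧ LipschitzOnWith L φ.symm (Metric.ball (φ x) R) := by
  obtain ⟨K₁, t₁, ht₁, hK₁⟩ := ((h.smooth.contDiffAt (φ.open_source.mem_nhds hx)).of_le
    (by simp : (1 : WithTop ℕ∞) ≤ ∞)).exists_lipschitzOnWith
  obtain ⟨K₂, t₂, ht₂, hK₂⟩ := ((h.smooth_symm.contDiffAt (φ.open_target.mem_nhds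
    (φ.map_source hx))).of_le (by simp : (1 : WithTop ℕ∞) ≤ ∞)).exists_lipschitzOnWith
  obtain ⟨R₁, hR₁, hs₁⟩ := Metric.mem_nhds_iff.1 (inter_mem ht₁ (φ.open_source.mem_nhds hx))
  obtain ⟨R₂, hR₂, hs₂⟩ := Metric.mem_nhds_iff.1
    (inter_mem ht₂ (φ.open_target.mem_nhds (φ.map_source hx)))
  refine ⟨max 1 (max K₁ K₂), le_max_left _ _, min R₁ R₂, lt_min hR₁ hR₂, ?_, ?_, ?_, ?_⟩
  · exact fun y hy => (hs₁ (Metric.ball_subset_ball (min_le_left _ _) hy)).2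
  · exact (hK₁.weaken (le_max_of_le_right (le_max_left _ _))).mono
      fun y hy => (hs₁ (Metric.ball_subset_ball (min_le_left _ _) hy)).1
  · exact fun y hy => (hs₂ (Metric.ball_subset_ball (min_le_right _ _) hy)).2
  · exact (hK₂.weaken (le_max_of_le_right (le_max_right _ _))).mono
      fun y hy => (hs₂ (Metric.ball_subset_ball (min_le_right _ _) hy)).1

theorem IsCuspChart.mem_domain_iff (h : IsCuspChart Ω S α ε r p φ) {x : E d}
    (hx : x ∈ φ.source) : x ∈ Ω ↔ φ x ∈ modelCusp d' d'' α ε r := by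
  rw [← h.image_domain]
  refine ⟨fun hxΩ => ⟨x, ⟨hxΩ, hx⟩, rfl⟩, ?_⟩
  rintro ⟨y, ⟨hyΩ, hy⟩, hxy⟩
  rwa [← φ.injOn hy hx hxy]

theorem IsCuspChart.mem_edge_iff (h : IsCuspChart Ω S α ε r p φ) {x : E d}
    (hx : x ∈ φ.source) : x ∈ S ↔ (φ x).1 = 0 ∧ (φ x).2.1 = 0 := by
  have : φ x ∈ φ '' (S ∩ φ.source) ↔ x ∈ S := by
    constructor
    · rintro ⟨y, ⟨hyS, hy⟩, hxy⟩
      rwa [← φ.injOn hy hx hxy]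
    · exact fun hxS => ⟨x, ⟨hxS, hx⟩, rfl⟩
  rw [← this, h.image_edge]
  simp [φ.map_source hx]

theorem IsCuspChart.eventually_mem_fatPart (h : IsCuspChart Ω S α ε r p φ) (hα : 1 ≤ α)
    (hε : 0 < ε) (hr : 0 < r) {x₀ : E d} (hx₀ : x₀ ∈ φ.source) :
    ∃ c > 0, ∃ h₀ > 0, ∀ᶠ x in 𝓝 x₀, ∀ t, 0 < t → t ≤ h₀ → x ∈ Ω → t ≤ (φ x).1 ^ α →
      x ∈ fatPart Ω c t := by
  obtain ⟨L, hL1, R, hR, hs, hφ, hs', hφ'⟩ := h.exists_lipschitz hx₀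
  obtain ⟨κ, hκ, H⟩ := exists_ball_subset_modelCusp (d' := d') (d'' := d'') (r := r) hα hε
  have hL1' : (1 : ℝ) ≤ L := by exact_mod_cast hL1
  have hL0 : (0 : ℝ) < L := by linarith
  set c := min (1 / 8) (κ / (8 * L ^ 2)) with hc
  have hc0 : 0 < c := by positivity
  have hcκ : L * c ≤ κ / (8 * L) := by
    calc L * c ≤ L * (κ / (8 * L ^ 2)) := by gcongr; exact min_le_right _ _
      _ = κ / (8 * L) := by field_simp
  have hcont : ContinuousAt φ x₀ := φ.continuousAt hx₀
  refine ⟨c, hc0, min (8 * L * r) (min R (R / 2)), by positivity, ?_⟩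
  filter_upwards [Metric.ball_mem_nhds x₀ (half_pos hR),
    hcont.preimage_mem_nhds (Metric.ball_mem_nhds (φ x₀) (half_pos hR))] with x hxR hφxR
    t ht htle hxΩ htx
  rw [mem_preimage] at hφxR
  have htr : t ≤ 8 * L * r := htle.trans (min_le_left _ _)
  have htR : t ≤ R / 2 := htle.trans ((min_le_right _ _).trans (min_le_right _ _))
  have hxs : x ∈ φ.source := hs (Metric.ball_subset_ball (by linarith) hxR)
  have htL : t / (8 * L) ≤ t := div_le_self ht.le (by linarith)
  -- The model is used at scale t / (8L): the inverse chart then moves the point by at most t/8, and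
  -- with the radius ct ≤ t/8 the total stays below t/2.
  obtain ⟨z, hz, hzb⟩ := H (t / (8 * L)) (by positivity)
    (by rw [div_le_iff₀ (by positivity)]; linarith) (φ x) ((h.mem_domain_iff hxs).1 hxΩ)
    (by linarith)
  rw [Metric.mem_ball] at hxR hφxR
  have hzR : z ∈ Metric.ball (φ x₀) R := by
    rw [Metric.mem_ball]
    have := dist_triangle z (φ x) (φ x₀)
    have : t / (8 * L) < R / 2 := by
      refine lt_of_lt_of_le ?_ htR
      exact div_lt_self ht (by linarith)
    linarith
  have hφxR' : φ x ∈ Metric.ball (φ x₀) R := by rw [Metric.mem_ball]; linarith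
  have hw : dist x (φ.symm z) ≤ t / 8 := by
    have := hφ'.dist_le_mul _ hφxR' _ hzR
    rw [φ.left_inv hxs, dist_comm (φ x)] at this
    calc _ ≤ _ := this
      _ ≤ L * (t / (8 * L)) := by gcongr
      _ = t / 8 := by field_simp
  have hc8 : c * t ≤ 1 / 8 * t := by gcongr; exact min_le_left _ _
  refine ⟨hxΩ, φ.symm z, ?_, by linarith⟩
  intro y hy
  rw [Metric.mem_ball] at hy
  have hwR : φ.symm z ∈ Metric.ball x₀ R := by
    rw [Metric.mem_ball]
    have := dist_triangle_left (φ.symm z) x₀ x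
    linarith
  have hyR : y ∈ Metric.ball x₀ R := by
    rw [Metric.mem_ball]
    have := dist_triangle y (φ.symm z) x₀
    have := dist_triangle_left (φ.symm z) x₀ x
    linarith
  rw [h.mem_domain_iff (hs hyR)]
  apply hzb
  have := hφ.dist_le_mul _ hyR _ hwR
  rw [φ.right_inv (hs' hzR)] at this
  rw [Metric.mem_ball]
  calc dist (φ y) z ≤ L * dist y (φ.symm z) := this
    _ < L * (c * t) := by gcongr
    _ = (L * c) * t := by ring
    _ ≤ κ / (8 * L) * t := by gcongr
    _ = κ * (t / (8 * L)) := by ring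

/-- Near the edge, the first coordinate is comparable to the distance to the edge. -/
theorem IsCuspChart.eventually_infDist (h : IsCuspChart Ω S α ε r p φ) (hα : 1 ≤ α)
    (hp : p ∈ S) : ∃ L : ℝ, 1 ≤ L ∧ ∀ᶠ x in 𝓝 p, x ∈ Ω →
      (φ x).1 ≤ L * Metric.infDist x S ∧ Metric.infDist x S ≤ L * (φ x).1 := by
  obtain ⟨L, hL1, R, hR, hs, hφ, hs', hφ'⟩ := h.exists_lipschitz h.mem_source
  have hL1' : (1 : ℝ) ≤ L := by exact_mod_cast hL1
  have hcont : ContinuousAt φ p := φ.continuousAt h.mem_source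
  refine ⟨L, hL1', ?_⟩
  filter_upwards [Metric.ball_mem_nhds p (half_pos hR),
    hcont.preimage_mem_nhds (Metric.ball_mem_nhds (φ p) (lt_min one_pos hR))] with x hxR hφxR hxΩ
  rw [mem_preimage] at hφxR
  have hxR' : x ∈ Metric.ball p R := Metric.ball_subset_ball (by linarith) hxR
  have hφxR' : φ x ∈ Metric.ball (φ p) R := Metric.ball_subset_ball (min_le_right _ _) hφxR
  have hxs := hs hxR'
  rw [Metric.mem_ball] at hxR
  obtain ⟨h1, h2, h3, h4⟩ := (h.mem_domain_iff hxs).1 hxΩ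
  have habs : ∀ y z : ℝ × E d' × E d'', |y.1 - z.1| ≤ dist y z := fun y z => by
    rw [Prod.dist_eq, ← Real.dist_eq]; exact le_max_left _ _
  constructor
  · have hpS : S.Nonempty := ⟨p, hp⟩
    rw [mul_comm, ← div_le_iff₀ (by linarith), Metric.le_infDist hpS]
    intro y hy
    rw [div_le_iff₀ (by linarith), mul_comm]
    -- Only edge points inside the chart are known to have first coordinate 0. An edge point at
    -- distance at least R/2 is farther from x than p is, so p serves instead.
    by_cases hyR : dist x y < R / 2
    · have hyR' : y ∈ Metric.ball p R := by
        rw [Metric.mem_ball]; have := dist_triangle_left y p x; linarith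
      have := hφ.dist_le_mul _ hxR' _ hyR'
      have h5 := habs (φ x) (φ y)
      rw [((h.mem_edge_iff (hs hyR')).1 hy).1, sub_zero, abs_of_pos h1] at h5
      linarith
    · have := hφ.dist_le_mul _ hxR' _ (Metric.mem_ball_self hR)
      have h5 := habs (φ x) (φ p)
      rw [h.map_center, Prod.fst_zero, sub_zero, abs_of_pos h1] at h5
      rw [h.map_center] at this
      push Not at hyR
      calc (φ x).1 ≤ L * dist x p := h5.trans this
        _ ≤ L * dist x y := by gcongr; linarith
  · have hx1 : (φ x).1 < 1 := by
      have := habs (φ x) (φ p)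
      rw [h.map_center, Prod.fst_zero, sub_zero, abs_of_pos h1] at this
      rw [Metric.mem_ball, h.map_center] at hφxR
      exact this.trans_lt (hφxR.trans_le (min_le_left _ _))
    -- The projection to the edge displaces only x₁ and x', and |x'| < x₁^α ≤ x₁ because x₁ < 1.
    set q : ℝ × E d' × E d'' := (0, 0, (φ x).2.2) with hq
    have hqR : q ∈ Metric.ball (φ p) R := by
      rw [Metric.mem_ball, h.map_center] at hφxR' ⊢
      refine lt_of_le_of_lt ?_ hφxR'
      rw [dist_zero_right, dist_zero_right, Prod.norm_def, Prod.norm_def]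
      simp only [hq, norm_zero]
      refine max_le (norm_nonneg _) (max_le (norm_nonneg _) ?_)
      exact (le_max_right ‖(φ x).2.1‖ _).trans (le_max_right ‖(φ x).1‖ _)
    have hqt := hs' hqR
    have hqS : φ.symm q ∈ S := by
      rw [h.mem_edge_iff (φ.map_target hqt), φ.right_inv hqt]
      simp [hq]
    refine (Metric.infDist_le_dist_of_mem hqS).trans ?_
    have := hφ'.dist_le_mul _ hφxR' _ hqR
    rw [φ.left_inv hxs] at this
    refine this.trans ?_
    gcongr
    rw [Prod.dist_eq, Prod.dist_eq]
    simp only [hq, dist_zero_right, dist_self]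
    refine max_le (le_of_eq (Real.norm_of_nonneg h1.le)) (max_le ?_ h1.le)
    refine h3.le.trans ?_
    calc (φ x).1 ^ α ≤ (φ x).1 ^ (1 : ℝ) := Real.rpow_le_rpow_of_exponent_ge h1 hx1.le hα
      _ = (φ x).1 := Real.rpow_one _

end chart

theorem eventually_mem_fatPart_of_mem {d : ℕ} {Ω : Set (E d)} (hΩ : IsOpen Ω) {x₀ : E d}
    (hx₀ : x₀ ∈ Ω) : ∃ c > 0, ∃ h₀ > 0, ∀ᶠ x in 𝓝 x₀, ∀ t, 0 < t → t ≤ h₀ → x ∈ Ω →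
      x ∈ fatPart Ω c t := by
  obtain ⟨R, hR, hs⟩ := Metric.isOpen_iff.1 hΩ x₀ hx₀
  refine ⟨1 / 4, by norm_num, R / 2, by positivity, ?_⟩
  filter_upwards [Metric.ball_mem_nhds x₀ (half_pos hR)] with x hx t ht htR hxΩ
  refine ⟨hxΩ, x, fun y hy => hs ?_, by rw [dist_self]; linarith⟩
  rw [Metric.mem_ball] at *
  have := dist_triangle y x x₀
  linarith

/-- Moving up by t/4 along ν clears the graph by t/4. A further displacement shorter than ct lowers
the height by at most ct and raises the graph by at most 2Kct; c is chosen so that the two add up to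
t/8. -/
theorem IsLipschitzNear.eventually_mem_fatPart {d : ℕ} {Ω : Set (E d)} {x₀ : E d}
    (h : IsLipschitzNear Ω x₀) : ∃ c > 0, ∃ h₀ > 0, ∀ᶠ x in 𝓝 x₀, ∀ t, 0 < t → t ≤ h₀ → x ∈ Ω →
      x ∈ fatPart Ω c t := by
  obtain ⟨U, hU, hxU, ν, hν, K, g, hg, hiff⟩ := h
  obtain ⟨R, hR, hs⟩ := Metric.isOpen_iff.1 hU x₀ hxU
  set c : ℝ := (8 * (1 + 2 * K))⁻¹ with hc
  have hK : (0 : ℝ) ≤ K := K.2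
  have hc0 : 0 < c := by positivity
  have hc1 : c * (8 * (1 + 2 * K)) = 1 := inv_mul_cancel₀ (by positivity)
  have hcK : 0 ≤ c * K := by positivity
  refine ⟨c, hc0, R / 2, by positivity, ?_⟩
  filter_upwards [Metric.ball_mem_nhds x₀ (half_pos hR)] with x hx t ht htR hxΩ
  have hct : 0 < c * t := by positivity
  have hct8 : c * t ≤ 1 / 8 * t := by gcongr; nlinarith
  set z := x + (t / 4) • ν with hz
  have hxz : dist x z = t / 4 := by
    rw [hz, dist_self_add_right, norm_smul, hν, mul_one, Real.norm_of_nonneg (by linarith)]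
  rw [Metric.mem_ball] at hx
  refine ⟨hxΩ, z, fun y hy => ?_, by linarith⟩
  rw [Metric.mem_ball] at hy
  have hyU : y ∈ U := hs <| by
    rw [Metric.mem_ball]
    have := dist_triangle4 y z x x₀
    rw [dist_comm z x] at this
    linarith
  have hxU' : x ∈ U := hs (Metric.ball_subset_ball (by linarith) hx)
  rw [hiff y hyU]
  rw [hiff x hxU'] at hxΩ
  set e := y - z with he
  have hen : ‖e‖ < c * t := by rwa [he, ← dist_eq_norm]
  have hνe : |inner ℝ ν e| ≤ ‖e‖ := by simpa [hν] using abs_real_inner_le_norm ν e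
  have hy : y = x + (t / 4) • ν + e := by rw [he, ← hz]; abel
  have hνν : inner ℝ ν ν = (1 : ℝ) := by rw [real_inner_self_eq_norm_sq, hν]; norm_num
  have hin : inner ℝ ν y = inner ℝ ν x + t / 4 + inner ℝ ν e := by
    rw [hy, inner_add_right, inner_add_right, inner_smul_right, hνν, mul_one]
  have hproj : y - inner ℝ ν y • ν - (x - inner ℝ ν x • ν) = e - inner ℝ ν e • ν := by
    rw [hin, add_smul, add_smul]; nth_rewrite 1 [hy]; abel
  have hdist : dist (y - inner ℝ ν y • ν) (x - inner ℝ ν x • ν) ≤ 2 * (c * t) := by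
    rw [dist_eq_norm, hproj]
    have h1 := norm_sub_le e (inner ℝ ν e • ν)
    rw [norm_smul, hν, mul_one, Real.norm_eq_abs] at h1
    linarith
  have hg1 := hg.dist_le_mul (y - inner ℝ ν y • ν) (x - inner ℝ ν x • ν)
  have hg2 := (abs_le.1 ((Real.dist_eq _ _).symm.le.trans hg1)).2
  have hg3 : (K : ℝ) * dist (y - inner ℝ ν y • ν) (x - inner ℝ ν x • ν) ≤ K * (2 * (c * t)) := by
    gcongr
  have h4 := (abs_le.1 hνe).1
  have h5 : c * (8 * (1 + 2 * K)) * t = t := by rw [hc1, one_mul]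
  linarith

end CuspMetropolis

/-! ### Uniform interior balls off the cuspidal region -/

namespace CuspMetropolis

theorem le_rpow_of_mul_rpow_le {L h α x : ℝ} (hL : 0 < L) (hh : 0 ≤ h) (hα : 0 < α)
    (hx : L * h ^ (1 / α) ≤ L * x) : h ≤ x ^ α := by
  have h1 : h ^ (1 / α) ≤ x := le_of_mul_le_mul_left hx hL
  calc h = (h ^ (1 / α)) ^ α := by
        rw [← Real.rpow_mul hh, one_div_mul_cancel hα.ne', Real.rpow_one]
    _ ≤ x ^ α := Real.rpow_le_rpow (Real.rpow_nonneg hh _) h1 hα.le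

theorem le_infDist_of_notMem_cuspRegion {d : ℕ} {Ω : Set (E d)} {Ic : Type*}
    {S : Ic → Set (E d)} {α : Ic → ℝ} {C h : ℝ} {i : Ic} (hS : (S i).Nonempty) {x : E d}
    (hxΩ : x ∈ Ω) (hx : x ∉ cuspRegion Ω S α C h) :
    C * h ^ (1 / α i) ≤ Metric.infDist x (S i) := by
  by_contra! hlt
  exact hx (mem_iUnion.2 ⟨i, hxΩ, (Metric.mem_thickening_iff_infDist_lt hS).2 hlt⟩)

/-- On the closure of the cusp |x'| ≤ x₁^α, so x₁ = 0 forces x' = 0, which is the edge. This makes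
boundary points covered by a cusp chart but off its edge harmless. -/
theorem IsCuspChart.fst_pos {d d' d'' : ℕ} {Ω S : Set (E d)} {α ε r : ℝ} {p : E d}
    {φ : OpenPartialHomeomorph (E d) (ℝ × E d' × E d'')} (h : IsCuspChart Ω S α ε r p φ)
    (hα : 0 < α) {x : E d} (hx : x ∈ φ.source) (hxΩ : x ∈ closure Ω) (hxS : x ∉ S) :
    0 < (φ x).1 := by
  have hmem : φ x ∈ closure (modelCusp d' d'' α ε r) := by
    rw [← h.image_domain, inter_comm]
    refine mem_closure_image (φ.continuousAt hx) ?_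
    exact φ.open_source.inter_closure ⟨hx, hxΩ⟩
  have hsub : closure (modelCusp d' d'' α ε r) ⊆ {y | 0 ≤ y.1 ∧ ‖y.2.1‖ ≤ y.1 ^ α} := by
    refine closure_minimal (fun y hy => ⟨hy.1.le, hy.2.2.1.le⟩) ?_
    exact (isClosed_le continuous_const continuous_fst).inter
      (isClosed_le continuous_snd.fst.norm
        ((Real.continuous_rpow_const hα.le).comp continuous_fst))
  obtain ⟨h1, h2⟩ := hsub hmem
  refine h1.lt_of_ne fun h0 => hxS ?_
  rw [h.mem_edge_iff hx]
  rw [← h0, Real.zero_rpow hα.ne'] at h2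
  exact ⟨h0.symm, norm_le_zero_iff.1 h2⟩

section

variable {d : ℕ} {Ω : Set (E d)} {Ir Ic : Type*} {ωr : Ir → Set (E d)} {ωc : Ic → E d → Set (E d)}
  {S : Ic → Set (E d)} {d' d'' : Ic → ℕ} {α : Ic → ℝ}

/-- Four kinds of points occur: interior points, Lipschitz boundary points, edge points, and
boundary points in a cusp chart off the edge. Only the third kind needs the cuspidal region to be
removed. -/
theorem HasCuspidalBoundary.eventually_mem_fatPart (hΩ : HasCuspidalBoundary Ω ωr ωc S d' d'' α)
    (hΩo : IsOpen Ω) {x₀ : E d} (hx₀ : x₀ ∈ closure Ω) :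
    ∃ C > 0, ∃ c > 0, ∃ h₀ > 0, ∀ᶠ x in 𝓝 x₀, ∀ h, 0 < h → h ≤ h₀ → x ∈ Ω →
      x ∉ cuspRegion Ω S α C h → x ∈ fatPart Ω c h := by
  by_cases hx : x₀ ∈ Ω
  · obtain ⟨c, hc, h₀, hh₀, H⟩ := eventually_mem_fatPart_of_mem hΩo hx
    exact ⟨1, one_pos, c, hc, h₀, hh₀, H.mono fun x H h h1 h2 h3 _ => H h h1 h2 h3⟩
  have hfr : x₀ ∈ frontier Ω := by rw [hΩo.frontier_eq]; exact ⟨hx₀, hx⟩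
  rcases hΩ.cover hfr with hr | hc
  · obtain ⟨i, hi⟩ := mem_iUnion.1 hr
    obtain ⟨c, hc, h₀, hh₀, H⟩ := (hΩ.lipschitz i x₀ ⟨hfr, hi⟩).eventually_mem_fatPart
    exact ⟨1, one_pos, c, hc, h₀, hh₀, H.mono fun x H h h1 h2 h3 _ => H h h1 h2 h3⟩
  · simp only [mem_iUnion, exists_prop] at hc
    obtain ⟨i, p, hp, hxp⟩ := hc
    have hα := hΩ.one_lt_exponent i
    obtain ⟨r, hr, ε, hε, H⟩ := hΩ.cusp i
    by_cases hxS : x₀ ∈ S i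
    -- The chart centred at x₀ itself is used, since x₁ has been compared with the distance to the
    -- edge only near the centre. Taking C = L gives L h^{1/α} ≤ d(x, S_i) ≤ L x₁, that is h ≤ x₁^α.
    · obtain ⟨φ, -, hφ⟩ := H x₀ hxS
      obtain ⟨c, hc, h₀, hh₀, H1⟩ := hφ.eventually_mem_fatPart hα.le hε hr hφ.mem_source
      obtain ⟨L, hL, H2⟩ := hφ.eventually_infDist hα.le hxS
      refine ⟨L, by linarith, c, hc, h₀, hh₀, ?_⟩
      filter_upwards [H1, H2] with x H1 H2 h h1 h2 h3 h4
      refine H1 h h1 h2 h3 (le_rpow_of_mul_rpow_le (by linarith : 0 < L) h1.le (by linarith) ?_)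
      exact (le_infDist_of_notMem_cuspRegion ⟨x₀, hxS⟩ h3 h4).trans (H2 h3).2
    · obtain ⟨φ, hφs, hφ⟩ := H p hp
      have hxs : x₀ ∈ φ.source := by rwa [hφs]
      obtain ⟨c, hc, h₀, hh₀, H1⟩ := hφ.eventually_mem_fatPart hα.le hε hr hxs
      have hpos := hφ.fst_pos (by linarith) hxs hx₀ hxS
      have hcont : ContinuousAt (fun x => (φ x).1) x₀ :=
        continuous_fst.continuousAt.comp (φ.continuousAt hxs)
      -- Off the edge x₁ > δ near x₀, so every h ≤ δ^α satisfies h ≤ x₁^α.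
      set δ := (φ x₀).1 / 2 with hδ
      refine ⟨1, one_pos, c, hc, min h₀ (δ ^ α i), lt_min hh₀ (by positivity), ?_⟩
      filter_upwards [H1, hcont.eventually (lt_mem_nhds (half_lt_self hpos))]
        with x H1 H2 h h1 h2 h3 _
      refine H1 h h1 (h2.trans (min_le_left _ _)) h3 ((h2.trans (min_le_right _ _)).trans ?_)
      exact Real.rpow_le_rpow (by positivity) H2.le (by linarith)

/-- Outside of the cuspidal region, the domain satisfies a uniform interior ball condition at
scale `h`. -/
theorem HasCuspidalBoundary.exists_diff_cuspRegion_subset_fatPart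
    (hΩ : HasCuspidalBoundary Ω ωr ωc S d' d'' α) (hΩo : IsOpen Ω)
    (hΩb : Bornology.IsBounded Ω) :
    ∃ C > 0, ∃ c > 0, ∃ h₀ > 0, ∀ h, 0 < h → h ≤ h₀ →
      Ω \ cuspRegion Ω S α C h ⊆ fatPart Ω c h := by
  suffices H : ∃ C > 0, ∃ c > 0, ∃ h₀ > 0, ∀ x ∈ closure Ω, ∀ h, 0 < h → h ≤ h₀ → x ∈ Ω →
      x ∉ cuspRegion Ω S α C h → x ∈ fatPart Ω c h by
    obtain ⟨C, hC, c, hc, h₀, hh₀, H⟩ := H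
    exact ⟨C, hC, c, hc, h₀, hh₀, fun h h1 h2 x hx => H x (subset_closure hx.1) h h1 h2 hx.1 hx.2⟩
  -- The property passes to subsets and to finite unions, by enlarging C and decreasing c and h₀, so
  -- it need only be checked locally on the compact closure.
  refine (hΩb.isCompact_closure).induction_on (p := fun s => ∃ C > 0, ∃ c > 0, ∃ h₀ > 0, ∀ x ∈ s,
    ∀ h, 0 < h → h ≤ h₀ → x ∈ Ω → x ∉ cuspRegion Ω S α C h → x ∈ fatPart Ω c h) ?_ ?_ ?_ ?_
  · exact ⟨1, one_pos, 1, one_pos, 1, one_pos, by simp⟩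
  · rintro s t hst ⟨C, hC, c, hc, h₀, hh₀, H⟩
    exact ⟨C, hC, c, hc, h₀, hh₀, fun x hx => H x (hst hx)⟩
  · rintro s t ⟨C, hC, c, hc, h₀, hh₀, H⟩ ⟨C', hC', c', hc', h₀', hh₀', H'⟩
    refine ⟨max C C', lt_max_of_lt_left hC, min c c', lt_min hc hc', min h₀ h₀',
      lt_min hh₀ hh₀', ?_⟩
    rintro x (hx | hx) h h1 h2 h3 h4
    · exact fatPart_antitone Ω h1.le (min_le_left _ _)
        (H x hx h h1 (h2.trans (min_le_left _ _)) h3 fun h5 => h4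
          (cuspRegion_mono Ω S α h1.le (le_max_left _ _) h5))
    · exact fatPart_antitone Ω h1.le (min_le_right _ _)
        (H' x hx h h1 (h2.trans (min_le_right _ _)) h3 fun h5 => h4
          (cuspRegion_mono Ω S α h1.le (le_max_right _ _) h5))
  · intro x hx
    obtain ⟨C, hC, c, hc, h₀, hh₀, H⟩ := hΩ.eventually_mem_fatPart hΩo hx
    exact ⟨_, mem_nhdsWithin_of_mem_nhds H, C, hC, c, hc, h₀, hh₀, fun x hx => hx⟩

end

end CuspMetropolis

/-! ### Hardy's inequality in the model cusp -/

namespace CuspMetropolis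

theorem sq_lintegral_le {X : Type*} [MeasurableSpace X] {μ : Measure X} {f : X → ENNReal}
    (hf : AEMeasurable f μ) : (∫⁻ x, f x ∂μ) ^ 2 ≤ μ univ * ∫⁻ x, f x ^ 2 ∂μ := by
  have h := ENNReal.lintegral_mul_le_Lp_mul_Lq μ Real.HolderConjugate.two_two hf
    (aemeasurable_const (b := (1 : ENNReal)))
  simp only [Pi.mul_apply, mul_one, ENNReal.one_rpow, lintegral_const, one_mul] at h
  calc (∫⁻ x, f x ∂μ) ^ 2
      ≤ ((∫⁻ x, f x ^ (2 : ℝ) ∂μ) ^ (1 / 2 : ℝ) * μ univ ^ (1 / 2 : ℝ)) ^ 2 := by gcongr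
    _ = μ univ * ∫⁻ x, f x ^ 2 ∂μ := by
      have (a : ENNReal) : (a ^ (1 / 2 : ℝ)) ^ 2 = a := by
        rw [← ENNReal.rpow_natCast, ← ENNReal.rpow_mul]; norm_num
      rw [mul_pow, this, this, mul_comm]
      norm_cast

theorem add_sq_le_of_pos {η : NNReal} (hη : 0 < η) (a b : ENNReal) :
    (a + b) ^ 2 ≤ (1 + η) * a ^ 2 + (1 + ((η⁻¹ : NNReal) : ENNReal)) * b ^ 2 := by
  induction a with
  | top => simp [ENNReal.mul_top]
  | coe a =>
    induction b with
    | top => simp [ENNReal.mul_top]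
    | coe b =>
      norm_cast
      rw [← NNReal.coe_le_coe]
      push_cast
      have h1 : (0 : ℝ) < η := hη
      have h2 : (η : ℝ) * (η : ℝ)⁻¹ = 1 := mul_inv_cancel₀ h1.ne'
      have h3 : 0 ≤ (η : ℝ)⁻¹ * (η * a - b) ^ 2 := by positivity
      have h4 : (η : ℝ)⁻¹ * (η * a - b) ^ 2 =
        (η * (η : ℝ)⁻¹) * η * a ^ 2 - 2 * (η * (η : ℝ)⁻¹) * (a * b) + (η : ℝ)⁻¹ * b ^ 2 := by ring
      rw [h4, h2] at h3
      nlinarith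

/-- Absorption of q H into the left side; finiteness of H is indispensable here, and is the reason
for truncating the cusp below. -/
theorem le_mul_of_le_mul_add {H R : ENNReal} {q : NNReal} (hq : q < 1) (hH : H ≠ ⊤)
    (h : H ≤ q * H + R) : H ≤ ((1 - q)⁻¹ : NNReal) * R := by
  have hq' : 0 < 1 - q := tsub_pos_of_lt hq
  induction R with
  | top => rw [ENNReal.mul_top (by simpa using inv_ne_zero hq'.ne')]; exact le_top
  | coe R =>
    lift H to NNReal using hH
    norm_cast at h ⊢
    rw [← NNReal.coe_le_coe] at h ⊢
    rw [NNReal.coe_mul, NNReal.coe_inv, inv_mul_eq_div, le_div_iff₀ (by exact_mod_cast hq'),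
      NNReal.coe_sub hq.le]
    push_cast at h ⊢
    linarith

section dilation

variable {d' d'' : ℕ}

/-- The anisotropic dilations `(x₁, x', x'') ↦ (t x₁, t ^ α x', x'')`. -/
noncomputable def cuspDilation (d' d'' : ℕ) (α t : ℝ) (x : ℝ × E d' × E d'') : ℝ × E d' × E d'' :=
  (t • x.1, t ^ α • x.2.1, x.2.2)

/-- The Jacobian t^{1 + α d'} ignores x'' because the edge directions are not scaled. -/
theorem lintegral_comp_cuspDilation {α t : ℝ} (ht : 0 < t) (H : ℝ × E d' × E d'' → ENNReal) :
    ∫⁻ x, H (cuspDilation d' d'' α t x) = ENNReal.ofReal (t * t ^ (α * d'))⁻¹ * ∫⁻ x, H x := by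
  have ht' : 0 < t ^ α := Real.rpow_pos_of_pos ht α
  let e : ℝ × E d' × E d'' ≃ᵐ ℝ × E d' × E d'' :=
    (MeasurableEquiv.smul₀ t ht.ne').prodCongr
      ((MeasurableEquiv.smul₀ (t ^ α) ht'.ne').prodCongr (MeasurableEquiv.refl _))
  have hmap : Measure.map e volume = ENNReal.ofReal (t * t ^ (α * d'))⁻¹ • volume := by
    have h2 : Measure.map (Prod.map (t ^ α • · : E d' → E d') (id : E d'' → E d'')) volume =
        ENNReal.ofReal ((t ^ α) ^ d')⁻¹ • volume := by
      rw [Measure.volume_eq_prod, ← Measure.map_prod_map _ _ (measurable_const_smul _)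
        measurable_id, Measure.map_addHaar_smul _ ht'.ne', Measure.map_id,
        Measure.prod_smul_left, finrank_euclideanSpace_fin, abs_of_pos (by positivity)]
    have h1 : Measure.map (t • · : ℝ → ℝ) volume = ENNReal.ofReal t⁻¹ • volume := by
      rw [Measure.map_addHaar_smul _ ht.ne', Module.finrank_self, pow_one,
        abs_of_pos (by positivity)]
    have h3 : Measure.map e volume = Measure.map (Prod.map (t • · : ℝ → ℝ)
        (Prod.map (t ^ α • · : E d' → E d') (id : E d'' → E d'')))
        ((volume : Measure ℝ).prod (volume : Measure (E d' × E d''))) := rfl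
    have hm : Measurable (Prod.map (t ^ α • · : E d' → E d') (id : E d'' → E d'')) :=
      (measurable_const_smul _).prodMap measurable_id
    rw [h3, ← Measure.map_prod_map _ _ (measurable_const_smul _) hm, h1, h2,
      Measure.prod_smul_left, Measure.prod_smul_right, smul_smul, Measure.volume_eq_prod ℝ,
      ← ENNReal.ofReal_mul (by positivity)]
    congr 2
    rw [Real.rpow_mul ht.le, Real.rpow_natCast, mul_inv]
  calc ∫⁻ x, H (cuspDilation d' d'' α t x) = ∫⁻ x, H (e x) := rfl
    _ = ∫⁻ x, H x ∂(Measure.map e volume) := (lintegral_map_equiv H e).symm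
    _ = _ := by rw [hmap, lintegral_smul_measure, smul_eq_mul]

theorem measurable_cuspDilation_uncurry (α : ℝ) :
    Measurable fun z : (ℝ × E d' × E d'') × ℝ => cuspDilation d' d'' α z.2 z.1 := by
  unfold cuspDilation
  refine (measurable_snd.smul measurable_fst.fst).prodMk (Measurable.prodMk ?_ ?_)
  · exact (measurable_snd.pow_const α).smul measurable_fst.snd.fst
  · exact measurable_fst.snd.snd

/-- The part of the model cusp on which the first coordinate is at least `s`. -/
def truncatedCusp (d' d'' : ℕ) (α δ s : ℝ) : Set (ℝ × E d' × E d'') :=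
  modelCusp d' d'' α δ δ ∩ {x | s ≤ x.1}

theorem isOpen_modelCusp {α ε r : ℝ} (hα : 0 ≤ α) : IsOpen (modelCusp d' d'' α ε r) := by
  refine (isOpen_lt continuous_const continuous_fst).inter
    ((isOpen_lt continuous_fst continuous_const).inter
    ((isOpen_lt continuous_snd.fst.norm ?_).inter
      (isOpen_lt continuous_snd.snd.norm continuous_const)))
  exact (Real.continuous_rpow_const hα).comp continuous_fst

theorem measurableSet_truncatedCusp {α δ s : ℝ} (hα : 0 ≤ α) :
    MeasurableSet (truncatedCusp d' d'' α δ s) :=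
  (isOpen_modelCusp hα).measurableSet.inter (measurableSet_le measurable_const measurable_fst)

/-- The power t^α on x' matches the shape |x'| < x₁^α, so the cusp is invariant; as t ≥ 1, points
move away from the truncation x₁ = s, and t x₁ stays below δ because x₁ < δ/2. -/
theorem cuspDilation_mem_truncatedCusp {α δ s t : ℝ} (ht : t ∈ Icc (1 : ℝ) 2)
    {x : ℝ × E d' × E d''} (hx : x ∈ truncatedCusp d' d'' α δ s) (hxδ : x.1 < δ / 2) :
    cuspDilation d' d'' α t x ∈ truncatedCusp d' d'' α δ s := by
  obtain ⟨⟨h1, h2, h3, h4⟩, h5⟩ := hx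
  obtain ⟨ht1, ht2⟩ := ht
  simp only [mem_ofPred_eq] at h5
  have ht0 : 0 < t := by linarith
  have hle : x.1 ≤ t * x.1 := le_mul_of_one_le_left h1.le ht1
  refine ⟨⟨mul_pos ht0 h1, ?_, ?_, h4⟩, ?_⟩
  · change t * x.1 < δ
    nlinarith
  · change ‖t ^ α • x.2.1‖ < (t * x.1) ^ α
    have := Real.rpow_pos_of_pos ht0 α
    rw [norm_smul, Real.norm_of_nonneg this.le, Real.mul_rpow ht0.le h1.le]
    gcongr
  · change s ≤ t * x.1
    linarith

/-- The fundamental theorem of calculus along the orbit t ∈ [1, 2]. The velocity (x₁, α t^{α-1} x',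
0) has size O(x₁), since |x'| < x₁^α ≤ x₁; this factor x₁ is what cancels the Hardy weight 1/x₁. -/
theorem enorm_cuspDilation_two_sub_le {α δ s : ℝ} (hα : 1 ≤ α) (hδ : δ ≤ 1)
    {F : ℝ × E d' × E d'' → ℂ} (hF : ContDiffOn ℝ 1 F (modelCusp d' d'' α δ δ))
    {x : ℝ × E d' × E d''} (hx : x ∈ truncatedCusp d' d'' α δ s) (hxδ : x.1 < δ / 2) :
    ‖F (cuspDilation d' d'' α 2 x) - F x‖ₑ ≤ ENNReal.ofReal (α * 2 ^ α * x.1) *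
      ∫⁻ t in Icc (1 : ℝ) 2, ‖fderiv ℝ F (cuspDilation d' d'' α t x)‖ₑ := by
  have hα0 : 0 ≤ α := by linarith
  have hQ := isOpen_modelCusp (d' := d') (d'' := d'') (ε := δ) (r := δ) hα0
  have hmem : ∀ t ∈ Icc (1 : ℝ) 2, cuspDilation d' d'' α t x ∈ modelCusp d' d'' α δ δ :=
    fun t ht => (cuspDilation_mem_truncatedCusp ht hx hxδ).1
  have hγ : ContDiffOn ℝ 1 (fun t => cuspDilation d' d'' α t x) (Icc 1 2) := by
    unfold cuspDilation
    have h1 : ContDiffOn ℝ 1 (fun t : ℝ => t • x.1) (Icc 1 2) :=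
      (contDiff_id.smul contDiff_const).contDiffOn
    have h2 : ContDiffOn ℝ 1 (fun t : ℝ => t ^ α • x.2.1) (Icc 1 2) := by
      refine ContDiffOn.smul (ContDiffOn.rpow_const_of_ne contDiffOn_id fun t ht => ?_)
        contDiffOn_const
      have := ht.1
      simp only [id]
      linarith
    exact h1.prodMk (h2.prodMk contDiffOn_const)
  have hcomp : ContDiffOn ℝ 1 (fun t => F (cuspDilation d' d'' α t x)) (Icc 1 2) :=
    hF.comp hγ hmem
  have h1 := enorm_sub_le_lintegral_deriv_of_contDiffOn_Icc hcomp (by norm_num)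
  have hone : cuspDilation d' d'' α 1 x = x := by simp [cuspDilation]
  rw [hone] at h1
  refine h1.trans ?_
  rw [← lintegral_const_mul' _ _ ENNReal.ofReal_ne_top]
  refine setLIntegral_mono' measurableSet_Icc fun t ht => ?_
  obtain ⟨⟨hx1, hx2, hx3, hx4⟩, -⟩ := hx
  have ht0 : 0 < t := by linarith [ht.1]
  have hd : HasDerivAt (fun t => cuspDilation d' d'' α t x)
      ((1 : ℝ) • x.1, (α * t ^ (α - 1)) • x.2.1, 0) t := by
    unfold cuspDilation
    refine ((hasDerivAt_id t).smul_const x.1).prodMk (HasDerivAt.prodMk ?_ (hasDerivAt_const _ _))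
    exact (Real.hasDerivAt_rpow_const (Or.inl ht0.ne')).smul_const _
  have hFd : HasFDerivAt F (fderiv ℝ F (cuspDilation d' d'' α t x)) (cuspDilation d' d'' α t x) :=
    ((hF.differentiableOn one_ne_zero).differentiableAt (hQ.mem_nhds (hmem t ht))).hasFDerivAt
  have hder := hFd.comp_hasDerivAt t hd
  have heq : deriv (fun t => F (cuspDilation d' d'' α t x)) t = _ := hder.deriv
  rw [heq, mul_comm (ENNReal.ofReal _)]
  have hp1 : t ^ (α - 1) ≤ 2 ^ α := by
    calc t ^ (α - 1) ≤ t ^ α := Real.rpow_le_rpow_of_exponent_le ht.1 (by linarith)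
      _ ≤ 2 ^ α := Real.rpow_le_rpow ht0.le ht.2 hα0
  have hp2 : x.1 ^ α ≤ x.1 := by
    calc x.1 ^ α ≤ x.1 ^ (1 : ℝ) := Real.rpow_le_rpow_of_exponent_ge hx1 (by linarith) hα
      _ = x.1 := Real.rpow_one _
  have hp3 : (1 : ℝ) ≤ 2 ^ α := Real.one_le_rpow (by norm_num) hα0
  have hn : ‖(((1 : ℝ) • x.1, (α * t ^ (α - 1)) • x.2.1, 0) : ℝ × E d' × E d'')‖ ≤
      α * 2 ^ α * x.1 := by
    have hpos : 0 < t ^ (α - 1) := Real.rpow_pos_of_pos ht0 _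
    rw [Prod.norm_def, Prod.norm_def]
    simp only [one_smul, norm_zero]
    refine max_le ?_ (max_le ?_ (by positivity))
    · rw [Real.norm_of_nonneg hx1.le]
      exact le_mul_of_one_le_left hx1.le (one_le_mul_of_one_le_of_one_le hα hp3)
    · rw [norm_smul, Real.norm_of_nonneg (by positivity)]
      gcongr
      exact hx3.le.trans hp2
  refine (ContinuousLinearMap.le_opENorm _ _).trans ?_
  gcongr
  rw [← ofReal_norm]
  exact ENNReal.ofReal_le_ofReal hn

/-- With H the weighted integral, replacing F(x) by F at the point dilated by 2 gives H ≤ (1 + η) q₀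
H plus a multiple of the H¹ norm, and the first term is absorbed. The part x₁ ≥ δ/2, where the
dilation would leave the cusp, has bounded weight. The constant does not depend on the truncation s;
this gives uniformity in h later. -/
theorem exists_lintegral_truncatedCusp_le (d'' : ℕ) {α δ : ℝ} (hα : 1 ≤ α) (hd' : 1 < α * d')
    (hδ0 : 0 < δ) (hδ : δ ≤ 1) :
    ∃ B : NNReal, ∀ s > 0, ∀ F : ℝ × E d' × E d'' → ℂ,
      ContDiffOn ℝ 1 F (modelCusp d' d'' α δ δ) →
      ∫⁻ x in truncatedCusp d' d'' α δ s, (‖F x‖ₑ * (ENNReal.ofReal x.1)⁻¹) ^ 2 ≤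
        B * ∫⁻ x in truncatedCusp d' d'' α δ s, (‖F x‖ₑ ^ 2 + ‖fderiv ℝ F x‖ₑ ^ 2) := by
  have hα0 : 0 ≤ α := by linarith
  -- The weight 1/x₁² gains a factor 4 under the dilation by 2 and the change of variables a factor
  -- 2^{-(1 + α d')}; their product is q₀, and q₀ < 1 exactly when α d' > 1.
  set q₀ : NNReal := Real.toNNReal (2 ^ (1 - α * d')) with hq₀
  have hq₀c : (q₀ : ℝ) = 2 ^ (1 - α * d') := Real.coe_toNNReal _ (by positivity)
  have hq₀1 : q₀ < 1 := by
    rw [← NNReal.coe_lt_coe, hq₀c]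
    exact Real.rpow_lt_one_of_one_lt_of_neg (by norm_num) (by linarith)
  obtain ⟨η, hη, hηq⟩ : ∃ η : NNReal, 0 < η ∧ (1 + η) * q₀ < 1 := by
    have hq0 : 0 < q₀ := by
      rw [← NNReal.coe_lt_coe, hq₀c]; exact Real.rpow_pos_of_pos (by norm_num) _
    refine ⟨(q₀⁻¹ - 1) / 2, ?_, ?_⟩
    · have : 1 < q₀⁻¹ := (one_lt_inv₀ hq0).2 hq₀1
      have := tsub_pos_of_lt this
      positivity
    · have h1 : 1 < q₀⁻¹ := (one_lt_inv₀ hq0).2 hq₀1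
      rw [← NNReal.coe_lt_coe] at *
      push_cast [NNReal.coe_sub h1.le]
      push_cast at hq₀1 hq0 h1
      have : (q₀ : ℝ)⁻¹ * q₀ = 1 := inv_mul_cancel₀ hq0.ne'
      nlinarith
  set K : NNReal := Real.toNNReal (α * 2 ^ α) with hK
  refine ⟨(1 - (1 + η) * q₀)⁻¹ * ((1 + η⁻¹) * K ^ 2 + (Real.toNNReal (δ / 2))⁻¹ ^ 2),
    fun s hs F hF => ?_⟩
  set W := truncatedCusp d' d'' α δ s with hW
  have hWm : MeasurableSet W := measurableSet_truncatedCusp hα0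
  set R := ∫⁻ x in W, (‖F x‖ₑ ^ 2 + ‖fderiv ℝ F x‖ₑ ^ 2) with hR
  set w : ℝ × E d' × E d'' → ENNReal := fun x => (ENNReal.ofReal x.1)⁻¹ with hw
  set H := ∫⁻ x in W, (‖F x‖ₑ * w x) ^ 2 with hH
  have hFR : ∫⁻ x in W, ‖F x‖ₑ ^ 2 ≤ R := lintegral_mono fun x => le_self_add
  have hDR : ∫⁻ x in W, ‖fderiv ℝ F x‖ₑ ^ 2 ≤ R := lintegral_mono fun x => le_add_self
  have hwle : ∀ a > 0, ∀ x : ℝ × E d' × E d'', a ≤ x.1 →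
      w x ≤ ((Real.toNNReal a)⁻¹ : NNReal) := by
    intro a ha x hax
    rw [hw, ENNReal.coe_inv (by simpa using ha)]
    exact ENNReal.inv_le_inv.2 (ENNReal.ofReal_le_ofReal hax)
  have hmulw : ∀ a > 0, ∀ T ⊆ W, MeasurableSet T → (∀ x ∈ T, a ≤ x.1) →
      ∫⁻ x in T, (‖F x‖ₑ * w x) ^ 2 ≤ (((Real.toNNReal a)⁻¹ ^ 2 : NNReal) : ENNReal) * R := by
    intro a ha T hT hTm hTa
    calc ∫⁻ x in T, (‖F x‖ₑ * w x) ^ 2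
        ≤ ∫⁻ x in T, (((Real.toNNReal a)⁻¹ ^ 2 : NNReal) : ENNReal) * ‖F x‖ₑ ^ 2 := by
          refine setLIntegral_mono' hTm fun x hx => ?_
          rw [mul_pow, mul_comm, ENNReal.coe_pow]
          gcongr
          exact hwle a ha x (hTa x hx)
      _ = (((Real.toNNReal a)⁻¹ ^ 2 : NNReal) : ENNReal) * ∫⁻ x in T, ‖F x‖ₑ ^ 2 :=
          lintegral_const_mul' _ _ ENNReal.coe_ne_top
      _ ≤ _ := by
          gcongr
          exact (lintegral_mono_set hT).trans hFR
  -- If the right side is infinite there is nothing to prove, the constant being nonzero. Otherwise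
  -- H is finite, because the weight is at most 1/s on the truncated cusp.
  rcases eq_or_ne R ⊤ with hRtop | hRtop
  · rw [hRtop, ENNReal.mul_top]
    · exact le_top
    · rw [ENNReal.coe_ne_zero]
      have h1 : (1 - (1 + η) * q₀)⁻¹ ≠ 0 := inv_ne_zero (tsub_pos_of_lt hηq).ne'
      have h2 : 0 < (Real.toNNReal (δ / 2))⁻¹ ^ 2 :=
        pow_pos (inv_pos.2 (Real.toNNReal_pos.2 (by linarith))) 2
      exact mul_ne_zero h1 (add_pos_of_nonneg_of_pos (by positivity) h2).ne'
  have hHtop : H ≠ ⊤ := ne_top_of_le_ne_top (ENNReal.mul_ne_top ENNReal.coe_ne_top hRtop)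
    (hmulw s hs W Subset.rfl hWm fun x hx => hx.2)
  set W₁ := W ∩ {x | x.1 < δ / 2} with hW₁
  set W₂ := W ∩ {x | δ / 2 ≤ x.1} with hW₂
  have hW₁m : MeasurableSet W₁ := hWm.inter (measurableSet_lt measurable_fst measurable_const)
  have hW₂m : MeasurableSet W₂ := hWm.inter (measurableSet_le measurable_const measurable_fst)
  have hcover : W ⊆ W₁ ∪ W₂ := fun x hx => by
    rcases lt_or_ge x.1 (δ / 2) with h | h
    · exact Or.inl ⟨hx, h⟩
    · exact Or.inr ⟨hx, h⟩
  -- Extending |∇F|² by zero lets the dilations act on the whole space; for t ≥ 1 the Jacobian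
  -- factor of the change of variables is at most 1.
  set D : ℝ × E d' × E d'' → ENNReal := W.indicator fun x => ‖fderiv ℝ F x‖ₑ ^ 2 with hD
  have hDm : Measurable D := ((measurable_fderiv ℝ F).enorm.pow_const 2).indicator hWm
  set P : ℝ × E d' × E d'' → ENNReal := fun x =>
    ∫⁻ t in Icc (1 : ℝ) 2, D (cuspDilation d' d'' α t x) with hP
  have hDunc : Measurable fun z : (ℝ × E d' × E d'') × ℝ => D (cuspDilation d' d'' α z.2 z.1) :=
    hDm.comp (measurable_cuspDilation_uncurry α)
  have hPm : Measurable P := hDunc.lintegral_prod_right'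
  have hPint : ∫⁻ x, P x ≤ R := by
    calc ∫⁻ x, P x
        = ∫⁻ t in Icc (1 : ℝ) 2, ∫⁻ x, D (cuspDilation d' d'' α t x) :=
          lintegral_lintegral_swap hDunc.aemeasurable
      _ ≤ ∫⁻ t in Icc (1 : ℝ) 2, ∫⁻ x, D x := by
          refine setLIntegral_mono' measurableSet_Icc fun t ht => ?_
          have ht1 : 1 ≤ t * t ^ (α * d') :=
            one_le_mul_of_one_le_of_one_le ht.1 (Real.one_le_rpow ht.1 (by linarith))
          rw [lintegral_comp_cuspDilation (by linarith [ht.1])]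
          refine mul_le_of_le_one_left (by positivity) ?_
          rw [ENNReal.ofReal_le_one]
          exact inv_le_one_of_one_le₀ ht1
      _ = ∫⁻ x, D x := by
          rw [setLIntegral_const, Real.volume_Icc]; norm_num
      _ = ∫⁻ x in W, ‖fderiv ℝ F x‖ₑ ^ 2 := lintegral_indicator hWm _
      _ ≤ R := hDR
  have hpt : ∀ x ∈ W₁, (‖F x‖ₑ * w x) ^ 2 ≤
      (1 + η) * (4 * W.indicator (fun y => (‖F y‖ₑ * w y) ^ 2) (cuspDilation d' d'' α 2 x)) +
      (1 + ((η⁻¹ : NNReal) : ENNReal)) * (K ^ 2 * P x) := by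
    rintro x ⟨hxW, hxδ⟩
    have hx1 : 0 < x.1 := hxW.1.1
    have hmem := cuspDilation_mem_truncatedCusp (t := 2) ⟨by norm_num, le_rfl⟩ hxW hxδ
    rw [indicator_of_mem hmem]
    have hw2 : w x = 2 * w (cuspDilation d' d'' α 2 x) := by
      simp only [hw, cuspDilation, smul_eq_mul]
      rw [ENNReal.ofReal_mul (by norm_num), ENNReal.mul_inv (by simp) (by simp), ← mul_assoc,
        ENNReal.ofReal_ofNat, ENNReal.mul_inv_cancel (by simp) (by simp), one_mul]
    have hdiff : ‖F (cuspDilation d' d'' α 2 x) - F x‖ₑ * w x ≤ K *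
        ∫⁻ t in Icc (1 : ℝ) 2, ‖fderiv ℝ F (cuspDilation d' d'' α t x)‖ₑ := by
      have h1 := enorm_cuspDilation_two_sub_le hα hδ hF hxW hxδ
      rw [ENNReal.ofReal_mul (by positivity)] at h1
      calc _ ≤ (ENNReal.ofReal (α * 2 ^ α) * ENNReal.ofReal x.1 *
            ∫⁻ t in Icc (1 : ℝ) 2, ‖fderiv ℝ F (cuspDilation d' d'' α t x)‖ₑ) * w x := by
              gcongr
        _ = ENNReal.ofReal (α * 2 ^ α) * (ENNReal.ofReal x.1 * w x) *
            ∫⁻ t in Icc (1 : ℝ) 2, ‖fderiv ℝ F (cuspDilation d' d'' α t x)‖ₑ := by ring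
        _ = _ := by
          rw [hw, ENNReal.mul_inv_cancel (by simpa using hx1) (by simp), mul_one]; rfl
    have hCS : (∫⁻ t in Icc (1 : ℝ) 2, ‖fderiv ℝ F (cuspDilation d' d'' α t x)‖ₑ) ^ 2 ≤ P x := by
      have hm : Measurable fun t => ‖fderiv ℝ F (cuspDilation d' d'' α t x)‖ₑ :=
        (measurable_fderiv ℝ F).enorm.comp
          ((measurable_cuspDilation_uncurry α).comp measurable_prodMk_left)
      refine (sq_lintegral_le hm.aemeasurable).trans ?_
      rw [Measure.restrict_apply_univ, Real.volume_Icc]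
      norm_num
      refine setLIntegral_mono' measurableSet_Icc fun t ht => ?_
      rw [hD, indicator_of_mem (cuspDilation_mem_truncatedCusp ht hxW hxδ)]
    have htri : ‖F x‖ₑ * w x ≤ ‖F (cuspDilation d' d'' α 2 x)‖ₑ * w x +
        ‖F (cuspDilation d' d'' α 2 x) - F x‖ₑ * w x := by
      rw [← add_mul]
      gcongr
      have := enorm_sub_le (a := F (cuspDilation d' d'' α 2 x))
        (b := F (cuspDilation d' d'' α 2 x) - F x)
      rwa [sub_sub_cancel] at this
    calc (‖F x‖ₑ * w x) ^ 2 ≤ (‖F (cuspDilation d' d'' α 2 x)‖ₑ * w x +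
          ‖F (cuspDilation d' d'' α 2 x) - F x‖ₑ * w x) ^ 2 := by gcongr
      _ ≤ _ := add_sq_le_of_pos hη _ _
      _ ≤ _ := by
        gcongr
        · rw [hw2, mul_pow, mul_pow, mul_pow]
          refine le_of_eq ?_
          ring
        · calc _ ≤ _ := pow_le_pow_left₀ (by positivity) hdiff 2
            _ ≤ _ := by rw [mul_pow]; gcongr
  have hWone : ∫⁻ x in W₁, (‖F x‖ₑ * w x) ^ 2 ≤
      ((1 + η) * q₀ : NNReal) * H + ((1 + η⁻¹) * K ^ 2 : NNReal) * R := by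
    calc ∫⁻ x in W₁, (‖F x‖ₑ * w x) ^ 2
        ≤ ∫⁻ x in W₁, ((1 + η) *
          (4 * W.indicator (fun y => (‖F y‖ₑ * w y) ^ 2) (cuspDilation d' d'' α 2 x)) +
          (1 + ((η⁻¹ : NNReal) : ENNReal)) * (K ^ 2 * P x)) := setLIntegral_mono' hW₁m hpt
      _ ≤ ∫⁻ x, ((1 + η) *
          (4 * W.indicator (fun y => (‖F y‖ₑ * w y) ^ 2) (cuspDilation d' d'' α 2 x)) +
          (1 + ((η⁻¹ : NNReal) : ENNReal)) * (K ^ 2 * P x)) := setLIntegral_le_lintegral _ _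
      _ = (1 + η) * (4 * ∫⁻ x,
            W.indicator (fun y => (‖F y‖ₑ * w y) ^ 2) (cuspDilation d' d'' α 2 x)) +
          (1 + ((η⁻¹ : NNReal) : ENNReal)) * (K ^ 2 * ∫⁻ x, P x) := by
          rw [lintegral_add_right _ ((hPm.const_mul _).const_mul _), lintegral_const_mul' _ _
            (by finiteness), lintegral_const_mul' _ _ (by finiteness), lintegral_const_mul' _ _
            (by finiteness), lintegral_const_mul' _ _ (by finiteness)]
      _ ≤ _ := by
        rw [lintegral_comp_cuspDilation (by norm_num), lintegral_indicator hWm, ← hH]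
        refine add_le_add (le_of_eq ?_) ?_
        · have : ENNReal.ofReal (2 * 2 ^ (α * d'))⁻¹ * 4 = q₀ := by
            rw [← ENNReal.ofReal_ofNat 4, ← ENNReal.ofReal_mul (by positivity),
              ENNReal.ofReal, ENNReal.coe_inj, ← NNReal.coe_inj, Real.coe_toNNReal _ (by positivity),
              hq₀c, Real.rpow_sub (by norm_num), Real.rpow_one]
            field_simp
            norm_num
          rw [← mul_assoc 4, mul_comm 4, this, ← mul_assoc]
          push_cast
          rfl
        · push_cast
          rw [mul_assoc]
          gcongr
  rw [ENNReal.coe_mul, mul_assoc]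
  refine le_mul_of_le_mul_add hηq hHtop ?_
  calc H ≤ ∫⁻ x in W₁ ∪ W₂, (‖F x‖ₑ * w x) ^ 2 := lintegral_mono_set hcover
    _ ≤ _ := lintegral_union_le _ _ _
    _ ≤ _ := add_le_add hWone (hmulw (δ / 2) (by linarith) W₂ inter_subset_left hW₂m
        fun x hx => hx.2)
    _ = _ := by push_cast; ring

end dilation

end CuspMetropolis

/-! ### Transport of Hardy's inequality through the charts -/

namespace CuspMetropolis

section lipschitz

variable {X Y : Type*} [NormedAddCommGroup X] [NormedSpace ℝ X] [FiniteDimensional ℝ X]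
  [MeasurableSpace X] [BorelSpace X] [NormedAddCommGroup Y] [NormedSpace ℝ Y]
  [FiniteDimensional ℝ Y] [MeasurableSpace Y] [BorelSpace Y]
  (μ : Measure X) [μ.IsAddHaarMeasure] (ν : Measure Y) [ν.IsAddHaarMeasure]

/-- Haar measures are multiples of the Hausdorff measure of the same dimension, which a Lipschitz
map enlarges by at most L^n. No Jacobian is needed. -/
theorem exists_addHaar_image_le_of_lipschitzOnWith
    (hdim : Module.finrank ℝ X = Module.finrank ℝ Y) (L : NNReal) :
    ∃ K : NNReal, ∀ (f : X → Y) (A : Set X), LipschitzOnWith L f A → ν (f '' A) ≤ K * μ A := by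
  have h1 := Measure.isAddLeftInvariant_eq_smul ν
    (Measure.hausdorffMeasure (Module.finrank ℝ Y) : Measure Y)
  have h2 := Measure.isAddLeftInvariant_eq_smul
    (Measure.hausdorffMeasure (Module.finrank ℝ X) : Measure X) μ
  set a := Measure.addHaarScalarFactor ν (Measure.hausdorffMeasure (Module.finrank ℝ Y))
  set b := Measure.addHaarScalarFactor
    (Measure.hausdorffMeasure (Module.finrank ℝ X) : Measure X) μ
  refine ⟨a * (L ^ Module.finrank ℝ X * b), fun f A hf => ?_⟩
  have h3 := hf.hausdorffMeasure_image_le (d := Module.finrank ℝ X) (by positivity)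
  rw [ENNReal.rpow_natCast] at h3
  rw [h1, ← hdim]
  calc (a • (Measure.hausdorffMeasure (Module.finrank ℝ X) : Measure Y)) (f '' A)
      = a * (Measure.hausdorffMeasure (Module.finrank ℝ X) : Measure Y) (f '' A) := rfl
    _ ≤ a * (L ^ Module.finrank ℝ X *
        (Measure.hausdorffMeasure (Module.finrank ℝ X) : Measure X) A) := by gcongr
    _ = a * (L ^ Module.finrank ℝ X * (b • μ) A) := by rw [h2]
    _ = ((a * (L ^ Module.finrank ℝ X * b) : NNReal) : ENNReal) * μ A := by
      push_cast
      change _ * (_ * (_ * _)) = _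
      ring

/-- The previous bound, applied to subsets of A, says that the image of ν under `φ.symm` is at most
K times μ on A; one then integrates H against both. -/
theorem exists_lintegral_image_le_of_lipschitzOnWith
    (hdim : Module.finrank ℝ X = Module.finrank ℝ Y) (L : NNReal) :
    ∃ K : NNReal, ∀ (φ : OpenPartialHomeomorph X Y) (A : Set X), A ⊆ φ.source →
      MeasurableSet A → LipschitzOnWith L φ A → ∀ H : X → ENNReal,
      AEMeasurable H (μ.restrict A) →
      ∫⁻ y in φ '' A, H (φ.symm y) ∂ν ≤ K * ∫⁻ x in A, H x ∂μ := by
  obtain ⟨K, hK⟩ := exists_addHaar_image_le_of_lipschitzOnWith μ ν hdim L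
  refine ⟨K, fun φ A hA hAm hL H hH => ?_⟩
  have hφA : MeasurableSet (φ '' A) :=
    hAm.image_of_continuousOn_injOn (φ.continuousOn.mono hA) (φ.injOn.mono hA)
  have hsub : φ '' A ⊆ φ.target := by
    rintro _ ⟨x, hx, rfl⟩; exact φ.map_source (hA hx)
  have hsymm : AEMeasurable φ.symm (ν.restrict (φ '' A)) :=
    (φ.continuousOn_symm.mono hsub).aemeasurable hφA
  have hle : Measure.map φ.symm (ν.restrict (φ '' A)) ≤ (K : ENNReal) • μ.restrict A := by
    refine Measure.le_iff.2 fun s hs => ?_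
    rw [Measure.map_apply_of_aemeasurable hsymm hs, Measure.restrict_apply₀'
      hφA.nullMeasurableSet, Measure.smul_apply, smul_eq_mul, Measure.restrict_apply hs]
    refine le_trans (measure_mono ?_) (hK φ (s ∩ A) (hL.mono inter_subset_right))
    rintro y ⟨hys, x, hx, rfl⟩
    rw [mem_preimage, φ.left_inv (hA hx)] at hys
    exact ⟨x, ⟨hys, hx⟩, rfl⟩
  have hac : Measure.map φ.symm (ν.restrict (φ '' A)) ≪ μ.restrict A :=
    (Measure.absolutelyContinuous_of_le hle).trans Measure.smul_absolutelyContinuous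
  calc ∫⁻ y in φ '' A, H (φ.symm y) ∂ν
      = ∫⁻ x, H x ∂(Measure.map φ.symm (ν.restrict (φ '' A))) :=
        (lintegral_map' (hH.mono_ac hac) hsymm).symm
    _ ≤ ∫⁻ x, H x ∂((K : ENNReal) • μ.restrict A) := lintegral_mono' hle le_rfl
    _ = _ := by rw [lintegral_smul_measure, smul_eq_mul]

end lipschitz

theorem modelCusp_subset_ball {d' d'' : ℕ} {α δ : ℝ} (hα : 1 ≤ α) (hδ : δ ≤ 1) :
    modelCusp d' d'' α δ δ ⊆ Metric.ball 0 δ := by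
  rintro y ⟨h1, h2, h3, h4⟩
  rw [mem_ball_zero_iff, Prod.norm_def, Prod.norm_def, max_lt_iff, max_lt_iff]
  refine ⟨by rwa [Real.norm_of_nonneg h1.le], ?_, h4⟩
  refine h3.trans (lt_of_le_of_lt ?_ h2)
  calc y.1 ^ α ≤ y.1 ^ (1 : ℝ) := Real.rpow_le_rpow_of_exponent_ge h1 (by linarith) hα
    _ = y.1 := Real.rpow_one _

theorem modelCusp_inter_ball_subset {d' d'' : ℕ} {α ε r δ : ℝ} :
    modelCusp d' d'' α ε r ∩ Metric.ball 0 δ ⊆ modelCusp d' d'' α δ δ := by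
  rintro y ⟨⟨h1, h2, h3, h4⟩, h5⟩
  rw [mem_ball_zero_iff, Prod.norm_def, Prod.norm_def, max_lt_iff, max_lt_iff,
    Real.norm_of_nonneg h1.le] at h5
  exact ⟨h1, h5.1, h3, h5.2.2⟩

theorem aemeasurable_enorm_sq_add {V : Type*} [NormedAddCommGroup V] [NormedSpace ℝ V]
    [MeasurableSpace V] [BorelSpace V] [FiniteDimensional ℝ V] {μ : Measure V} {g : V → ℂ}
    {Ω A : Set V} (hΩ : IsOpen Ω) (hg : ContinuousOn g Ω) (hA : A ⊆ Ω) :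
    AEMeasurable (fun x => ‖g x‖ₑ ^ 2 + ‖fderiv ℝ g x‖ₑ ^ 2) (μ.restrict A) :=
  (((hg.aemeasurable hΩ.measurableSet).enorm.pow_const 2).add
    ((measurable_fderiv ℝ g).enorm.pow_const 2).aemeasurable).mono_measure
    (Measure.restrict_mono hA le_rfl)

/-- Hardy's inequality near the edge of a cusp. -/
theorem IsCuspChart.exists_lintegral_le {d d' d'' : ℕ} {Ω S : Set (E d)} {α ε r : ℝ} {p : E d}
    {φ : OpenPartialHomeomorph (E d) (ℝ × E d' × E d'')} (h : IsCuspChart Ω S α ε r p φ)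
    (hΩ : IsOpen Ω) (hdim : 1 + d' + d'' = d) (hd' : 1 ≤ d') (hα : 1 < α) (hε : 0 < ε)
    (hr : 0 < r) (hp : p ∈ S) :
    ∃ C > 0, ∃ c > 0, ∃ h₀ > 0, ∃ B : NNReal, ∃ V ∈ 𝓝 p, ∀ t, 0 < t → t ≤ h₀ →
      ∀ g : E d → ℂ, ContDiffOn ℝ 1 g Ω →
      ∫⁻ x in V ∩ (Ω \ Metric.thickening (C * t ^ (1 / α)) S),
        (‖g x‖ₑ * (Metric.infEDist x S)⁻¹) ^ 2 ≤
        B * ∫⁻ x in fatPart Ω c t, (‖g x‖ₑ ^ 2 + ‖fderiv ℝ g x‖ₑ ^ 2) := by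
  have hSne : S.Nonempty := ⟨p, hp⟩
  have hα0 : 0 < α := by linarith
  obtain ⟨L, hL1, R, hR, hs, hφ, hs', hφ'⟩ := h.exists_lipschitz h.mem_source
  obtain ⟨c, hc, h₀, hh₀, hfat⟩ := h.eventually_mem_fatPart hα.le hε hr h.mem_source
  obtain ⟨L', hL', hdist⟩ := h.eventually_infDist hα.le hp
  obtain ⟨R₁, hR₁, hfat⟩ := Metric.eventually_nhds_iff_ball.1 hfat
  obtain ⟨R₂, hR₂, hdist⟩ := Metric.eventually_nhds_iff_ball.1 hdist
  rw [h.map_center] at hs' hφ'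
  have hL1' : (1 : ℝ) ≤ L := by exact_mod_cast hL1
  have hL0 : (0 : ℝ) < L := by linarith
  -- The inverse chart sends the small cusp into the ball of radius Lδ around p; the bounds R / L
  -- and R₁ / L keep that ball where the chart is Lipschitz and where the fat part is understood.
  obtain ⟨δ, hδ0, hδ⟩ : ∃ δ : ℝ, 0 < δ ∧
      δ ≤ min 1 (min ε (min r (min R (min (R / L) (R₁ / L))))) :=
    ⟨_, by positivity, le_rfl⟩
  simp only [le_min_iff] at hδ
  obtain ⟨hδ1, hδε, hδr, hδR, hδRL, hδR₁⟩ := hδ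
  rw [le_div_iff₀ hL0] at hδR₁ hδRL
  have hfin : Module.finrank ℝ (E d) = Module.finrank ℝ (ℝ × E d' × E d'') := by
    simp only [Module.finrank_prod, finrank_euclideanSpace_fin, Module.finrank_self]
    omega
  have hHaar₁ : (volume : Measure (E d' × E d'')).IsAddHaarMeasure :=
    inferInstanceAs ((volume : Measure (E d')).prod (volume : Measure (E d''))).IsAddHaarMeasure
  have hHaar₂ : (volume : Measure (ℝ × E d' × E d'')).IsAddHaarMeasure :=
    inferInstanceAs
      ((volume : Measure ℝ).prod (volume : Measure (E d' × E d''))).IsAddHaarMeasure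
  obtain ⟨K₁, hK₁⟩ := exists_lintegral_image_le_of_lipschitzOnWith (volume : Measure (E d))
    (volume : Measure (ℝ × E d' × E d'')) hfin L
  obtain ⟨K₂, hK₂⟩ := exists_lintegral_image_le_of_lipschitzOnWith
    (volume : Measure (ℝ × E d' × E d'')) (volume : Measure (E d)) hfin.symm L
  have hαd : 1 < α * d' := by
    have : (1 : ℝ) ≤ d' := by exact_mod_cast hd'
    nlinarith
  obtain ⟨B, hB⟩ := exists_lintegral_truncatedCusp_le d'' hα.le hαd hδ0 hδ1
  set Q := modelCusp d' d'' α δ δ with hQ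
  have hQo : IsOpen Q := isOpen_modelCusp hα0.le
  have hQball : Q ⊆ Metric.ball 0 R :=
    (modelCusp_subset_ball hα.le hδ1).trans (Metric.ball_subset_ball hδR)
  have hQt : Q ⊆ φ.target := hQball.trans hs'
  have hQm : Q ⊆ modelCusp d' d'' α ε r := fun y hy =>
    ⟨hy.1, hy.2.1.trans_le hδε, hy.2.2.1, hy.2.2.2.trans_le hδr⟩
  have hQΩ : ∀ y ∈ Q, φ.symm y ∈ Ω := fun y hy => by
    rw [h.mem_domain_iff (φ.map_target (hQt hy)), φ.right_inv (hQt hy)]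
    exact hQm hy
  have hsymm0 : φ.symm 0 = p := by rw [← h.map_center, φ.left_inv h.mem_source]
  have hQp : ∀ y ∈ Q, dist (φ.symm y) p < L * δ := fun y hy => by
    have := hφ'.dist_le_mul _ (hQball hy) _ (Metric.mem_ball_self hR)
    rw [hsymm0] at this
    refine this.trans_lt ?_
    gcongr
    exact modelCusp_subset_ball hα.le hδ1 hy
  set V := (φ.source ∩ φ ⁻¹' Metric.ball 0 δ) ∩ Metric.ball p R₂ with hV
  have hVo : IsOpen V := (φ.isOpen_inter_preimage Metric.isOpen_ball).inter Metric.isOpen_ball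
  have hpV : p ∈ V := ⟨⟨h.mem_source, by
    rw [mem_preimage, h.map_center]; exact Metric.mem_ball_self hδ0⟩, Metric.mem_ball_self hR₂⟩
  have hL'0 : 0 < L' := by linarith
  refine ⟨L', hL'0, c, hc, h₀, hh₀, Real.toNNReal L' ^ 2 * K₂ * B * L ^ 2 * K₁, V,
    hVo.mem_nhds hpV, fun t ht hth g hg => ?_⟩
  set s := t ^ (1 / α) with hs_def
  have hs0 : 0 < s := Real.rpow_pos_of_pos ht _
  set F : ℝ × E d' × E d'' → ℂ := g ∘ φ.symm with hF
  have hFC : ContDiffOn ℝ 1 F Q :=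
    hg.comp ((h.smooth_symm.of_le (by simp)).mono hQt) fun y hy => hQΩ y hy
  set W := truncatedCusp d' d'' α δ s with hW
  have hWm : MeasurableSet W := measurableSet_truncatedCusp hα0.le
  have hWQ : W ⊆ Q := inter_subset_left
  set A := V ∩ (Ω \ Metric.thickening (L' * s) S) with hA
  have hAm : MeasurableSet A := hVo.measurableSet.inter
    (hΩ.measurableSet.diff Metric.isOpen_thickening.measurableSet)
  have hAs : A ⊆ φ.source := fun x hx => hx.1.1.1
  -- The removed neighbourhood has radius L' t^{1/α} precisely so that L' t^{1/α} ≤ d(x, S) ≤ L' x₁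
  -- places φ x above the truncation s = t^{1/α}.
  have hAQ : ∀ x ∈ A, φ x ∈ W := by
    rintro x ⟨⟨⟨hx1, hx2⟩, hx3⟩, hx4, hx5⟩
    refine ⟨modelCusp_inter_ball_subset ⟨(h.mem_domain_iff hx1).1 hx4, hx2⟩, ?_⟩
    rw [Metric.mem_thickening_iff_infDist_lt hSne, not_lt] at hx5
    exact le_of_mul_le_mul_left (hx5.trans (hdist x hx3 hx4).2) hL'0
  have hBm : MeasurableSet (φ '' A) :=
    hAm.image_of_continuousOn_injOn (φ.continuousOn.mono hAs) (φ.injOn.mono hAs)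
  have hBW : φ '' A ⊆ W := by rintro _ ⟨x, hx, rfl⟩; exact hAQ x hx
  have hsymmB : φ.symm '' (φ '' A) = A := φ.symm_image_image_of_subset_source hAs
  -- comparison of the weighted norm on `A` with the model
  have step1 : ∫⁻ x in A, (‖g x‖ₑ * (Metric.infEDist x S)⁻¹) ^ 2 ≤
      (Real.toNNReal L' : ENNReal) ^ 2 * (K₂ *
        ∫⁻ y in W, (‖F y‖ₑ * (ENNReal.ofReal y.1)⁻¹) ^ 2) := by
    set G : ℝ × E d' × E d'' → ENNReal := fun y => (‖F y‖ₑ * (ENNReal.ofReal y.1)⁻¹) ^ 2 with hG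
    have hGm : AEMeasurable G (volume.restrict (φ '' A)) := by
      refine AEMeasurable.mono_measure ?_ (Measure.restrict_mono (hBW.trans hWQ) le_rfl)
      refine (((hFC.continuousOn.aemeasurable hQo.measurableSet).enorm).mul ?_).pow_const 2
      exact measurable_fst.ennreal_ofReal.inv.aemeasurable
    have h1 := hK₂ φ.symm (φ '' A) (hBW.trans (hWQ.trans hQt)) hBm
      (hφ'.mono (hBW.trans (hWQ.trans hQball))) G hGm
    rw [hsymmB, φ.symm_symm] at h1
    calc ∫⁻ x in A, (‖g x‖ₑ * (Metric.infEDist x S)⁻¹) ^ 2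
        ≤ ∫⁻ x in A, (Real.toNNReal L' : ENNReal) ^ 2 * G (φ x) := by
          refine setLIntegral_mono' hAm fun x hx => ?_
          have hFx : F (φ x) = g x := by rw [hF, Function.comp, φ.left_inv (hAs hx)]
          have hle := (hdist x hx.1.2 hx.2.1).1
          have hpos : 0 < (φ x).1 := (hAQ x hx).1.1
          rw [hG, ← mul_pow, hFx, mul_left_comm]
          gcongr
          have hedist : ENNReal.ofReal (φ x).1 ≤ Real.toNNReal L' * Metric.infEDist x S := by
            calc ENNReal.ofReal (φ x).1 ≤ ENNReal.ofReal (L' * Metric.infDist x S) :=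
                  ENNReal.ofReal_le_ofReal hle
              _ = Real.toNNReal L' * Metric.infEDist x S := by
                  rw [ENNReal.ofReal_mul hL'0.le, Metric.infDist,
                    ENNReal.ofReal_toReal (Metric.infEDist_ne_top hSne)]
                  rfl
          have hLne : (Real.toNNReal L' : ENNReal) ≠ 0 := by simpa using hL'0
          calc (Metric.infEDist x S)⁻¹
              = Real.toNNReal L' * (Real.toNNReal L' * Metric.infEDist x S)⁻¹ := by
                rw [ENNReal.mul_inv (Or.inl hLne) (Or.inl ENNReal.coe_ne_top), ← mul_assoc,
                  ENNReal.mul_inv_cancel hLne ENNReal.coe_ne_top, one_mul]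
            _ ≤ _ := by gcongr
      _ = (Real.toNNReal L' : ENNReal) ^ 2 * ∫⁻ x in A, G (φ x) :=
          lintegral_const_mul' _ _ (by finiteness)
      _ ≤ _ := by
          gcongr
          exact h1.trans (by gcongr)
  have step2 : ∫⁻ y in W, (‖F y‖ₑ ^ 2 + ‖fderiv ℝ F y‖ₑ ^ 2) ≤
      (L : ENNReal) ^ 2 * (K₁ * ∫⁻ x in fatPart Ω c t, (‖g x‖ₑ ^ 2 + ‖fderiv ℝ g x‖ₑ ^ 2)) := by
    set H : E d → ENNReal := fun x => ‖g x‖ₑ ^ 2 + ‖fderiv ℝ g x‖ₑ ^ 2 with hH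
    set A' := φ.symm '' W with hA'
    have hWt : W ⊆ φ.target := hWQ.trans hQt
    have hA'm : MeasurableSet A' := hWm.image_of_continuousOn_injOn
      (φ.continuousOn_symm.mono hWt) (φ.symm.injOn.mono hWt)
    have hA's : A' ⊆ φ.source := by rintro _ ⟨y, hy, rfl⟩; exact φ.map_target (hWt hy)
    have hA'Ω : A' ⊆ Ω := by rintro _ ⟨y, hy, rfl⟩; exact hQΩ y (hWQ hy)
    -- Points with x₁ ≥ t^{1/α} satisfy t ≤ x₁^α, so the H¹ norm is only needed on the fat part,
    -- where the local average will be controlled.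
    have hA'fat : A' ⊆ fatPart Ω c t := by
      rintro _ ⟨y, hy, rfl⟩
      refine hfat _ ?_ t ht hth (hQΩ y (hWQ hy)) ?_
      · rw [Metric.mem_ball]
        refine (hQp y (hWQ hy)).trans_le ?_
        rwa [mul_comm]
      · rw [φ.right_inv (hWt hy)]
        refine le_rpow_of_mul_rpow_le one_pos ht.le hα0 ?_
        rw [one_mul, one_mul]
        exact hy.2
    have hA'R : A' ⊆ Metric.ball p R := by
      rintro _ ⟨y, hy, rfl⟩
      rw [Metric.mem_ball]
      refine (hQp y (hWQ hy)).trans_le ?_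
      rwa [mul_comm]
    have h1 := hK₁ φ A' hA's hA'm (hφ.mono hA'R) H
      (aemeasurable_enorm_sq_add hΩ hg.continuousOn hA'Ω)
    have himg : φ '' A' = W := φ.symm.symm_image_image_of_subset_source hWt
    rw [himg] at h1
    calc ∫⁻ y in W, (‖F y‖ₑ ^ 2 + ‖fderiv ℝ F y‖ₑ ^ 2)
        ≤ ∫⁻ y in W, (L : ENNReal) ^ 2 * H (φ.symm y) := by
          refine setLIntegral_mono' hWm fun y hy => ?_
          have hyQ := hWQ hy
          have hL1e : (1 : ENNReal) ≤ (L : ENNReal) ^ 2 :=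
            one_le_pow₀ (by exact_mod_cast hL1)
          have hgd : DifferentiableAt ℝ g (φ.symm y) :=
            (hg.differentiableOn one_ne_zero).differentiableAt (hΩ.mem_nhds (hQΩ y hyQ))
          have hφd : DifferentiableAt ℝ φ.symm y :=
            (h.smooth_symm.differentiableOn (by simp)).differentiableAt
              (φ.open_target.mem_nhds (hQt hyQ))
          have hφn : ‖fderiv ℝ φ.symm y‖ₑ ≤ L := by
            rw [enorm_eq_nnnorm, ENNReal.coe_le_coe, ← NNReal.coe_le_coe]
            exact norm_fderiv_le_of_lipschitzOn ℝ (Metric.isOpen_ball.mem_nhds (hQball hyQ)) hφ'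
          have hFd : ‖fderiv ℝ F y‖ₑ ≤ L * ‖fderiv ℝ g (φ.symm y)‖ₑ := by
            rw [hF, fderiv_comp y hgd hφd, mul_comm]
            refine (ContinuousLinearMap.opENorm_comp_le _ _).trans ?_
            gcongr
          rw [hH, mul_add]
          refine add_le_add ?_ ?_
          · exact le_mul_of_one_le_left (by positivity) hL1e
          · rw [← mul_pow]; gcongr
      _ = (L : ENNReal) ^ 2 * ∫⁻ y in W, H (φ.symm y) :=
          lintegral_const_mul' _ _ (by finiteness)
      _ ≤ _ := by
          gcongr
          exact h1.trans (by gcongr)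
  calc _ ≤ _ := step1
    _ ≤ (Real.toNNReal L' : ENNReal) ^ 2 * (K₂ * (B * ((L : ENNReal) ^ 2 * (K₁ *
        ∫⁻ x in fatPart Ω c t, (‖g x‖ₑ ^ 2 + ‖fderiv ℝ g x‖ₑ ^ 2))))) := by
      gcongr
      exact (hB s hs0 F hFC).trans (by gcongr)
    _ = _ := by push_cast; ring

section

variable {d : ℕ} {Ω : Set (E d)} {Ir Ic : Type*} {ωr : Ir → Set (E d)} {ωc : Ic → E d → Set (E d)}
  {S : Ic → Set (E d)} {d' d'' : Ic → ℕ} {α : Ic → ℝ}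

/-- Hardy's inequality in a domain with cusps, relative to the edge `S i`. -/
theorem HasCuspidalBoundary.exists_lintegral_le (hΩ : HasCuspidalBoundary Ω ωr ωc S d' d'' α)
    (hΩo : IsOpen Ω) (hΩb : Bornology.IsBounded Ω) (i : Ic) :
    ∃ C > 0, ∃ c > 0, ∃ h₀ > 0, ∃ B : NNReal, ∀ h, 0 < h → h ≤ h₀ →
      ∀ g : E d → ℂ, ContDiffOn ℝ 1 g Ω →
      ∫⁻ x in Ω \ cuspRegion Ω S α C h, (‖g x‖ₑ * (Metric.infEDist x (S i))⁻¹) ^ 2 ≤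
        B * ∫⁻ x in fatPart Ω c h, (‖g x‖ₑ ^ 2 + ‖fderiv ℝ g x‖ₑ ^ 2) := by
  obtain ⟨C₁, hC₁, c₁, hc₁, h₁, hh₁, hfat⟩ :=
    hΩ.exists_diff_cuspRegion_subset_fatPart hΩo hΩb
  suffices H : ∃ C > 0, ∃ c > 0, ∃ h₀ > 0, ∃ B : NNReal, ∀ h, 0 < h → h ≤ h₀ →
      ∀ g : E d → ℂ, ContDiffOn ℝ 1 g Ω →
      ∫⁻ x in closure Ω ∩ (Ω \ cuspRegion Ω S α C h),
        (‖g x‖ₑ * (Metric.infEDist x (S i))⁻¹) ^ 2 ≤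
        B * ∫⁻ x in fatPart Ω c h, (‖g x‖ₑ ^ 2 + ‖fderiv ℝ g x‖ₑ ^ 2) by
    obtain ⟨C, hC, c, hc, h₀, hh₀, B, H⟩ := H
    refine ⟨C, hC, c, hc, h₀, hh₀, B, fun h h1 h2 g hg => ?_⟩
    have hsub : Ω \ cuspRegion Ω S α C h ⊆ closure Ω ∩ (Ω \ cuspRegion Ω S α C h) :=
      fun x hx => ⟨subset_closure hx.1, hx⟩
    exact (lintegral_mono_set hsub).trans (H h h1 h2 g hg)
  refine (hΩb.isCompact_closure).induction_on (p := fun s => ∃ C > 0, ∃ c > 0, ∃ h₀ > 0,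
    ∃ B : NNReal, ∀ h, 0 < h → h ≤ h₀ → ∀ g : E d → ℂ, ContDiffOn ℝ 1 g Ω →
      ∫⁻ x in s ∩ (Ω \ cuspRegion Ω S α C h), (‖g x‖ₑ * (Metric.infEDist x (S i))⁻¹) ^ 2 ≤
        B * ∫⁻ x in fatPart Ω c h, (‖g x‖ₑ ^ 2 + ‖fderiv ℝ g x‖ₑ ^ 2)) ?_ ?_ ?_ ?_
  · exact ⟨1, one_pos, 1, one_pos, 1, one_pos, 0, by simp⟩
  · rintro s t hst ⟨C, hC, c, hc, h₀, hh₀, B, H⟩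
    refine ⟨C, hC, c, hc, h₀, hh₀, B, fun h h1 h2 g hg => ?_⟩
    exact (lintegral_mono_set (inter_subset_inter_left _ hst)).trans (H h h1 h2 g hg)
  · rintro s t ⟨C, hC, c, hc, h₀, hh₀, B, H⟩ ⟨C', hC', c', hc', h₀', hh₀', B', H'⟩
    refine ⟨max C C', lt_max_of_lt_left hC, min c c', lt_min hc hc', min h₀ h₀',
      lt_min hh₀ hh₀', B + B', fun h h1 h2 g hg => ?_⟩
    rw [union_inter_distrib_right]
    refine (lintegral_union_le _ _ _).trans ?_
    rw [ENNReal.coe_add, add_mul]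
    refine add_le_add ?_ ?_
    · refine le_trans (lintegral_mono_set ?_)
        ((H h h1 (h2.trans (min_le_left _ _)) g hg).trans ?_)
      · gcongr
        exact cuspRegion_mono Ω S α h1.le (le_max_left _ _)
      · gcongr
        exact fatPart_antitone Ω h1.le (min_le_left _ _)
    · refine le_trans (lintegral_mono_set ?_)
        ((H' h h1 (h2.trans (min_le_right _ _)) g hg).trans ?_)
      · gcongr
        exact cuspRegion_mono Ω S α h1.le (le_max_right _ _)
      · gcongr
        exact fatPart_antitone Ω h1.le (min_le_right _ _)
  · intro x₀ _
    by_cases hx : x₀ ∈ S i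
    · obtain ⟨r, hr, ε, hε, hφ⟩ := hΩ.cusp i
      obtain ⟨φ, -, hφ⟩ := hφ x₀ hx
      obtain ⟨C, hC, c, hc, h₀, hh₀, B, V, hV, H⟩ := hφ.exists_lintegral_le hΩo (hΩ.dim_eq i)
        (hΩ.dim_pos i) (hΩ.one_lt_exponent i) hε hr hx
      refine ⟨V, mem_nhdsWithin_of_mem_nhds hV, C, hC, c, hc, h₀, hh₀, B,
        fun h h1 h2 g hg => le_trans (lintegral_mono_set ?_) (H h h1 h2 g hg)⟩
      refine inter_subset_inter_right _ fun x hx => ⟨hx.1, fun h3 => hx.2 ?_⟩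
      exact mem_iUnion.2 ⟨i, hx.1, h3⟩
    -- Away from the closed set S_i the weight is locally bounded and the inequality is trivial.
    -- With the extended distance this covers an empty S_i as well, the weight being then zero.
    · have hpos : 0 < Metric.infEDist x₀ (S i) := by
        rw [pos_iff_ne_zero, Ne, ← Metric.mem_iff_infEDist_zero_of_closed (hΩ.isClosed_edge i)]; exact hx
      obtain ⟨δ, hδ0, hδ⟩ := ENNReal.lt_iff_exists_nnreal_btwn.1 hpos
      have hδ0' : δ ≠ 0 := by rintro rfl; simp at hδ0
      have hnhds := (Metric.continuous_infEDist (s := S i)).continuousAt.eventually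
        (lt_mem_nhds hδ)
      refine ⟨_, mem_nhdsWithin_of_mem_nhds hnhds, C₁, hC₁, c₁, hc₁, h₁, hh₁, δ⁻¹ ^ 2,
        fun h h1 h2 g hg => ?_⟩
      rw [← lintegral_const_mul' _ _ ENNReal.coe_ne_top]
      refine le_trans (lintegral_mono_set (inter_subset_inter_right _ (hfat h h1 h2))) ?_
      refine le_trans (setLIntegral_mono' ((measurableSet_lt measurable_const
        Metric.continuous_infEDist.measurable).inter (isOpen_fatPart hΩo c₁ h).measurableSet)
        fun x hx => ?_) (lintegral_mono_set inter_subset_right)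
      have hinv : (Metric.infEDist x (S i))⁻¹ ≤ ((δ⁻¹ : NNReal) : ENNReal) := by
        rw [ENNReal.coe_inv hδ0', ENNReal.inv_le_inv]
        exact le_of_lt hx.1
      rw [mul_pow, mul_comm, ENNReal.coe_pow]
      gcongr
      exact le_self_add

end

end CuspMetropolis

/-! ### The Dirichlet energy as a double integral -/

namespace CuspMetropolis

section energy

variable {d : ℕ}

theorem ballDensity_nonneg (z : E d) : 0 ≤ ballDensity z :=
  mul_nonneg (inv_nonneg.2 measureReal_nonneg)
    (indicator_nonneg (fun _ _ => zero_le_one) _)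

theorem ballDensity_le (z : E d) :
    ballDensity z ≤ (volume.real (Metric.ball (0 : E d) 1))⁻¹ :=
  mul_le_of_le_one_right (inv_nonneg.2 measureReal_nonneg)
    (indicator_le_self' (fun _ _ => zero_le_one) _)

theorem measurable_ballDensity : Measurable (ballDensity (d := d)) :=
  (measurable_const.indicator Metric.isOpen_ball.measurableSet).const_mul _

theorem ballDensity_neg (z : E d) : ballDensity (-z) = ballDensity z := by
  unfold ballDensity
  congr 1
  simp only [indicator, mem_ball_zero_iff, norm_neg, Pi.one_apply]

theorem volume_real_ball_pos {x : E d} {r : ℝ} (hr : 0 < r) :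
    0 < volume.real (Metric.ball x r) :=
  ENNReal.toReal_pos (Metric.measure_ball_pos _ _ hr).ne' measure_ball_lt_top.ne

theorem volume_real_ball_eq (x : E d) {r : ℝ} (hr : 0 < r) :
    volume.real (Metric.ball x r) = r ^ d * volume.real (Metric.ball (0 : E d) 1) := by
  rw [Measure.real, Measure.addHaar_ball_of_pos _ _ hr, ENNReal.toReal_mul,
    ENNReal.toReal_ofReal (by positivity), finrank_euclideanSpace_fin]
  rfl

/-- The density of the jump measure of the Metropolis chain with respect to Lebesgue measure. -/
noncomputable def jumpDensity (ρ : E d → ℝ) (h : ℝ) (x y : E d) : ℝ :=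
  (h ^ d)⁻¹ * ballDensity (h⁻¹ • (x - y)) * min (ρ y) (ρ x)

theorem jumpDensity_comm (ρ : E d → ℝ) (h : ℝ) (x y : E d) :
    jumpDensity ρ h x y = jumpDensity ρ h y x := by
  unfold jumpDensity
  rw [min_comm, ← ballDensity_neg, ← smul_neg, neg_sub]

theorem metropolisKernel_eq {ρ : E d → ℝ} {h : ℝ} {x : E d} (hx : 0 < ρ x) (y : E d) :
    metropolisKernel ρ h x y = (ρ x)⁻¹ * jumpDensity ρ h x y := by
  unfold metropolisKernel jumpDensity
  have : min (ρ y / ρ x) 1 = (ρ x)⁻¹ * min (ρ y) (ρ x) := by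
    rw [← div_self hx.ne', min_div_div_right hx.le, div_eq_inv_mul]
  rw [this]; ring

/-- Detailed balance: ρ(x) min(ρ(y)/ρ(x), 1) = min(ρ(x), ρ(y)) is symmetric, so twice the energy is
the integral of J(x, y) |u(y) - u(x)|². On |x - y| < h the density J is at least the constant on the
left. -/
theorem lintegral_sq_sub_le_dirichletEnergy {Ω : Set (E d)} (hΩ : MeasurableSet Ω)
    (hΩfin : volume Ω ≠ ⊤) {ρ : E d → ℝ} (hρ_meas : AEMeasurable ρ (volume.restrict Ω))
    {m M : ℝ} (hm : 0 < m) (hρ : ∀ x ∈ Ω, m ≤ ρ x ∧ ρ x ≤ M) {h : ℝ} (hh : 0 < h)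
    {u : E d → ℂ} (hu : MemLp u 2 (volume.restrict Ω)) :
    ENNReal.ofReal ((h ^ d)⁻¹ * (volume.real (Metric.ball (0 : E d) 1))⁻¹ * m) *
      ∫⁻ x in Ω, ∫⁻ y in Ω ∩ Metric.ball x h, ‖u y - u x‖ₑ ^ 2 ≤
    ENNReal.ofReal (2 * dirichletEnergy Ω ρ h u) := by
  set μ : Measure (E d) := volume.restrict Ω with hμ
  have hfinμ : IsFiniteMeasure μ := ⟨by rw [hμ, Measure.restrict_apply_univ]; exact hΩfin.lt_top⟩
  have hmem : ∀ᵐ x ∂μ, x ∈ Ω := ae_restrict_mem hΩ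
  have hmem₂ : ∀ᵐ z ∂μ.prod μ, z.1 ∈ Ω ∧ z.2 ∈ Ω :=
    (Measure.quasiMeasurePreserving_fst.ae hmem).and (Measure.quasiMeasurePreserving_snd.ae hmem)
  set v := (volume.real (Metric.ball (0 : E d) 1))⁻¹ with hv
  have hv0 : 0 < v := inv_pos.2 (volume_real_ball_pos one_pos)
  set J := jumpDensity ρ h with hJ
  have hJnn : ∀ x ∈ Ω, ∀ y ∈ Ω, 0 ≤ J x y := fun x hx y hy =>
    mul_nonneg (mul_nonneg (by positivity) (ballDensity_nonneg _))
      (le_min (hm.le.trans (hρ y hy).1) (hm.le.trans (hρ x hx).1))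
  set A := (h ^ d)⁻¹ * v * M with hA
  have hJle : ∀ x ∈ Ω, ∀ y ∈ Ω, ‖J x y‖ ≤ A := fun x hx y hy => by
    rw [Real.norm_of_nonneg (hJnn x hx y hy)]
    have h0 : 0 ≤ min (ρ y) (ρ x) :=
      le_min (hm.le.trans (hρ y hy).1) (hm.le.trans (hρ x hx).1)
    have h1 : min (ρ y) (ρ x) ≤ M := (min_le_left _ _).trans (hρ y hy).2
    have h2 := ballDensity_le (h⁻¹ • (x - y))
    rw [hJ, hA, jumpDensity]
    gcongr
  have hJmeas : AEMeasurable (fun z : E d × E d => J z.1 z.2) (μ.prod μ) := by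
    refine AEMeasurable.mul (Measurable.aemeasurable ?_)
      (AEMeasurable.min hρ_meas.comp_snd hρ_meas.comp_fst)
    exact (measurable_ballDensity.comp
      ((measurable_fst.sub measurable_snd).const_smul h⁻¹)).const_mul _
  have hJmeas₁ : ∀ x, AEMeasurable (J x) μ := fun x => by
    refine AEMeasurable.mul (Measurable.aemeasurable ?_)
      (AEMeasurable.min hρ_meas aemeasurable_const)
    exact (measurable_ballDensity.comp
      ((measurable_const.sub measurable_id).const_smul h⁻¹)).const_mul _
  have hu1 : Integrable u μ := hu.integrable (by norm_num)
  -- Φ integrates to the form itself, and the sum of Φ and its mirror image under x ↔ y is J |u(y) -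
  -- u(x)|². Integrability holds because J is bounded, Ω has finite volume and u is in L².
  set Φ : E d × E d → ℂ := fun z =>
    (J z.1 z.2 : ℂ) * ((u z.1 - u z.2) * (starRingEnd ℂ) (u z.1)) with hΦ
  have huconj : Integrable (fun x => (starRingEnd ℂ) (u x)) μ :=
    (Complex.conjLIE.toContinuousLinearEquiv.toContinuousLinearMap).integrable_comp hu1
  have huu : Integrable (fun x => u x * (starRingEnd ℂ) (u x)) μ := by
    have : (fun x => u x * (starRingEnd ℂ) (u x)) = fun x => ((‖u x‖ ^ 2 : ℝ) : ℂ) := by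
      funext x; rw [Complex.mul_conj']; push_cast; rfl
    rw [this]
    exact (hu.integrable_norm_pow (by norm_num)).ofReal
  have hbase : Integrable (fun z : E d × E d => (u z.1 - u z.2) * (starRingEnd ℂ) (u z.1))
      (μ.prod μ) := by
    have h1 : Integrable (fun z : E d × E d => (u z.1 * (starRingEnd ℂ) (u z.1)) * (1 : ℂ))
      (μ.prod μ) := huu.mul_prod (integrable_const (1 : ℂ))
    have h2 : Integrable (fun z : E d × E d => (starRingEnd ℂ) (u z.1) * u z.2)
      (μ.prod μ) := huconj.mul_prod hu1
    refine (h1.sub h2).congr (Eventually.of_forall fun z => ?_)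
    simp only [Pi.sub_apply]
    ring
  have hΦint : Integrable Φ (μ.prod μ) := by
    refine hbase.bdd_mul (c := A)
      (Complex.measurable_ofReal.comp_aemeasurable hJmeas).aestronglyMeasurable ?_
    filter_upwards [hmem₂] with z hz
    rw [Complex.norm_real]
    exact hJle _ hz.1 _ hz.2
  have hΦswap : Integrable (fun z : E d × E d => Φ z.swap) (μ.prod μ) := hΦint.swap
  have hΦsum : Integrable (fun z : E d × E d => Φ z + Φ z.swap) (μ.prod μ) := hΦint.add hΦswap
  have hform : dirichletForm Ω ρ h u u = ∫ z, Φ z ∂(μ.prod μ) := by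
    rw [integral_prod _ hΦint]
    refine setIntegral_congr_fun hΩ fun x hx => ?_
    have hρx : 0 < ρ x := hm.trans_le (hρ x hx).1
    have hJ1 : Integrable (fun y => (J x y : ℂ)) μ := by
      refine (Integrable.of_bound (hJmeas₁ x).aestronglyMeasurable A ?_).ofReal
      filter_upwards [hmem] with y hy using hJle x hx y hy
    have hJu : Integrable (fun y => (J x y : ℂ) * u y) μ := by
      refine hu1.bdd_mul (c := A)
        (Complex.measurable_ofReal.comp_aemeasurable (hJmeas₁ x)).aestronglyMeasurable ?_
      filter_upwards [hmem] with y hy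
      rw [Complex.norm_real]
      exact hJle x hx y hy
    have hk1 : ((∫ y in Ω, metropolisKernel ρ h x y : ℝ) : ℂ) =
        (ρ x : ℂ)⁻¹ * ∫ y, (J x y : ℂ) ∂μ := by
      rw [← integral_const_mul, ← integral_complex_ofReal]
      congr 1; funext y
      rw [metropolisKernel_eq hρx]; push_cast; rfl
    have hk2 : ∫ y in Ω, (metropolisKernel ρ h x y : ℂ) * u y =
        (ρ x : ℂ)⁻¹ * ∫ y, (J x y : ℂ) * u y ∂μ := by
      rw [← integral_const_mul]
      congr 1; funext y
      rw [metropolisKernel_eq hρx]; push_cast; ring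
    have hRHS : ∫ y, Φ (x, y) ∂μ = ((∫ y, (J x y : ℂ) ∂μ) * u x -
        ∫ y, (J x y : ℂ) * u y ∂μ) * (starRingEnd ℂ) (u x) := by
      rw [← integral_mul_const, ← integral_sub (hJ1.mul_const _) hJu, ← integral_mul_const]
      congr 1; funext y
      simp only [hΦ]
      ring
    simp only [metropolisOp, holdingProb]
    rw [hRHS]
    push_cast
    rw [hk1, hk2]
    have hρc : (ρ x : ℂ) ≠ 0 := by exact_mod_cast hρx.ne'
    field_simp
    ring
  set Ψ : E d × E d → ℝ := fun z => J z.1 z.2 * ‖u z.2 - u z.1‖ ^ 2 with hΨ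
  have hΨeq : ∀ z, Ψ z = (Φ z + Φ z.swap).re := fun z => by
    have h1 : Φ z + Φ z.swap =
        (J z.1 z.2 : ℂ) * ((u z.2 - u z.1) * (starRingEnd ℂ) (u z.2 - u z.1)) := by
      simp only [hΦ, Prod.fst_swap, Prod.snd_swap, map_sub]
      rw [hJ, jumpDensity_comm ρ h z.2 z.1]
      ring
    rw [h1, Complex.mul_conj', ← Complex.ofReal_pow, ← Complex.ofReal_mul, Complex.ofReal_re]
  have hΨint : Integrable Ψ (μ.prod μ) := by
    have : Integrable (fun z => (Φ z + Φ z.swap).re) (μ.prod μ) := hΦsum.re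
    exact this.congr (Eventually.of_forall fun z => (hΨeq z).symm)
  have hΨtot : ∫ z, Ψ z ∂(μ.prod μ) = 2 * dirichletEnergy Ω ρ h u := by
    have h1 : ∫ z, Ψ z ∂(μ.prod μ) = (∫ z, (Φ z + Φ z.swap) ∂(μ.prod μ)).re := by
      rw [← RCLike.re_eq_complex_re, ← integral_re hΦsum]
      exact integral_congr_ae (Eventually.of_forall hΨeq)
    rw [h1, integral_add hΦint hΦswap]
    have h2 : ∫ z, Φ z.swap ∂(μ.prod μ) = ∫ z, Φ z ∂(μ.prod μ) := integral_prod_swap Φ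
    rw [h2, ← hform, Complex.add_re, dirichletEnergy]
    ring
  have hΨnn : 0 ≤ᵐ[μ.prod μ] Ψ := by
    filter_upwards [hmem₂] with z hz
    exact mul_nonneg (hJnn _ hz.1 _ hz.2) (by positivity)
  rw [← hΨtot, ofReal_integral_eq_lintegral_ofReal hΨint hΨnn,
    lintegral_prod _ hΨint.aestronglyMeasurable.aemeasurable.ennreal_ofReal,
    ← lintegral_const_mul' _ _ ENNReal.ofReal_ne_top]
  refine setLIntegral_mono' hΩ fun x hx => ?_
  rw [← lintegral_const_mul' _ _ ENNReal.ofReal_ne_top]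
  refine le_trans ?_ (lintegral_mono_set inter_subset_left : ∫⁻ y in Ω ∩ Metric.ball x h,
    ENNReal.ofReal (Ψ (x, y)) ≤ _)
  refine setLIntegral_mono' (hΩ.inter Metric.isOpen_ball.measurableSet) fun y hy => ?_
  obtain ⟨hyΩ, hyb⟩ := hy
  have hmin : m ≤ min (ρ y) (ρ x) := le_min (hρ y hyΩ).1 (hρ x hx).1
  have hball : h⁻¹ • (x - y) ∈ Metric.ball (0 : E d) 1 := by
    rw [mem_ball_zero_iff, norm_smul, Real.norm_of_nonneg (by positivity),
      ← dist_eq_norm, dist_comm, inv_mul_lt_iff₀ hh, mul_one]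
    exact hyb
  have hbd : ballDensity (h⁻¹ • (x - y)) = v := by
    rw [ballDensity, indicator_of_mem hball]; simp [hv]
  have hJge : (h ^ d)⁻¹ * v * m ≤ J x y := by
    rw [hJ, jumpDensity, hbd]
    gcongr
  simp only [hΨ]
  rw [ENNReal.ofReal_mul (hJnn x hx y hyΩ), ENNReal.ofReal_pow (norm_nonneg _), ofReal_norm]
  gcongr

end energy

end CuspMetropolis

/-! ### Averages at scale h -/

namespace CuspMetropolis

variable {d : ℕ}

/-- A smooth bump function equal to `1` on the ball of radius `h / 2` and supported in the ball of
radius `h`. -/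
noncomputable def bumpAt (h : ℝ) (z : E d) : ℝ :=
  (⟨1 / 2, 3 / 4, by norm_num, by norm_num⟩ : ContDiffBump (0 : E d)) (h⁻¹ • z)

theorem contDiff_bumpAt (h : ℝ) : ContDiff ℝ ∞ (bumpAt (d := d) h) :=
  (ContDiffBump.contDiff _).comp (contDiff_const_smul _)

theorem bumpAt_nonneg (h : ℝ) (z : E d) : 0 ≤ bumpAt h z := ContDiffBump.nonneg _

theorem bumpAt_le_one (h : ℝ) (z : E d) : bumpAt h z ≤ 1 := ContDiffBump.le_one _

theorem bumpAt_eq_one {h : ℝ} (hh : 0 < h) {z : E d} (hz : ‖z‖ ≤ h / 2) : bumpAt h z = 1 := by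
  refine ContDiffBump.one_of_mem_closedBall _ ?_
  rw [mem_closedBall_zero_iff, norm_smul, Real.norm_of_nonneg (by positivity),
    inv_mul_le_iff₀ hh]
  simp only
  linarith

theorem bumpAt_eq_zero {h : ℝ} (hh : 0 < h) {z : E d} (hz : 3 / 4 * h ≤ ‖z‖) :
    bumpAt h z = 0 := by
  refine ContDiffBump.zero_of_le_dist _ ?_
  rw [dist_zero_right, norm_smul, Real.norm_of_nonneg (by positivity), le_inv_mul_iff₀ hh]
  simp only
  linarith

theorem hasCompactSupport_bumpAt {h : ℝ} (hh : 0 < h) :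
    HasCompactSupport (bumpAt (d := d) h) := by
  refine HasCompactSupport.of_support_subset_isCompact (isCompact_closedBall (0 : E d) h)
    fun z hz => ?_
  rw [mem_closedBall_zero_iff]
  by_contra! hlt
  exact hz (bumpAt_eq_zero hh (by linarith))

theorem fderiv_bumpAt_eq_zero {h : ℝ} (hh : 0 < h) {z : E d} (hz : h ≤ ‖z‖) :
    fderiv ℝ (bumpAt h) z = 0 := by
  have : bumpAt (d := d) h =ᶠ[𝓝 z] fun _ => 0 := by
    filter_upwards [continuous_norm.continuousAt.eventually
      (lt_mem_nhds (show 3 / 4 * h < ‖z‖ by linarith))] with y hy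
    exact bumpAt_eq_zero hh hy.le
  rw [this.fderiv_eq, fderiv_const_apply]

theorem exists_norm_fderiv_bumpAt_le (d : ℕ) :
    ∃ C > 0, ∀ h > 0, ∀ z : E d, ‖fderiv ℝ (bumpAt h) z‖ ≤ C * h⁻¹ := by
  have hone : ∀ h : ℝ, ∀ z : E d, bumpAt h z = bumpAt 1 (h⁻¹ • z) := fun h z => by
    simp [bumpAt]
  obtain ⟨C, hC⟩ := ((contDiff_bumpAt (d := d) 1).continuous_fderiv (by simp)).norm
    |>.bddAbove_range_of_hasCompactSupport ((hasCompactSupport_bumpAt one_pos).fderiv ℝ).norm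
  refine ⟨max C 1, by positivity, fun h hh z => ?_⟩
  have heq : bumpAt (d := d) h = fun z => bumpAt 1 (h⁻¹ • z) := funext (hone h)
  rw [heq, fderiv_comp_smul, norm_smul, Real.norm_of_nonneg (by positivity), mul_comm]
  gcongr
  exact (hC ⟨_, rfl⟩).trans (le_max_left _ _)

section mollify

variable {V : Type*} [NormedAddCommGroup V] [NormedSpace ℝ V]

/-- The (unnormalized) local average of `v` at scale `h`. -/
noncomputable def mollify (h : ℝ) (v : E d → V) (x : E d) : V := ∫ y, bumpAt h (x - y) • v y

theorem mollify_eq_convolution (h : ℝ) (v : E d → V) :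
    mollify h v = convolution v (bumpAt h) (ContinuousLinearMap.lsmul ℝ ℝ).flip volume := rfl

theorem contDiff_mollify {h : ℝ} (hh : 0 < h) {v : E d → V} (hv : LocallyIntegrable v) :
    ContDiff ℝ ∞ (mollify h v) := by
  rw [mollify_eq_convolution]
  exact (hasCompactSupport_bumpAt hh).contDiff_convolution_right _ hv
    (contDiff_bumpAt h)

theorem integrable_bumpAt_smul (h : ℝ) {v : E d → V} (hv : Integrable v) (x : E d) :
    Integrable fun y => bumpAt h (x - y) • v y := by
  refine hv.bdd_smul 1 ?_ (Eventually.of_forall fun y => ?_)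
  · exact ((contDiff_bumpAt h).continuous.comp
      (continuous_const.sub continuous_id)).aestronglyMeasurable
  · rw [Real.norm_of_nonneg (bumpAt_nonneg _ _)]
    exact bumpAt_le_one _ _

theorem norm_mollify_le {h : ℝ} (hh : 0 < h) {v : E d → V} (hv : Integrable v) (x : E d) :
    ‖mollify h v x‖ ≤ ∫ y in Metric.ball x h, ‖v y‖ := by
  rw [← integral_indicator Metric.isOpen_ball.measurableSet]
  refine norm_integral_le_of_norm_le
    (hv.norm.indicator Metric.isOpen_ball.measurableSet) (Eventually.of_forall fun y => ?_)
  by_cases hy : y ∈ Metric.ball x h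
  · rw [indicator_of_mem hy, norm_smul, Real.norm_of_nonneg (bumpAt_nonneg _ _)]
    exact mul_le_of_le_one_left (norm_nonneg _) (bumpAt_le_one _ _)
  · rw [indicator_of_notMem hy, bumpAt_eq_zero hh, zero_smul, norm_zero]
    rw [Metric.mem_ball, not_lt, dist_comm, dist_eq_norm] at hy
    linarith

theorem norm_fderiv_mollify_le {C : ℝ}
    (hC : ∀ h > 0, ∀ z : E d, ‖fderiv ℝ (bumpAt h) z‖ ≤ C * h⁻¹) {h : ℝ} (hh : 0 < h)
    {v : E d → V} (hv : LocallyIntegrable v) (x : E d) :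
    ‖fderiv ℝ (mollify h v) x‖ ≤ C * h⁻¹ * ∫ y in Metric.ball x h, ‖v y‖ := by
  have hd := (hasCompactSupport_bumpAt hh).hasFDerivAt_convolution_right
    (ContinuousLinearMap.lsmul ℝ ℝ : ℝ →L[ℝ] V →L[ℝ] V).flip hv
    ((contDiff_bumpAt (d := d) h).of_le (by simp)) x
  rw [mollify_eq_convolution, hd.fderiv, ← integral_const_mul,
    ← integral_indicator Metric.isOpen_ball.measurableSet]
  have hvb : IntegrableOn v (Metric.ball x h) :=
    (hv.integrableOn_isCompact (isCompact_closedBall x h)).mono_set Metric.ball_subset_closedBall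
  refine norm_integral_le_of_norm_le
    ((integrable_indicator_iff Metric.isOpen_ball.measurableSet).2 (hvb.norm.const_mul _))
    (Eventually.of_forall fun y => ?_)
  by_cases hy : y ∈ Metric.ball x h
  · rw [indicator_of_mem hy]
    refine ContinuousLinearMap.opNorm_le_bound _ ?_ fun w => ?_
    · exact mul_nonneg ((norm_nonneg _).trans (hC h hh 0)) (norm_nonneg _)
    · change ‖(fderiv ℝ (bumpAt h) (x - y) w) • v y‖ ≤ _
      rw [norm_smul]
      calc _ ≤ (‖fderiv ℝ (bumpAt h) (x - y)‖ * ‖w‖) * ‖v y‖ := by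
            gcongr; exact ContinuousLinearMap.le_opNorm _ _
        _ ≤ (C * h⁻¹ * ‖w‖) * ‖v y‖ := by gcongr; exact hC h hh _
        _ = _ := by ring
  · rw [indicator_of_notMem hy, fderiv_bumpAt_eq_zero hh, map_zero, norm_zero]
    rwa [Metric.mem_ball, not_lt, dist_comm, dist_eq_norm] at hy

end mollify

/-- The mass of the bump function of scale `h` centred at `x` inside of `Ω`. -/
noncomputable def localMass (Ω : Set (E d)) (h : ℝ) : E d → ℝ :=
  mollify h (Ω.indicator fun _ => (1 : ℝ))

/-- The average of `u` at scale `h` inside of `Ω`. -/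
noncomputable def localAverage (Ω : Set (E d)) (h : ℝ) (u : E d → ℂ) (x : E d) : ℂ :=
  (localMass Ω h x)⁻¹ • mollify h (Ω.indicator u) x

section average

variable {Ω : Set (E d)} {h : ℝ}

theorem integrable_indicator_const {V : Type*} [NormedAddCommGroup V] (hΩ : MeasurableSet Ω)
    (hΩfin : volume Ω ≠ ⊤) (a : V) : Integrable (Ω.indicator fun _ => a) :=
  (integrable_indicator_iff hΩ).2 (integrableOn_const hΩfin)

theorem volume_real_le_localMass (hΩ : MeasurableSet Ω) (hΩfin : volume Ω ≠ ⊤) (hh : 0 < h)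
    {A : Set (E d)} {x : E d} (hA : MeasurableSet A) (hAΩ : A ⊆ Ω)
    (hAx : A ⊆ Metric.ball x (h / 2)) : volume.real A ≤ localMass Ω h x := by
  have h1 : volume.real A = ∫ y, A.indicator (fun _ => (1 : ℝ)) y := by
    rw [integral_indicator hA, setIntegral_const, smul_eq_mul, mul_one]
  rw [h1, localMass, mollify]
  refine integral_mono ?_ (integrable_bumpAt_smul h (integrable_indicator_const hΩ hΩfin 1) x) ?_
  · exact integrable_indicator_const hA (ne_top_of_le_ne_top hΩfin (measure_mono hAΩ)) 1
  · intro y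
    by_cases hy : y ∈ A
    · simp only [indicator_of_mem hy, indicator_of_mem (hAΩ hy)]
      rw [bumpAt_eq_one hh, one_smul]
      have := hAx hy
      rw [Metric.mem_ball, dist_comm, dist_eq_norm] at this
      exact this.le
    · simp only [indicator_of_notMem hy]
      exact mul_nonneg (bumpAt_nonneg _ _) (indicator_nonneg (fun _ _ => zero_le_one) _)

/-- The mass is positive at every point of Ω, so the average is smooth on all of Ω; the quantitative
lower bound h^d is available only on the fat part. -/
theorem localMass_pos (hΩ : IsOpen Ω) (hΩfin : volume Ω ≠ ⊤) (hh : 0 < h) {x : E d}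
    (hx : x ∈ Ω) : 0 < localMass Ω h x := by
  have hop : IsOpen (Ω ∩ Metric.ball x (h / 2)) := hΩ.inter Metric.isOpen_ball
  refine lt_of_lt_of_le ?_ (volume_real_le_localMass hΩ.measurableSet hΩfin hh hop.measurableSet
    inter_subset_left inter_subset_right)
  refine ENNReal.toReal_pos ?_ (ne_top_of_le_ne_top hΩfin (measure_mono inter_subset_left))
  exact (hop.measure_pos volume ⟨x, hx, Metric.mem_ball_self (by linarith)⟩).ne'

theorem le_localMass_of_mem_fatPart (hΩ : IsOpen Ω) (hΩfin : volume Ω ≠ ⊤) (hh : 0 < h) {c : ℝ}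
    (hc : 0 < c) {x : E d} (hx : x ∈ fatPart Ω c h) :
    c ^ d * volume.real (Metric.ball (0 : E d) 1) * h ^ d ≤ localMass Ω h x := by
  obtain ⟨-, z, hz, hd⟩ := hx
  have := volume_real_le_localMass (x := x) hΩ.measurableSet hΩfin hh
    Metric.isOpen_ball.measurableSet hz fun y hy => by
      rw [Metric.mem_ball] at *
      have := dist_triangle_right y x z
      linarith
  rw [volume_real_ball_eq z (by positivity), mul_pow] at this
  linarith

theorem contDiffOn_localAverage (hΩ : IsOpen Ω) (hΩfin : volume Ω ≠ ⊤) (hh : 0 < h)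
    {u : E d → ℂ} (hu : IntegrableOn u Ω) : ContDiffOn ℝ ∞ (localAverage Ω h u) Ω := by
  have h1 : ContDiffOn ℝ ∞ (fun x => (localMass Ω h x)⁻¹) Ω :=
    (contDiff_mollify hh (integrable_indicator_const hΩ.measurableSet hΩfin
      1).locallyIntegrable).contDiffOn.inv
      fun x hx => (localMass_pos hΩ hΩfin hh hx).ne'
  exact h1.smul (contDiff_mollify hh
    ((integrable_indicator_iff hΩ.measurableSet).2 hu).locallyIntegrable).contDiffOn

/-- Averages reproduce constants. With a = u(x) frozen, both the average minus u(x) and its gradient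
involve only the differences u(y) - u(x) that the energy controls. -/
theorem localAverage_eq (hΩ : IsOpen Ω) (hΩfin : volume Ω ≠ ⊤) (hh : 0 < h)
    {u : E d → ℂ} (hu : IntegrableOn u Ω) (a : ℂ) {z : E d} (hz : z ∈ Ω) :
    localAverage Ω h u z =
      a + (localMass Ω h z)⁻¹ • mollify h (Ω.indicator fun y => u y - a) z := by
  have h1 : mollify h (Ω.indicator u) z =
      mollify h (Ω.indicator fun y => u y - a) z + localMass Ω h z • a := by
    have hi : Integrable (Ω.indicator fun y => u y - a) :=
      (integrable_indicator_iff hΩ.measurableSet).2 (hu.sub (integrableOn_const hΩfin))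
    rw [localMass, mollify, mollify, mollify, ← integral_smul_const,
      ← integral_add (integrable_bumpAt_smul h hi z)
        ((integrable_bumpAt_smul h (integrable_indicator_const hΩ.measurableSet hΩfin 1) z).smul_const
          a)]
    congr 1; funext y
    by_cases hy : y ∈ Ω
    · simp only [indicator_of_mem hy, smul_eq_mul, mul_one]
      rw [← smul_add, sub_add_cancel]
    · simp [indicator_of_notMem hy]
  rw [localAverage, h1, smul_add, smul_smul, inv_mul_cancel₀ (localMass_pos hΩ hΩfin hh hz).ne',
    one_smul, add_comm]

/-- On the fat part the normalising mass is at least a constant times h^d, and each derivative of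
the bump, whether in the numerator or in the mass, costs one factor 1/h. -/
theorem exists_localAverage_bounds (d : ℕ) {c : ℝ} (hc : 0 < c) : ∃ K > 0, ∀ Ω : Set (E d),
    IsOpen Ω → volume Ω ≠ ⊤ → ∀ h > 0, ∀ u : E d → ℂ, IntegrableOn u Ω → ∀ x ∈ fatPart Ω c h,
      ‖localAverage Ω h u x - u x‖ ≤
        K * (h ^ d)⁻¹ * ∫ y in Ω ∩ Metric.ball x h, ‖u y - u x‖ ∧
      ‖fderiv ℝ (localAverage Ω h u) x‖ ≤
        K * h⁻¹ * (h ^ d)⁻¹ * ∫ y in Ω ∩ Metric.ball x h, ‖u y - u x‖ := by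
  obtain ⟨C, hC0, hC⟩ := exists_norm_fderiv_bumpAt_le d
  set v := volume.real (Metric.ball (0 : E d) 1) with hv
  have hv0 : 0 < v := volume_real_ball_pos one_pos
  set κ := c ^ d * v with hκ
  have hκ0 : 0 < κ := by positivity
  refine ⟨max κ⁻¹ (κ⁻¹ * C + κ⁻¹ ^ 2 * C * v), by positivity, ?_⟩
  intro Ω hΩ hΩfin h hh u hu x hx
  have hxΩ : x ∈ Ω := hx.1
  set w := Ω.indicator fun y => u y - u x with hw
  have hwi : Integrable w :=
    (integrable_indicator_iff hΩ.measurableSet).2 (hu.sub (integrableOn_const hΩfin))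
  set e := ∫ y in Ω ∩ Metric.ball x h, ‖u y - u x‖ with he
  have he0 : 0 ≤ e := integral_nonneg fun _ => norm_nonneg _
  have hwe : ∫ y in Metric.ball x h, ‖w y‖ = e := by
    have : (fun y => ‖w y‖) = Ω.indicator fun y => ‖u y - u x‖ := by
      funext y; rw [hw, norm_indicator_eq_indicator_norm]
    rw [this, setIntegral_indicator hΩ.measurableSet, inter_comm]
  set D := localMass Ω h with hD
  have hDx : κ * h ^ d ≤ D x := le_localMass_of_mem_fatPart hΩ hΩfin hh hc hx
  have hhd : 0 < κ * h ^ d := by positivity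
  have hDpos : 0 < D x := hhd.trans_le hDx
  have hDinv : (D x)⁻¹ ≤ κ⁻¹ * (h ^ d)⁻¹ := by
    rw [← mul_inv]
    exact inv_anti₀ hhd hDx
  have hDinv0 : 0 < (D x)⁻¹ := inv_pos.2 hDpos
  have hN : ‖mollify h w x‖ ≤ e := (norm_mollify_le hh hwi x).trans hwe.le
  have hN' : ‖fderiv ℝ (mollify h w) x‖ ≤ C * h⁻¹ * e :=
    (norm_fderiv_mollify_le hC hh hwi.locallyIntegrable x).trans (by rw [hwe])
  have hDi := integrable_indicator_const (V := ℝ) hΩ.measurableSet hΩfin 1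
  have hD' : ‖fderiv ℝ D x‖ ≤ C * h⁻¹ * (h ^ d * v) := by
    refine (norm_fderiv_mollify_le hC hh hDi.locallyIntegrable x).trans ?_
    gcongr
    calc ∫ y in Metric.ball x h, ‖Ω.indicator (fun _ => (1 : ℝ)) y‖
        ≤ ∫ y in Metric.ball x h, (1 : ℝ) := by
          refine integral_mono (hDi.norm.restrict) (integrableOn_const measure_ball_lt_top.ne)
            fun y => ?_
          by_cases hy : y ∈ Ω <;> simp [hy]
      _ = h ^ d * v := by
          rw [setIntegral_const, smul_eq_mul, mul_one, volume_real_ball_eq x hh]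
  refine ⟨?_, ?_⟩
  · rw [localAverage_eq hΩ hΩfin hh hu (u x) hxΩ, add_sub_cancel_left, norm_smul,
      Real.norm_of_nonneg hDinv0.le]
    calc (D x)⁻¹ * ‖mollify h w x‖ ≤ (κ⁻¹ * (h ^ d)⁻¹) * e := by gcongr
      _ ≤ _ := by gcongr; exact le_max_left _ _
  · have heq : localAverage Ω h u =ᶠ[𝓝 x] fun z => u x + (D z)⁻¹ • mollify h w z := by
      filter_upwards [hΩ.mem_nhds hxΩ] with z hz using localAverage_eq hΩ hΩfin hh hu (u x) hz
    have hDd : HasFDerivAt D (fderiv ℝ D x) x :=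
      ((contDiff_mollify hh hDi.locallyIntegrable).differentiable (by simp) x).hasFDerivAt
    have hNd : HasFDerivAt (mollify h w) (fderiv ℝ (mollify h w) x) x :=
      ((contDiff_mollify hh hwi.locallyIntegrable).differentiable (by simp) x).hasFDerivAt
    have hinv : HasFDerivAt (fun z => (D z)⁻¹) (-(D x ^ 2)⁻¹ • fderiv ℝ D x) x :=
      (hasDerivAt_inv hDpos.ne').comp_hasFDerivAt x hDd
    have hder := (hinv.smul hNd).const_add (u x)
    rw [heq.fderiv_eq]
    refine (congrArg norm hder.fderiv).trans_le ?_
    calc _ ≤ ‖(D x)⁻¹ • fderiv ℝ (mollify h w) x‖ +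
          ‖(-(D x ^ 2)⁻¹ • fderiv ℝ D x).smulRight (mollify h w x)‖ := norm_add_le _ _
      _ ≤ (κ⁻¹ * (h ^ d)⁻¹) * (C * h⁻¹ * e) +
          ((κ⁻¹ * (h ^ d)⁻¹) ^ 2 * (C * h⁻¹ * (h ^ d * v))) * e := by
        rw [norm_smul, Real.norm_of_nonneg hDinv0.le, ContinuousLinearMap.norm_smulRight_apply,
          norm_smul, norm_neg, Real.norm_of_nonneg (by positivity), ← inv_pow]
        gcongr
      _ = (κ⁻¹ * C + κ⁻¹ ^ 2 * C * v) * h⁻¹ * (h ^ d)⁻¹ * e := by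
        field_simp
      _ ≤ _ := by gcongr; exact le_max_right _ _

end average

end CuspMetropolis

/-! ### Energy estimates for the averages, and cutoffs -/

namespace CuspMetropolis

section estimates

variable {d : ℕ}

theorem sq_ofReal_setIntegral_norm_le {Ω : Set (E d)} {u : E d → ℂ} (hu : IntegrableOn u Ω)
    (hΩfin : volume Ω ≠ ⊤) (x : E d) {h : ℝ} (hh : 0 < h) (a : ℂ) :
    ENNReal.ofReal (∫ y in Ω ∩ Metric.ball x h, ‖u y - a‖) ^ 2 ≤
      ENNReal.ofReal (h ^ d * volume.real (Metric.ball (0 : E d) 1)) *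
        ∫⁻ y in Ω ∩ Metric.ball x h, ‖u y - a‖ₑ ^ 2 := by
  have hi : Integrable (fun y => u y - a) (volume.restrict (Ω ∩ Metric.ball x h)) :=
    ((hu.sub (integrableOn_const hΩfin)).mono_set inter_subset_left :)
  rw [ofReal_integral_norm_eq_lintegral_enorm hi]
  refine (sq_lintegral_le hi.aestronglyMeasurable.aemeasurable.enorm).trans ?_
  gcongr
  rw [Measure.restrict_apply_univ, ← volume_real_ball_eq x hh, Measure.real,
    ENNReal.ofReal_toReal measure_ball_lt_top.ne]
  exact measure_mono inter_subset_right

/-- Cauchy–Schwarz on a ball of volume of order h^d turns the pointwise bounds into the double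
integral, which the energy bounds by a multiple of h^{d+2}. The constant is independent of h and u.
-/
theorem exists_lintegral_localAverage_bounds {Ω : Set (E d)} (hΩ : IsOpen Ω)
    (hΩfin : volume Ω ≠ ⊤) {ρ : E d → ℝ} (hρ_meas : AEMeasurable ρ (volume.restrict Ω))
    {m M : ℝ} (hm : 0 < m) (hρ : ∀ x ∈ Ω, m ≤ ρ x ∧ ρ x ≤ M) {c : ℝ} (hc : 0 < c) :
    ∃ K > 0, ∀ h > 0, ∀ u : E d → ℂ, MemLp u 2 (volume.restrict Ω) →
      dirichletEnergy Ω ρ h u ≤ h ^ 2 →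
      ∫⁻ x in fatPart Ω c h, ‖localAverage Ω h u x - u x‖ₑ ^ 2 ≤ ENNReal.ofReal (K * h ^ 2) ∧
      ∫⁻ x in fatPart Ω c h, ‖fderiv ℝ (localAverage Ω h u) x‖ₑ ^ 2 ≤ ENNReal.ofReal K := by
  obtain ⟨K, hK, H⟩ := exists_localAverage_bounds d hc
  set v := volume.real (Metric.ball (0 : E d) 1) with hv
  have hv0 : 0 < v := volume_real_ball_pos one_pos
  refine ⟨2 * K ^ 2 * v ^ 2 * m⁻¹, by positivity, fun h hh u hu hE => ?_⟩
  have hfin : IsFiniteMeasure (volume.restrict Ω) :=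
    ⟨by rw [Measure.restrict_apply_univ]; exact hΩfin.lt_top⟩
  have hui : IntegrableOn u Ω := hu.integrable (by norm_num)
  have hen := lintegral_sq_sub_le_dirichletEnergy hΩ.measurableSet hΩfin hρ_meas hm hρ hh hu
  rw [← hv] at hen
  set e : E d → ENNReal := fun x => ∫⁻ y in Ω ∩ Metric.ball x h, ‖u y - u x‖ₑ ^ 2 with he
  have hen' : ENNReal.ofReal ((h ^ d)⁻¹ * v⁻¹ * m) * ∫⁻ x in Ω, e x ≤
      ENNReal.ofReal (2 * h ^ 2) := hen.trans (ENNReal.ofReal_le_ofReal (by linarith))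
  -- Used with A = K for the error, giving O(h²), and with A = K / h for the gradient, giving O(1).
  have key : ∀ (A : ℝ), 0 ≤ A → ∀ F : E d → ENNReal,
      (∀ x ∈ fatPart Ω c h,
        F x ≤ ENNReal.ofReal (A * (h ^ d)⁻¹ * ∫ y in Ω ∩ Metric.ball x h, ‖u y - u x‖)) →
      ∫⁻ x in fatPart Ω c h, F x ^ 2 ≤
        ENNReal.ofReal (A ^ 2 * v ^ 2 * m⁻¹ * (2 * h ^ 2)) := by
    intro A hA F hF
    calc ∫⁻ x in fatPart Ω c h, F x ^ 2
        ≤ ∫⁻ x in fatPart Ω c h, ENNReal.ofReal (A ^ 2 * v ^ 2 * m⁻¹) *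
            (ENNReal.ofReal ((h ^ d)⁻¹ * v⁻¹ * m) * e x) := by
          refine setLIntegral_mono' (isOpen_fatPart hΩ c h).measurableSet fun x hx => ?_
          calc F x ^ 2 ≤ ENNReal.ofReal (A * (h ^ d)⁻¹ *
                ∫ y in Ω ∩ Metric.ball x h, ‖u y - u x‖) ^ 2 := by gcongr; exact hF x hx
            _ = ENNReal.ofReal ((A * (h ^ d)⁻¹) ^ 2) *
                ENNReal.ofReal (∫ y in Ω ∩ Metric.ball x h, ‖u y - u x‖) ^ 2 := by
                rw [ENNReal.ofReal_mul (by positivity), mul_pow,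
                  ENNReal.ofReal_pow (by positivity)]
            _ ≤ ENNReal.ofReal ((A * (h ^ d)⁻¹) ^ 2) * (ENNReal.ofReal (h ^ d * v) * e x) := by
                gcongr
                exact sq_ofReal_setIntegral_norm_le hui hΩfin x hh (u x)
            _ = _ := by
                rw [← mul_assoc, ← mul_assoc, ← ENNReal.ofReal_mul (by positivity),
                  ← ENNReal.ofReal_mul (by positivity)]
                congr 2
                field_simp
      _ = ENNReal.ofReal (A ^ 2 * v ^ 2 * m⁻¹) *
            (ENNReal.ofReal ((h ^ d)⁻¹ * v⁻¹ * m) * ∫⁻ x in fatPart Ω c h, e x) := by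
          rw [lintegral_const_mul' _ _ ENNReal.ofReal_ne_top,
            lintegral_const_mul' _ _ ENNReal.ofReal_ne_top]
      _ ≤ ENNReal.ofReal (A ^ 2 * v ^ 2 * m⁻¹) * ENNReal.ofReal (2 * h ^ 2) := by
          gcongr
          refine le_trans ?_ hen'
          gcongr
          exact fatPart_subset Ω c h
      _ = _ := (ENNReal.ofReal_mul (by positivity)).symm
  constructor
  · refine (key K hK.le _ fun x hx => ?_).trans_eq ?_
    · rw [← ofReal_norm]
      exact ENNReal.ofReal_le_ofReal (H Ω hΩ hΩfin h hh u hui x hx).1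
    · congr 1; ring
  · refine (key (K * h⁻¹) (by positivity) _ fun x hx => ?_).trans_eq ?_
    · rw [← ofReal_norm]
      exact ENNReal.ofReal_le_ofReal (H Ω hΩ hΩfin h hh u hui x hx).2
    · congr 1; field_simp

end estimates

section cutoff

variable {d : ℕ}

theorem integrable_bumpAt_sub {h : ℝ} (hh : 0 < h) (x : E d) :
    Integrable fun y => bumpAt h (x - y) :=
  ((contDiff_bumpAt h).continuous.integrable_of_hasCompactSupport
    (hasCompactSupport_bumpAt hh)).comp_sub_left x

theorem le_integral_bumpAt {h : ℝ} (hh : 0 < h) :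
    (h / 2) ^ d * volume.real (Metric.ball (0 : E d) 1) ≤ ∫ y : E d, bumpAt h y := by
  rw [← volume_real_ball_eq 0 (by positivity)]
  have h1 : volume.real (Metric.ball (0 : E d) (h / 2)) =
      ∫ y, (Metric.ball (0 : E d) (h / 2)).indicator (fun _ => (1 : ℝ)) y := by
    rw [integral_indicator Metric.isOpen_ball.measurableSet, setIntegral_const, smul_eq_mul,
      mul_one]
  rw [h1]
  refine integral_mono (integrable_indicator_const Metric.isOpen_ball.measurableSet
    measure_ball_lt_top.ne 1) ((contDiff_bumpAt h).continuous.integrable_of_hasCompactSupport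
    (hasCompactSupport_bumpAt hh)) fun y => ?_
  by_cases hy : y ∈ Metric.ball (0 : E d) (h / 2)
  · rw [indicator_of_mem hy, bumpAt_eq_one hh]
    rw [mem_ball_zero_iff] at hy
    exact hy.le
  · rw [indicator_of_notMem hy]
    exact bumpAt_nonneg _ _

/-- Smooth cutoff functions of the distance to a set. -/
theorem exists_cutoff (d : ℕ) : ∃ K > 0, ∀ (S : Set (E d)) (a b : ℝ), 0 < a → a < b →
    ∃ χ : E d → ℝ, ContDiff ℝ ∞ χ ∧ (∀ x, 0 ≤ χ x) ∧ (∀ x, χ x ≤ 1) ∧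
      (∀ x ∈ Metric.thickening a S, χ x = 0) ∧ (∀ x, x ∉ Metric.thickening b S → χ x = 1) ∧
      ∀ x, ‖fderiv ℝ χ x‖ₑ ≤ ENNReal.ofReal (K * (b / (b - a))) * (Metric.infEDist x S)⁻¹ := by
  obtain ⟨C, hC0, hC⟩ := exists_norm_fderiv_bumpAt_le d
  set v := volume.real (Metric.ball (0 : E d) 1) with hv
  have hv0 : 0 < v := volume_real_ball_pos one_pos
  refine ⟨2 ^ (d + 1) * C, by positivity, fun S a b ha hab => ?_⟩
  -- The indicator of the complement of the thickening of radius (a + b)/2 is mollified at half the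
  -- gap, so the values 0 and 1 survive on the two sides.
  set η := (b - a) / 2 with hη
  have hη0 : 0 < η := by rw [hη]; linarith
  set T := Metric.thickening (a + η) S with hT
  have hTm : MeasurableSet Tᶜ := Metric.isOpen_thickening.measurableSet.compl
  set w : E d → ℝ := Tᶜ.indicator fun _ => (1 : ℝ) with hw
  have hwl : LocallyIntegrable w := (locallyIntegrable_const (1 : ℝ)).indicator hTm
  have hw0 : ∀ y, 0 ≤ w y := indicator_nonneg fun _ _ => zero_le_one
  have hw1 : ∀ y, w y ≤ 1 := indicator_le_self' fun _ _ => zero_le_one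
  set N := ∫ y : E d, bumpAt η y with hN
  have hNle : (η / 2) ^ d * v ≤ N := le_integral_bumpAt hη0
  have hN0 : 0 < N := lt_of_lt_of_le (by positivity) hNle
  have hNx : ∀ x : E d, ∫ y, bumpAt η (x - y) = N := fun x => integral_sub_left_eq_self _ _ x
  have hsm := contDiff_mollify hη0 hwl
  have hint : ∀ x, Integrable fun y => bumpAt η (x - y) • w y := fun x => by
    refine (integrable_bumpAt_sub hη0 x).mono' ?_ (Eventually.of_forall fun y => ?_)
    · exact (integrable_bumpAt_sub hη0 x).aestronglyMeasurable.smul hwl.aestronglyMeasurable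
    · rw [norm_smul, Real.norm_of_nonneg (bumpAt_nonneg _ _), Real.norm_of_nonneg (hw0 y)]
      exact mul_le_of_le_one_right (bumpAt_nonneg _ _) (hw1 y)
  have hle1 : ∀ x, mollify η w x ≤ N := fun x => by
    rw [← hNx x]
    refine integral_mono (hint x) (integrable_bumpAt_sub hη0 x) fun y => ?_
    exact mul_le_of_le_one_right (bumpAt_nonneg _ _) (hw1 y)
  have hfar : ∀ x y : E d, y ∉ Metric.ball x η → bumpAt η (x - y) = 0 := fun x y hy => by
    refine bumpAt_eq_zero hη0 ?_
    rw [Metric.mem_ball, not_lt, dist_comm, dist_eq_norm] at hy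
    linarith
  set χ : E d → ℝ := fun x => N⁻¹ * mollify η w x with hχ
  have hχsm : ContDiff ℝ ∞ χ := contDiff_const.mul hsm
  have hχ0 : ∀ x ∈ Metric.thickening a S, χ x = 0 := by
    intro x hx
    have : mollify η w x = 0 := by
      rw [mollify]
      refine integral_eq_zero_of_ae (Eventually.of_forall fun y => ?_)
      simp only [Pi.zero_apply]
      by_cases hy : y ∈ Metric.ball x η
      · have hyT : y ∈ T := by
          rw [hT]
          rw [Metric.mem_thickening_iff] at hx ⊢
          obtain ⟨z, hz, hxz⟩ := hx
          refine ⟨z, hz, ?_⟩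
          have := dist_triangle y x z
          rw [Metric.mem_ball] at hy
          linarith
        rw [hw, indicator_of_notMem (by simpa using hyT), smul_zero]
      · rw [hfar x y hy, zero_smul]
    rw [hχ]; simp only [this, mul_zero]
  have hχ1 : ∀ x, x ∉ Metric.thickening b S → χ x = 1 := by
    intro x hx
    have : mollify η w x = N := by
      rw [← hNx x, mollify]
      congr 1; funext y
      by_cases hy : y ∈ Metric.ball x η
      · have hyT : y ∈ Tᶜ := by
          intro hyT
          rw [hT, Metric.mem_thickening_iff] at hyT
          obtain ⟨z, hz, hyz⟩ := hyT
          refine hx (Metric.mem_thickening_iff.2 ⟨z, hz, ?_⟩)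
          have := dist_triangle_left x z y
          rw [Metric.mem_ball] at hy
          linarith
        rw [hw, indicator_of_mem hyT, smul_eq_mul, mul_one]
      · rw [hfar x y hy, zero_smul]
    rw [hχ]; simp only [this, inv_mul_cancel₀ hN0.ne']
  have hχd : ∀ x, ‖fderiv ℝ χ x‖ ≤ 2 ^ d * C * η⁻¹ := by
    intro x
    have h1 : fderiv ℝ χ x = N⁻¹ • fderiv ℝ (mollify η w) x :=
      fderiv_const_mul (hsm.differentiable (by simp) x) _
    have h2 : ∫ y in Metric.ball x η, ‖w y‖ ≤ η ^ d * v := by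
      calc ∫ y in Metric.ball x η, ‖w y‖ ≤ ∫ y in Metric.ball x η, (1 : ℝ) := by
            refine integral_mono ?_ (integrableOn_const measure_ball_lt_top.ne) fun y => ?_
            · exact ((hwl.integrableOn_isCompact (isCompact_closedBall x η)).mono_set
                Metric.ball_subset_closedBall).norm
            · simp only; rw [Real.norm_of_nonneg (hw0 y)]; exact hw1 y
        _ = η ^ d * v := by
            rw [setIntegral_const, smul_eq_mul, mul_one, volume_real_ball_eq x hη0]
    rw [h1, norm_smul, Real.norm_of_nonneg (by positivity)]
    calc N⁻¹ * ‖fderiv ℝ (mollify η w) x‖ ≤ ((η / 2) ^ d * v)⁻¹ * (C * η⁻¹ * (η ^ d * v)) := by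
          gcongr
          exact (norm_fderiv_mollify_le hC hη0 hwl x).trans (by gcongr)
      _ = 2 ^ d * C * η⁻¹ := by rw [div_pow]; field_simp
  refine ⟨χ, hχsm, fun x => ?_, fun x => ?_, hχ0, hχ1, fun x => ?_⟩
  · exact mul_nonneg (by positivity)
      (integral_nonneg fun y => mul_nonneg (bumpAt_nonneg _ _) (hw0 y))
  · rw [hχ]; simp only
    rw [inv_mul_le_iff₀ hN0, mul_one]; exact hle1 x
  · have hb : 0 < b := ha.trans hab
    have hba : 0 < b - a := by linarith
    -- Within distance b, the bound by a multiple of 1/η is one by (b/(b - a)) / b, hence by (b/(b -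
    -- a)) / d(x, S). Beyond b the cutoff is locally constant.
    rcases le_or_gt (Metric.infEDist x S) (ENNReal.ofReal b) with hx | hx
    · calc ‖fderiv ℝ χ x‖ₑ ≤ ENNReal.ofReal (2 ^ d * C * η⁻¹) := by
            rw [← ofReal_norm]; exact ENNReal.ofReal_le_ofReal (hχd x)
        _ = ENNReal.ofReal (2 ^ (d + 1) * C * (b / (b - a))) * (ENNReal.ofReal b)⁻¹ := by
            rw [← ENNReal.ofReal_inv_of_pos hb, ← ENNReal.ofReal_mul (by positivity)]
            congr 1
            rw [hη]; field_simp; ring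
        _ ≤ _ := by gcongr
    · have hnhds : χ =ᶠ[𝓝 x] fun _ => 1 := by
        filter_upwards [Metric.continuous_infEDist.continuousAt.eventually (lt_mem_nhds hx)]
          with y hy
        exact hχ1 y fun h => absurd (lt_trans hy h) (lt_irrefl _)
      rw [hnhds.fderiv_eq, fderiv_const_apply, ← ofReal_norm, norm_zero, ENNReal.ofReal_zero]
      exact zero_le

end cutoff

end CuspMetropolis

/-! ### Weak gradients and the H¹ bound for the cut-off average -/

namespace CuspMetropolis

variable {d : ℕ}

theorem eLpNorm_two_sq {X V : Type*} [MeasurableSpace X] [NormedAddCommGroup V] (μ : Measure X)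
    (f : X → V) : eLpNorm f 2 μ ^ 2 = ∫⁻ x, ‖f x‖ₑ ^ 2 ∂μ := by
  have := eLpNorm_nnreal_pow_eq_lintegral (μ := μ) (f := f) (p := 2) two_ne_zero
  simpa using this

theorem eLpNorm_two_le {X V : Type*} [MeasurableSpace X] [NormedAddCommGroup V] {μ : Measure X}
    {f : X → V} {t : ℝ} (h : ∫⁻ x, ‖f x‖ₑ ^ 2 ∂μ ≤ ENNReal.ofReal t ^ 2) :
    eLpNorm f 2 μ ≤ ENNReal.ofReal t := by
  rw [← eLpNorm_two_sq] at h
  exact (ENNReal.pow_le_pow_left_iff two_ne_zero).1 h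

theorem memLp_two_of_lintegral_ne_top {X V : Type*} [MeasurableSpace X] [NormedAddCommGroup V]
    {μ : Measure X} {f : X → V} (hf : AEStronglyMeasurable f μ)
    (h : ∫⁻ x, ‖f x‖ₑ ^ 2 ∂μ ≠ ⊤) : MemLp f 2 μ := by
  refine ⟨hf, lt_top_iff_ne_top.2 fun htop => h ?_⟩
  rw [← eLpNorm_two_sq, htop]
  simp

section gradient

/-- The gradient of a complex-valued function on `ℝ^d`. -/
noncomputable def complexGradient (u : E d → ℂ) (x : E d) : EuclideanSpace ℂ (Fin d) :=
  WithLp.toLp 2 fun j => fderiv ℝ u x (EuclideanSpace.single j 1)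

theorem enorm_sq_complexGradient_le (u : E d → ℂ) (x : E d) :
    ‖complexGradient u x‖ₑ ^ 2 ≤ d * ‖fderiv ℝ u x‖ₑ ^ 2 := by
  have h1 : ‖complexGradient u x‖ ^ 2 ≤ d * ‖fderiv ℝ u x‖ ^ 2 := by
    rw [EuclideanSpace.norm_sq_eq]
    calc ∑ j, ‖complexGradient u x j‖ ^ 2 ≤ ∑ _j : Fin d, ‖fderiv ℝ u x‖ ^ 2 := by
          refine Finset.sum_le_sum fun j _ => ?_
          gcongr
          refine ((fderiv ℝ u x).le_opNorm _).trans_eq ?_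
          simp
      _ = _ := by simp
  rw [← ofReal_norm, ← ofReal_norm, ← ENNReal.ofReal_pow (norm_nonneg _),
    ← ENNReal.ofReal_pow (norm_nonneg _), ← ENNReal.ofReal_natCast,
    ← ENNReal.ofReal_mul (by positivity)]
  exact ENNReal.ofReal_le_ofReal h1

theorem continuousOn_complexGradient {Ω : Set (E d)} (hΩ : IsOpen Ω) {u : E d → ℂ}
    (hu : ContDiffOn ℝ 1 u Ω) : ContinuousOn (complexGradient u) Ω := by
  have h1 : ContinuousOn (fderiv ℝ u) Ω := hu.continuousOn_fderiv_of_isOpen hΩ le_rfl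
  refine (PiLp.continuous_toLp 2 _).comp_continuousOn (continuousOn_pi.2 fun j => ?_)
  exact h1.clm_apply continuousOn_const

/-- Since the test function has compact support inside Ω, all products extend to integrable
functions on the whole space, where integration by parts applies; neither the boundary nor the
values of u outside Ω matter. -/
theorem hasWeakGradient_of_contDiffOn {Ω : Set (E d)} (hΩ : IsOpen Ω) {u : E d → ℂ}
    (hu : ContDiffOn ℝ 1 u Ω) : HasWeakGradient Ω u (complexGradient u) := by
  refine ⟨hu.continuousOn.locallyIntegrableOn hΩ.measurableSet,
    (continuousOn_complexGradient hΩ hu).locallyIntegrableOn hΩ.measurableSet,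
    fun ψ hψ hψc hψΩ j => ?_⟩
  set e : E d := EuclideanSpace.single j 1 with he
  set Ψ : E d → ℂ := fun x => (ψ x : ℂ) with hΨ
  have hψd : ∀ x, HasFDerivAt ψ (fderiv ℝ ψ x) x := fun x =>
    (hψ.differentiable (by simp) x).hasFDerivAt
  have hΨd : ∀ x, HasFDerivAt Ψ (Complex.ofRealCLM.comp (fderiv ℝ ψ x)) x := fun x =>
    Complex.ofRealCLM.hasFDerivAt.comp x (hψd x)
  have hΨe : ∀ x, fderiv ℝ Ψ x e = (fderiv ℝ ψ x e : ℂ) := fun x => by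
    rw [(hΨd x).fderiv]; rfl
  have hΨts : tsupport Ψ ⊆ tsupport ψ := closure_mono fun x hx h0 => hx (by
    simp only [hΨ]; rw [h0]; rfl)
  have hud : ∀ x ∈ tsupport Ψ, DifferentiableAt ℝ u x := fun x hx =>
    (hu.differentiableOn one_ne_zero).differentiableAt (hΩ.mem_nhds (hψΩ (hΨts hx)))
  have hint : ∀ (a b : E d → ℂ), Continuous a → tsupport a ⊆ tsupport ψ → ContinuousOn b Ω →
      Integrable (fun x => a x * b x) := by
    intro a b ha has hb
    have hsupp : tsupport (fun x => a x * b x) ⊆ tsupport ψ :=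
      (closure_mono (Function.support_mul_subset_left a b)).trans has
    refine Continuous.integrable_of_hasCompactSupport (continuous_of_tsupport fun x hx => ?_)
      (hψc.isCompact.of_isClosed_subset (isClosed_tsupport _) hsupp)
    exact ha.continuousAt.mul (hb.continuousAt (hΩ.mem_nhds (hψΩ (hsupp hx))))
  have hΨc : Continuous Ψ := Complex.continuous_ofReal.comp hψ.continuous
  have hdc : Continuous fun x => fderiv ℝ Ψ x e := by
    simp_rw [hΨe]
    exact Complex.continuous_ofReal.comp
      ((hψ.continuous_fderiv (by simp)).clm_apply continuous_const)
  have hdts : tsupport (fun x => fderiv ℝ Ψ x e) ⊆ tsupport ψ := by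
    refine closure_minimal (fun x hx => ?_) (isClosed_tsupport _)
    refine hΨts (support_fderiv_subset ℝ fun h0 => hx ?_)
    simp [h0]
  have hfu : ContinuousOn (fun x => fderiv ℝ u x e) Ω :=
    (hu.continuousOn_fderiv_of_isOpen hΩ le_rfl).clm_apply continuousOn_const
  have key := integral_mul_fderiv_eq_neg_fderiv_mul_of_integrable (μ := volume) (v := e)
    (hint _ _ hdc hdts hu.continuousOn) (hint _ _ hΨc hΨts hfu)
    (hint _ _ hΨc hΨts hu.continuousOn) (fun x _ => (hΨd x).differentiableAt) hud
  have hout : ∀ x, x ∉ Ω → x ∉ tsupport ψ := fun x hx h => hx (hψΩ h)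
  have h1 : ∫ x in Ω, (fderiv ℝ ψ x e : ℂ) * u x = ∫ x, fderiv ℝ Ψ x e * u x := by
    simp_rw [← hΨe]
    refine setIntegral_eq_integral_of_forall_compl_eq_zero fun x hx => ?_
    rw [image_eq_zero_of_notMem_tsupport fun h => hout x hx (hdts h), zero_mul]
  have h2 : ∫ x in Ω, (ψ x : ℂ) * complexGradient u x j = ∫ x, Ψ x * fderiv ℝ u x e := by
    refine setIntegral_eq_integral_of_forall_compl_eq_zero (f := fun x => Ψ x * fderiv ℝ u x e)
      fun x hx => ?_
    rw [image_eq_zero_of_notMem_tsupport fun h => hout x hx (hΨts h), zero_mul]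
  rw [h1, h2, key, neg_neg]

end gradient

theorem enorm_fderiv_prod_le {ι : Type*} [Fintype ι] {χ : ι → E d → ℝ}
    (hd : ∀ i, Differentiable ℝ (χ i)) (h0 : ∀ i x, 0 ≤ χ i x) (h1 : ∀ i x, χ i x ≤ 1) (x : E d) :
    ‖fderiv ℝ (fun x => ∏ i, χ i x) x‖ₑ ≤ ∑ i, ‖fderiv ℝ (χ i) x‖ₑ := by
  classical
  have := HasFDerivAt.finsetProd (u := Finset.univ) (g := χ) (g' := fun i => fderiv ℝ (χ i) x)
    (x := x) fun i _ => (hd i x).hasFDerivAt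
  rw [this.fderiv]
  refine (enorm_sum_le Finset.univ fun i =>
    (∏ j ∈ Finset.univ.erase i, χ j x) • fderiv ℝ (χ i) x).trans (Finset.sum_le_sum fun i _ => ?_)
  rw [← ofReal_norm, ← ofReal_norm, norm_smul, Real.norm_of_nonneg
    (Finset.prod_nonneg fun j _ => h0 j x)]
  refine ENNReal.ofReal_le_ofReal (mul_le_of_le_one_left (norm_nonneg _) ?_)
  exact Finset.prod_le_one (fun j _ => h0 j x) fun j _ => h1 j x

theorem exists_pos_forall_le {ι : Type*} [Finite ι] (f : ι → ℝ) (hf : ∀ i, 0 < f i) :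
    ∃ c > 0, ∀ i, c ≤ f i := by
  obtain ⟨M, hM⟩ := Finite.exists_le fun i => (f i)⁻¹
  refine ⟨(max M 1)⁻¹, by positivity, fun i => ?_⟩
  rw [inv_le_comm₀ (by positivity) (hf i)]
  exact (hM i).trans (le_max_left _ _)

section decomposition

variable {Ω : Set (E d)} {Ir Ic : Type*} {ωr : Ir → Set (E d)} {ωc : Ic → E d → Set (E d)}
  {S : Ic → Set (E d)} {d' d'' : Ic → ℕ} {α : Ic → ℝ}

theorem HasCuspidalBoundary.exists_uniform_constants
    (hΩ : HasCuspidalBoundary Ω ωr ωc S d' d'' α) (hΩo : IsOpen Ω)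
    (hΩb : Bornology.IsBounded Ω) :
    ∃ C > 0, ∃ c > 0, ∃ h₀ > 0, ∃ B : NNReal, ∀ h, 0 < h → h ≤ h₀ →
      Ω \ cuspRegion Ω S α C h ⊆ fatPart Ω c h ∧
      ∀ i, ∀ g : E d → ℂ, ContDiffOn ℝ 1 g Ω →
      ∫⁻ x in Ω \ cuspRegion Ω S α C h, (‖g x‖ₑ * (Metric.infEDist x (S i))⁻¹) ^ 2 ≤
        B * ∫⁻ x in fatPart Ω c h, (‖g x‖ₑ ^ 2 + ‖fderiv ℝ g x‖ₑ ^ 2) := by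
  have := hΩ.finite_cusp
  obtain ⟨C₁, hC₁, c₁, hc₁, h₁, hh₁, H₁⟩ := hΩ.exists_diff_cuspRegion_subset_fatPart hΩo hΩb
  choose C hC c hc h₀ hh₀ B H using fun i => hΩ.exists_lintegral_le hΩo hΩb i
  obtain ⟨C₂, hC₂⟩ := Finite.exists_le C
  obtain ⟨B₂, hB₂⟩ := Finite.exists_le B
  obtain ⟨c₂, hc₂, hcle⟩ := exists_pos_forall_le c hc
  obtain ⟨h₂, hh₂, hhle⟩ := exists_pos_forall_le h₀ hh₀
  refine ⟨max C₁ C₂, lt_max_of_lt_left hC₁, min c₁ c₂, lt_min hc₁ hc₂, min h₁ h₂,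
    lt_min hh₁ hh₂, B₂, fun h hpos hle => ⟨?_, fun i g hg => ?_⟩⟩
  · exact (sdiff_subset_sdiff_right (cuspRegion_mono Ω S α hpos.le (le_max_left _ _))).trans
      ((H₁ h hpos (hle.trans (min_le_left _ _))).trans
        (fatPart_antitone Ω hpos.le (min_le_left _ _)))
  · refine le_trans (lintegral_mono_set (sdiff_subset_sdiff_right
      (cuspRegion_mono Ω S α hpos.le ((hC₂ i).trans (le_max_right _ _))))) ?_
    refine (H i h hpos (hle.trans ((min_le_right _ _).trans (hhle i))) g hg).trans ?_
    gcongr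
    · exact hB₂ i
    · exact fatPart_antitone Ω hpos.le ((min_le_right _ _).trans (hcle i))

/-- By the product rule the only dangerous term is g ∇χ, at most κ times the sum over i of |g| /
d(x, S_i), which is exactly what Hardy's inequality controls. The factors 2 and the number of edges
come from squaring the sums. -/
theorem lintegral_enorm_sq_fderiv_smul_le [Fintype Ic] (hΩo : IsOpen Ω) {C c h : ℝ} {B : NNReal}
    (hfat : Ω \ cuspRegion Ω S α C h ⊆ fatPart Ω c h) {g : E d → ℂ} (hg : ContDiffOn ℝ 1 g Ω)
    (hB : ∀ i, ∫⁻ x in Ω \ cuspRegion Ω S α C h, (‖g x‖ₑ * (Metric.infEDist x (S i))⁻¹) ^ 2 ≤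
      B * ∫⁻ x in fatPart Ω c h, (‖g x‖ₑ ^ 2 + ‖fderiv ℝ g x‖ₑ ^ 2))
    {χ : Ic → E d → ℝ} (hχ : ∀ i, ContDiff ℝ ∞ (χ i)) (h0 : ∀ i x, 0 ≤ χ i x)
    (h1 : ∀ i x, χ i x ≤ 1) {κ : NNReal}
    (hκ : ∀ i x, ‖fderiv ℝ (χ i) x‖ₑ ≤ κ * (Metric.infEDist x (S i))⁻¹)
    (hvan : ∀ i, ∀ x ∈ Metric.thickening (C * h ^ (1 / α i)) (S i), χ i x = 0) :
    ∫⁻ x in Ω, ‖fderiv ℝ (fun x => (∏ i, χ i x) • g x) x‖ₑ ^ 2 ≤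
      (2 + 2 * (Fintype.card Ic * (Fintype.card Ic * (κ ^ 2 * B)))) *
        ∫⁻ x in fatPart Ω c h, (‖g x‖ₑ ^ 2 + ‖fderiv ℝ g x‖ₑ ^ 2) := by
  classical
  set R := ∫⁻ x in fatPart Ω c h, (‖g x‖ₑ ^ 2 + ‖fderiv ℝ g x‖ₑ ^ 2) with hR
  set Γ := cuspRegion Ω S α C h with hΓ
  have hΓo : IsOpen Γ := isOpen_iUnion fun i => hΩo.inter Metric.isOpen_thickening
  have hΩΓm : MeasurableSet (Ω \ Γ) := hΩo.measurableSet.diff hΓo.measurableSet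
  set D : E d → ENNReal := fun x => ‖fderiv ℝ (fun x => (∏ i, χ i x) • g x) x‖ₑ ^ 2 with hD
  set P : E d → ENNReal := fun x => ∑ i, (κ * (‖g x‖ₑ * (Metric.infEDist x (S i))⁻¹)) ^ 2 with hP
  -- The product vanishes identically near each point of Γ, so only Ω \ Γ contributes, and there
  -- Hardy's inequality is available.
  have hvanΓ : ∀ x ∈ Γ, D x = 0 := by
    intro x hx
    obtain ⟨i, hxΩ, hxi⟩ := mem_iUnion.1 hx
    have heq : (fun x => (∏ i, χ i x) • g x) =ᶠ[𝓝 x] fun _ => 0 := by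
      filter_upwards [Metric.isOpen_thickening.mem_nhds hxi] with y hy
      rw [Finset.prod_eq_zero (Finset.mem_univ i) (hvan i y hy), zero_smul]
    simp only [hD]
    rw [heq.fderiv_eq, fderiv_const_apply, ← ofReal_norm, norm_zero]
    simp
  have hpt : ∀ x ∈ Ω \ Γ, D x ≤ 2 * ‖fderiv ℝ g x‖ₑ ^ 2 + 2 * (Fintype.card Ic * P x) := by
    rintro x ⟨hxΩ, -⟩
    have hgd : HasFDerivAt g (fderiv ℝ g x) x :=
      ((hg.differentiableOn one_ne_zero).differentiableAt (hΩo.mem_nhds hxΩ)).hasFDerivAt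
    have hχd : HasFDerivAt (fun x => ∏ i, χ i x) (fderiv ℝ (fun x => ∏ i, χ i x) x) x :=
      ((contDiff_prod fun i _ => hχ i).differentiable (by simp) x).hasFDerivAt
    have hprod1 : ‖∏ i, χ i x‖ₑ ≤ 1 := by
      rw [← ofReal_norm, Real.norm_of_nonneg (Finset.prod_nonneg fun i _ => h0 i x),
        ENNReal.ofReal_le_one]
      exact Finset.prod_le_one (fun i _ => h0 i x) fun i _ => h1 i x
    have hbd : ‖fderiv ℝ (fun x => (∏ i, χ i x) • g x) x‖ₑ ≤
        ‖fderiv ℝ g x‖ₑ + ∑ i, κ * (‖g x‖ₑ * (Metric.infEDist x (S i))⁻¹) := by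
      refine (congrArg (fun T => ‖T‖ₑ) (hχd.smul hgd).fderiv).trans_le ?_
      refine (enorm_add_le ((∏ i, χ i x) • fderiv ℝ g x)
        ((fderiv ℝ (fun x => ∏ i, χ i x) x).smulRight (g x))).trans (add_le_add ?_ ?_)
      · rw [enorm_smul]
        exact mul_le_of_le_one_left (by positivity) hprod1
      · have hsr : ‖(fderiv ℝ (fun x => ∏ i, χ i x) x).smulRight (g x)‖ₑ =
            ‖fderiv ℝ (fun x => ∏ i, χ i x) x‖ₑ * ‖g x‖ₑ := by
          rw [← ofReal_norm, ContinuousLinearMap.norm_smulRight_apply,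
            ENNReal.ofReal_mul (norm_nonneg _), ofReal_norm, ofReal_norm]
        rw [hsr]
        calc _ ≤ (∑ i, κ * (Metric.infEDist x (S i))⁻¹) * ‖g x‖ₑ := by
              gcongr
              refine (enorm_fderiv_prod_le (fun i => (hχ i).differentiable (by simp)) h0 h1 x).trans
                (Finset.sum_le_sum fun i _ => hκ i x)
          _ = _ := by
              rw [Finset.sum_mul]
              exact Finset.sum_congr rfl fun i _ => by ring
    have hsq := add_sq_le_of_pos (η := 1) one_pos ‖fderiv ℝ g x‖ₑ
      (∑ i, κ * (‖g x‖ₑ * (Metric.infEDist x (S i))⁻¹))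
    have hcs := ENNReal.rpow_sum_le_const_mul_sum_rpow Finset.univ
      (fun i => (κ : ENNReal) * (‖g x‖ₑ * (Metric.infEDist x (S i))⁻¹)) (p := 2) (by norm_num)
    have h21 : (2 : ℝ) - 1 = 1 := by norm_num
    rw [h21, ENNReal.rpow_one] at hcs
    simp only [ENNReal.rpow_two, Finset.card_univ] at hcs
    have h2 : (1 : ENNReal) + ((1 : NNReal) : ENNReal) = 2 := by norm_num
    rw [inv_one, h2] at hsq
    calc D x ≤ (‖fderiv ℝ g x‖ₑ +
          ∑ i, κ * (‖g x‖ₑ * (Metric.infEDist x (S i))⁻¹)) ^ 2 := by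
          simp only [hD]; gcongr
      _ ≤ _ := hsq
      _ ≤ _ := by gcongr
  have hgm : AEMeasurable g (volume.restrict (Ω \ Γ)) :=
    (hg.continuousOn.aemeasurable hΩo.measurableSet).mono_measure
      (Measure.restrict_mono sdiff_subset le_rfl)
  have hPint : ∫⁻ x in Ω \ Γ, P x ≤ Fintype.card Ic * (κ ^ 2 * (B * R)) := by
    have hterm : ∀ i, ∫⁻ x in Ω \ Γ, (κ * (‖g x‖ₑ * (Metric.infEDist x (S i))⁻¹)) ^ 2 ≤
        κ ^ 2 * (B * R) := fun i => by
      simp_rw [mul_pow (κ : ENNReal)]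
      rw [lintegral_const_mul' _ _ (by finiteness)]
      gcongr
      exact hB i
    have hm : ∀ i ∈ Finset.univ, AEMeasurable
        (fun x => ((κ : ENNReal) * (‖g x‖ₑ * (Metric.infEDist x (S i))⁻¹)) ^ 2)
        (volume.restrict (Ω \ Γ)) := fun i _ => ((hgm.enorm.mul
      Metric.continuous_infEDist.measurable.inv.aemeasurable).const_mul _).pow_const 2
    simp only [hP]
    rw [lintegral_finsetSum' _ hm]
    refine (Finset.sum_le_sum fun i _ => hterm i).trans_eq ?_
    rw [Finset.sum_const, Finset.card_univ, nsmul_eq_mul]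
  have hDR : ∫⁻ x in Ω \ Γ, ‖fderiv ℝ g x‖ₑ ^ 2 ≤ R :=
    (lintegral_mono_set hfat).trans (lintegral_mono fun x => le_add_self)
  have hsub : Ω ⊆ Γ ∪ (Ω \ Γ) := fun x hx => by
    by_cases h : x ∈ Γ
    · exact Or.inl h
    · exact Or.inr ⟨hx, h⟩
  calc ∫⁻ x in Ω, D x ≤ ∫⁻ x in Γ ∪ (Ω \ Γ), D x := lintegral_mono_set hsub
    _ ≤ (∫⁻ x in Γ, D x) + ∫⁻ x in Ω \ Γ, D x := lintegral_union_le _ _ _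
    _ = ∫⁻ x in Ω \ Γ, D x := by
        rw [setLIntegral_congr_fun hΓo.measurableSet hvanΓ]; simp
    _ ≤ ∫⁻ x in Ω \ Γ, (2 * ‖fderiv ℝ g x‖ₑ ^ 2 + 2 * (Fintype.card Ic * P x)) :=
        setLIntegral_mono' hΩΓm hpt
    _ = 2 * (∫⁻ x in Ω \ Γ, ‖fderiv ℝ g x‖ₑ ^ 2) +
        2 * (Fintype.card Ic * ∫⁻ x in Ω \ Γ, P x) := by
        rw [lintegral_add_left (((measurable_fderiv ℝ g).enorm.pow_const 2).const_mul _),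
          lintegral_const_mul' _ _ (by finiteness), lintegral_const_mul' _ _ (by finiteness),
          lintegral_const_mul' _ _ (by finiteness)]
    _ ≤ 2 * R + 2 * (Fintype.card Ic * (Fintype.card Ic * (κ ^ 2 * (B * R)))) := by gcongr
    _ = _ := by ring

end decomposition

end CuspMetropolis

/-! ### Assembly of the decomposition -/

namespace CuspMetropolis

variable {d : ℕ}

theorem lintegral_enorm_sq_le_two_mul {X : Type*} [MeasurableSpace X] {μ : Measure X}
    {u g : X → ℂ} (hu : AEStronglyMeasurable u μ) :
    ∫⁻ x, ‖g x‖ₑ ^ 2 ∂μ ≤ 2 * (∫⁻ x, ‖g x - u x‖ₑ ^ 2 ∂μ) + 2 * ∫⁻ x, ‖u x‖ₑ ^ 2 ∂μ := by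
  have h2 : (1 : ENNReal) + ((1 : NNReal) : ENNReal) = 2 := by norm_num
  rw [← lintegral_const_mul' _ _ (by finiteness), ← lintegral_const_mul' _ _ (by finiteness),
    ← lintegral_add_right' _ ((hu.aemeasurable.enorm.pow_const 2).const_mul _)]
  refine lintegral_mono fun x => ?_
  have hsq := add_sq_le_of_pos (η := 1) one_pos ‖g x - u x‖ₑ ‖u x‖ₑ
  rw [inv_one, h2] at hsq
  refine le_trans ?_ hsq
  gcongr
  simpa using enorm_add_le (g x - u x) (u x)

/-- A cutoff of the local average and a remainder provide the decomposition. -/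
theorem exists_decomposition {Ω : Set (E d)} (hΩo : IsOpen Ω) {Ic : Type*} [Fintype Ic]
    {S : Ic → Set (E d)} {α : Ic → ℝ} {C h : ℝ} {G : Set (E d)} {b : Ic → ℝ}
    (hfat : Ω \ cuspRegion Ω S α C h ⊆ G)
    (hb : ∀ i, 0 < b i)
    (hab : ∀ i, C * h ^ (1 / α i) < b i) (hbc : ∀ i, b i < C * (2 * h) ^ (1 / α i))
    {χ : Ic → E d → ℝ} (hχ : ∀ i, ContDiff ℝ ∞ (χ i)) (h0 : ∀ i x, 0 ≤ χ i x)
    (h1 : ∀ i x, χ i x ≤ 1)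
    (hvan : ∀ i, ∀ x ∈ Metric.thickening (C * h ^ (1 / α i)) (S i), χ i x = 0)
    (hone : ∀ i x, x ∉ Metric.thickening (b i) (S i) → χ i x = 1)
    {u g : E d → ℂ} (hu : MemLp u 2 (volume.restrict Ω)) (hg : ContDiffOn ℝ 1 g Ω)
    {t : ℝ} (hR : ∫⁻ x in G, ‖g x‖ₑ ^ 2 ≠ ⊤) (hgu : ∫⁻ x in G, ‖g x - u x‖ₑ ^ 2 ≤ ENNReal.ofReal t ^ 2)
    {Z : ENNReal} (hZ : Z ≠ ⊤)
    (hD : ∫⁻ x in Ω, ‖fderiv ℝ (fun x => (∏ i, χ i x) • g x) x‖ₑ ^ 2 ≤ Z) :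
    ∃ fC fL fH : E d → ℂ,
      MemLp fC 2 (volume.restrict Ω) ∧ MemLp fL 2 (volume.restrict Ω) ∧
      MemLp fH 2 (volume.restrict Ω) ∧ u =ᵐ[volume.restrict Ω] fC + fL + fH ∧
      essSupport Ω fC ⊆ cuspRegion Ω S α C (2 * h) ∧
      essSupport Ω fL ⊆ Ω \ cuspRegion Ω S α C h ∧
      essSupport Ω fH ⊆ Ω \ cuspRegion Ω S α C h ∧
      (∃ G : E d → EuclideanSpace ℂ (Fin d), HasWeakGradient Ω fL G ∧
        MemLp G 2 (volume.restrict Ω) ∧ ∫⁻ x in Ω, ‖G x‖ₑ ^ 2 ≤ d * Z) ∧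
      eLpNorm fH 2 (volume.restrict Ω) ≤ ENNReal.ofReal t := by
  set Γ := cuspRegion Ω S α C h with hΓ
  set A : Set (E d) := ⋃ i, Metric.thickening (b i) (S i) with hA
  have hAo : IsOpen A := isOpen_iUnion fun i => Metric.isOpen_thickening
  have hΓo : IsOpen Γ := isOpen_iUnion fun i => hΩo.inter Metric.isOpen_thickening
  have hΓA : Γ ⊆ A := iUnion_mono fun i =>
    inter_subset_right.trans (Metric.thickening_mono (hab i).le _)
  set χ' : E d → ℝ := fun x => ∏ i, χ i x with hχ'
  have hχ'sm : ContDiff ℝ ∞ χ' := contDiff_prod fun i _ => hχ i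
  have hχ'1 : ∀ x, x ∉ A → χ' x = 1 := fun x hx => Finset.prod_eq_one fun i _ =>
    hone i x fun h => hx (mem_iUnion.2 ⟨i, h⟩)
  have hχ'0 : ∀ x ∈ Γ, χ' x = 0 := fun x hx => by
    obtain ⟨i, -, hxi⟩ := mem_iUnion.1 hx
    exact Finset.prod_eq_zero (Finset.mem_univ i) (hvan i x hxi)
  have hχ'le : ∀ x, ‖χ' x‖ₑ ≤ 1 := fun x => by
    rw [← ofReal_norm, Real.norm_of_nonneg (Finset.prod_nonneg fun i _ => h0 i x),
      ENNReal.ofReal_le_one]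
    exact Finset.prod_le_one (fun i _ => h0 i x) fun i _ => h1 i x
  set fL : E d → ℂ := fun x => χ' x • g x with hfL
  -- A sharp cutoff suffices, since only the L² norm of this part matters; off A the cutoff equals
  -- 1, so there fL + fH = u.
  set fH : E d → ℂ := Aᶜ.indicator fun x => u x - g x with hfH
  have hfLC : ContDiffOn ℝ 1 fL Ω := (hχ'sm.of_le (by simp)).contDiffOn.smul hg
  have hgm : AEStronglyMeasurable g (volume.restrict Ω) :=
    hg.continuousOn.aestronglyMeasurable hΩo.measurableSet
  have hfLm : MemLp fL 2 (volume.restrict Ω) := by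
    refine memLp_two_of_lintegral_ne_top
      (hfLC.continuousOn.aestronglyMeasurable hΩo.measurableSet) (ne_top_of_le_ne_top hR ?_)
    calc ∫⁻ x in Ω, ‖fL x‖ₑ ^ 2
        ≤ ∫⁻ x in Ω, (Ω \ Γ).indicator (fun x => ‖g x‖ₑ ^ 2) x := by
          refine setLIntegral_mono' hΩo.measurableSet fun x hx => ?_
          by_cases hxΓ : x ∈ Γ
          · simp [hfL, hχ'0 x hxΓ]
          · rw [indicator_of_mem (show x ∈ Ω \ Γ from ⟨hx, hxΓ⟩)]
            gcongr
            rw [hfL, enorm_smul]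
            exact mul_le_of_le_one_left (by positivity) (hχ'le x)
      _ ≤ ∫⁻ x, (Ω \ Γ).indicator (fun x => ‖g x‖ₑ ^ 2) x := setLIntegral_le_lintegral _ _
      _ = ∫⁻ x in Ω \ Γ, ‖g x‖ₑ ^ 2 :=
          lintegral_indicator (hΩo.measurableSet.diff hΓo.measurableSet) _
      _ ≤ _ := lintegral_mono_set hfat
  have hfHint : ∫⁻ x in Ω, ‖fH x‖ₑ ^ 2 ≤ ENNReal.ofReal t ^ 2 := by
    calc ∫⁻ x in Ω, ‖fH x‖ₑ ^ 2
        ≤ ∫⁻ x in Ω, (Ω \ Γ).indicator (fun x => ‖g x - u x‖ₑ ^ 2) x := by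
          refine setLIntegral_mono' hΩo.measurableSet fun x hx => ?_
          by_cases hxA : x ∈ A
          · simp [hfH, hxA]
          · rw [indicator_of_mem (show x ∈ Ω \ Γ from ⟨hx, fun h => hxA (hΓA h)⟩), hfH,
              indicator_of_mem (by exact hxA), enorm_sub_rev]
      _ ≤ ∫⁻ x, (Ω \ Γ).indicator (fun x => ‖g x - u x‖ₑ ^ 2) x := setLIntegral_le_lintegral _ _
      _ = ∫⁻ x in Ω \ Γ, ‖g x - u x‖ₑ ^ 2 :=
          lintegral_indicator (hΩo.measurableSet.diff hΓo.measurableSet) _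
      _ ≤ _ := (lintegral_mono_set hfat).trans hgu
  have hfHm : MemLp fH 2 (volume.restrict Ω) := by
    refine memLp_two_of_lintegral_ne_top ?_ (ne_top_of_le_ne_top (by finiteness) hfHint)
    exact (hu.aestronglyMeasurable.sub hgm).indicator hAo.measurableSet.compl
  have hvanish : ∀ (F : E d → ℂ) (x : E d) (U : Set (E d)), U ∈ 𝓝 x → (∀ y ∈ Ω ∩ U, F y = 0) →
      x ∉ essSupport Ω F := by
    intro F x U hU hF hx
    obtain ⟨V, hVU, hVo, hxV⟩ := mem_nhds_iff.1 hU
    refine hx.2 V (hVo.mem_nhds hxV) ?_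
    filter_upwards [ae_restrict_mem (hΩo.inter hVo).measurableSet] with y hy
    exact hF y ⟨hy.1, hVU hy.2⟩
  have hdiff : ∀ F : E d → ℂ, (∀ x ∈ Γ, F x = 0) → essSupport Ω F ⊆ Ω \ Γ := fun F hF x hx =>
    ⟨hx.1, fun hxΓ => hvanish F x Γ (hΓo.mem_nhds hxΓ) (fun y hy => hF y hy.2) hx⟩
  have hGint : ∫⁻ x in Ω, ‖complexGradient fL x‖ₑ ^ 2 ≤ d * Z := by
    calc ∫⁻ x in Ω, ‖complexGradient fL x‖ₑ ^ 2 ≤ ∫⁻ x in Ω, d * ‖fderiv ℝ fL x‖ₑ ^ 2 :=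
          lintegral_mono fun x => enorm_sq_complexGradient_le fL x
      _ = d * ∫⁻ x in Ω, ‖fderiv ℝ fL x‖ₑ ^ 2 := lintegral_const_mul' _ _ (by finiteness)
      _ ≤ d * Z := by gcongr
  refine ⟨u - fL - fH, fL, fH, (hu.sub hfLm).sub hfHm, hfLm, hfHm,
    Eventually.of_forall fun x => by simp only [Pi.add_apply, Pi.sub_apply]; ring, ?_, hdiff fL fun x hx => by simp [hfL, hχ'0 x hx],
    hdiff fH fun x hx => by simp [hfH, hΓA hx],
    ⟨complexGradient fL, hasWeakGradient_of_contDiffOn hΩo hfLC, ?_, hGint⟩,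
    eLpNorm_two_le hfHint⟩
  · intro x hx
    by_contra hxΓ
    -- The strict gap between b_i and C (2h)^{1/α_i} is used here: outside Γ_{2h} the distance
    -- strictly exceeds b_i, an open condition, so fC vanishes on a neighbourhood and not merely at
    -- the point.
    have hlt : ∀ i, ENNReal.ofReal (b i) < Metric.infEDist x (S i) := fun i => by
      have hnot : x ∉ Metric.thickening (C * (2 * h) ^ (1 / α i)) (S i) := fun hxi =>
        hxΓ (mem_iUnion.2 ⟨i, hx.1, hxi⟩)
      rw [Metric.thickening, mem_ofPred_eq, not_lt] at hnot
      refine lt_of_lt_of_le ?_ hnot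
      exact (ENNReal.ofReal_lt_ofReal_iff ((hb i).trans (hbc i))).2 (hbc i)
    refine hvanish _ x (⋂ i, {y | ENNReal.ofReal (b i) < Metric.infEDist y (S i)})
      (iInter_mem.2 fun i => Metric.continuous_infEDist.continuousAt.eventually
        (lt_mem_nhds (hlt i))) (fun y hy => ?_) hx
    have hyA : y ∉ A := fun hyA => by
      obtain ⟨i, hi⟩ := mem_iUnion.1 hyA
      have h2 : ENNReal.ofReal (b i) < Metric.infEDist y (S i) := mem_iInter.1 hy.2 i
      have h3 : Metric.infEDist y (S i) < ENNReal.ofReal (b i) := hi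
      exact lt_irrefl _ (h2.trans h3)
    simp only [Pi.sub_apply, hfL, hfH]
    rw [indicator_of_mem (by exact hyA), hχ'1 y hyA, one_smul, sub_self]
  · exact memLp_two_of_lintegral_ne_top
      ((continuousOn_complexGradient hΩo hfLC).aestronglyMeasurable hΩo.measurableSet)
      (ne_top_of_le_ne_top (by finiteness) hGint)

end CuspMetropolis

theorem lemma3p1 {d : ℕ} (Ω : Set (CuspMetropolis.E d))
    (hΩ_open : IsOpen Ω) (hΩ_conn : IsConnected Ω) (hΩ_bdd : Bornology.IsBounded Ω)
    {Ir Ic : Type*}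
    (ωr : Ir → Set (CuspMetropolis.E d)) (ωc : Ic → CuspMetropolis.E d → Set (CuspMetropolis.E d))
    (S : Ic → Set (CuspMetropolis.E d)) (d' d'' : Ic → ℕ) (α : Ic → ℝ)
    (hΩ : CuspMetropolis.HasCuspidalBoundary Ω ωr ωc S d' d'' α)
    (ρ : CuspMetropolis.E d → ℝ) (hρ_meas : AEMeasurable ρ (volume.restrict Ω))
    (m M : ℝ) (hm : 0 < m) (hρ_bdd : ∀ x ∈ Ω, m ≤ ρ x ∧ ρ x ≤ M)
    (hρ_int : ∫ x in Ω, ρ x = 1)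
    (f : ℝ → CuspMetropolis.E d → ℂ)
    (hf_mem : ∀ h ∈ Set.Ioc (0 : ℝ) 1, MemLp (f h) 2 (volume.restrict Ω))
    (hf_norm : ∀ h ∈ Set.Ioc (0 : ℝ) 1, eLpNorm (f h) 2 (volume.restrict Ω) ≤ 1)
    (hf_energy : ∀ h ∈ Set.Ioc (0 : ℝ) 1, CuspMetropolis.dirichletEnergy Ω ρ h (f h) ≤ h ^ 2) :
    ∃ C > 0, ∃ C₀ > 0, ∃ h₀ ∈ Set.Ioc (0 : ℝ) 1, ∀ h ∈ Set.Ioc (0 : ℝ) h₀,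
      ∃ fC fL fH : CuspMetropolis.E d → ℂ,
        MemLp fC 2 (volume.restrict Ω) ∧ MemLp fL 2 (volume.restrict Ω) ∧
        MemLp fH 2 (volume.restrict Ω) ∧
        f h =ᵐ[volume.restrict Ω] fC + fL + fH ∧
        CuspMetropolis.essSupport Ω fC ⊆ CuspMetropolis.cuspRegion Ω S α C (2 * h) ∧
        CuspMetropolis.essSupport Ω fL ⊆ Ω \ CuspMetropolis.cuspRegion Ω S α C h ∧
        CuspMetropolis.essSupport Ω fH ⊆ Ω \ CuspMetropolis.cuspRegion Ω S α C h ∧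
        (∃ G : CuspMetropolis.E d → EuclideanSpace ℂ (Fin d),
          CuspMetropolis.HasWeakGradient Ω fL G ∧ MemLp G 2 (volume.restrict Ω) ∧
          eLpNorm G 2 (volume.restrict Ω) ≤ ENNReal.ofReal C₀) ∧
        eLpNorm fH 2 (volume.restrict Ω) ≤ ENNReal.ofReal (C₀ * h) := by
  have hfinI := hΩ.finite_cusp
  have := Fintype.ofFinite Ic
  have hΩfin : volume Ω ≠ ⊤ := hΩ_bdd.measure_lt_top.ne
  obtain ⟨C, hC, c, hc, h₁, hh₁, B, H⟩ := hΩ.exists_uniform_constants hΩ_open hΩ_bdd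
  obtain ⟨K₁, hK₁, H₁⟩ := CuspMetropolis.exists_lintegral_localAverage_bounds hΩ_open hΩfin
    hρ_meas hm hρ_bdd hc
  obtain ⟨K₂, hK₂, H₂⟩ := CuspMetropolis.exists_cutoff d
  set q : Ic → ℝ := fun i => 2 ^ (1 / α i) with hq
  have hq1 : ∀ i, 1 < q i := fun i => Real.one_lt_rpow (by norm_num)
    (one_div_pos.2 (one_pos.trans (hΩ.one_lt_exponent i)))
  -- The outer radius b_i below is the midpoint of C h^{1/α_i} and C (2h)^{1/α_i}. The ratio b_i /
  -- (b_i - a_i) then depends only on q_i = 2^{1/α_i}, so κ is independent of h.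
  obtain ⟨κ, hκ⟩ := Finite.exists_le fun i =>
    Real.toNNReal (K₂ * (((1 + q i) / 2) / ((1 + q i) / 2 - 1)))
  set R : ENNReal := 2 * ENNReal.ofReal K₁ + 2 + ENNReal.ofReal K₁ with hR
  set Z : ENNReal := (2 + 2 * (Fintype.card Ic * (Fintype.card Ic * (κ ^ 2 * B)))) * R with hZ
  have hRtop : R ≠ ⊤ := by rw [hR]; finiteness
  have hZtop : Z ≠ ⊤ := by rw [hZ]; finiteness
  have hZ0 : 0 ≤ (d * Z).toReal := ENNReal.toReal_nonneg
  -- The final bounds need C₀² ≥ dZ and C₀² ≥ K₁; the summand 1 makes C₀ ≥ 1, so that C₀² ≥ C₀ gives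
  -- both without square roots.
  refine ⟨C, hC, (d * Z).toReal + K₁ + 1, by positivity, min h₁ 1,
    ⟨lt_min hh₁ one_pos, min_le_right _ _⟩, fun h hh => ?_⟩
  have hh0 : 0 < h := hh.1
  have hh1 : h ≤ 1 := hh.2.trans (min_le_right _ _)
  have hhI : h ∈ Set.Ioc (0 : ℝ) 1 := ⟨hh0, hh1⟩
  obtain ⟨hfat, hHardy⟩ := H h hh0 (hh.2.trans (min_le_left _ _))
  obtain ⟨hgu, hDg⟩ := H₁ h hh0 (f h) (hf_mem h hhI) (hf_energy h hhI)
  set u := f h with hu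
  set g := CuspMetropolis.localAverage Ω h u with hg
  have hfin : IsFiniteMeasure (volume.restrict Ω) :=
    ⟨by rw [Measure.restrict_apply_univ]; exact hΩfin.lt_top⟩
  have hgC : ContDiffOn ℝ 1 g Ω := (CuspMetropolis.contDiffOn_localAverage hΩ_open hΩfin hh0
    ((hf_mem h hhI).integrable (by norm_num))).of_le (by simp)
  set a : Ic → ℝ := fun i => C * h ^ (1 / α i) with ha
  have ha0 : ∀ i, 0 < a i := fun i => mul_pos hC (Real.rpow_pos_of_pos hh0 _)
  set b : Ic → ℝ := fun i => (1 + q i) / 2 * a i with hb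
  have hab : ∀ i, a i < b i := fun i =>
    lt_mul_of_one_lt_left (ha0 i) (by linarith [hq1 i])
  have hbc : ∀ i, b i < C * (2 * h) ^ (1 / α i) := fun i => by
    have h1 : C * (2 * h) ^ (1 / α i) = q i * a i := by
      rw [Real.mul_rpow (by norm_num) hh0.le]; simp only [hq, ha]; ring
    rw [h1]
    exact mul_lt_mul_of_pos_right (by linarith [hq1 i]) (ha0 i)
  choose χ hχ hχ0 hχ1 hvan hone hχd using fun i => H₂ (S i) (a i) (b i) (ha0 i) (hab i)
  have hκχ : ∀ i x, ‖fderiv ℝ (χ i) x‖ₑ ≤ κ * (Metric.infEDist x (S i))⁻¹ := fun i x => by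
    refine (hχd i x).trans ?_
    gcongr
    have hratio : b i / (b i - a i) = ((1 + q i) / 2) / ((1 + q i) / 2 - 1) := by
      have h1 : b i - a i = ((1 + q i) / 2 - 1) * a i := by simp only [hb]; ring
      rw [h1]
      exact mul_div_mul_right _ _ (ha0 i).ne'
    rw [hratio]
    exact ENNReal.coe_le_coe.2 (hκ i)
  have hgu1 : ∫⁻ x in CuspMetropolis.fatPart Ω c h, ‖g x - u x‖ₑ ^ 2 ≤ ENNReal.ofReal K₁ :=
    hgu.trans (ENNReal.ofReal_le_ofReal
      (mul_le_of_le_one_right hK₁.le (pow_le_one₀ hh0.le hh1)))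
  have hum : AEStronglyMeasurable u (volume.restrict (CuspMetropolis.fatPart Ω c h)) :=
    (hf_mem h hhI).aestronglyMeasurable.mono_measure
      (Measure.restrict_mono (CuspMetropolis.fatPart_subset Ω c h) le_rfl)
  have hu1 : ∫⁻ x in CuspMetropolis.fatPart Ω c h, ‖u x‖ₑ ^ 2 ≤ 1 := by
    refine (lintegral_mono_set (CuspMetropolis.fatPart_subset Ω c h)).trans ?_
    rw [← CuspMetropolis.eLpNorm_two_sq]
    exact pow_le_one₀ zero_le (hf_norm h hhI)
  have hg2 : ∫⁻ x in CuspMetropolis.fatPart Ω c h, ‖g x‖ₑ ^ 2 ≤ 2 * ENNReal.ofReal K₁ + 2 := by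
    refine (CuspMetropolis.lintegral_enorm_sq_le_two_mul hum).trans ?_
    refine add_le_add (by gcongr) ?_
    calc 2 * ∫⁻ x in CuspMetropolis.fatPart Ω c h, ‖u x‖ₑ ^ 2 ≤ 2 * 1 := by gcongr
      _ = 2 := mul_one 2
  have hgR : ∫⁻ x in CuspMetropolis.fatPart Ω c h, (‖g x‖ₑ ^ 2 + ‖fderiv ℝ g x‖ₑ ^ 2) ≤ R := by
    rw [lintegral_add_right _ ((measurable_fderiv ℝ g).enorm.pow_const 2)]
    exact add_le_add hg2 hDg
  have hD : ∫⁻ x in Ω, ‖fderiv ℝ (fun x => (∏ i, χ i x) • g x) x‖ₑ ^ 2 ≤ Z :=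
    (CuspMetropolis.lintegral_enorm_sq_fderiv_smul_le hΩ_open hfat hgC
    (fun i => hHardy i g hgC) hχ hχ0 hχ1 hκχ hvan).trans (by rw [hZ]; gcongr)
  have hgu2 : ∫⁻ x in CuspMetropolis.fatPart Ω c h, ‖g x - u x‖ₑ ^ 2 ≤
      ENNReal.ofReal (((d * Z).toReal + K₁ + 1) * h) ^ 2 := by
    refine hgu.trans ?_
    rw [← ENNReal.ofReal_pow (by positivity)]
    refine ENNReal.ofReal_le_ofReal ?_
    rw [mul_pow]
    gcongr
    nlinarith
  obtain ⟨fC, fL, fH, h1, h2, h3, h4, h5, h6, h7, ⟨G, hG1, hG2, hG3⟩, h8⟩ :=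
    CuspMetropolis.exists_decomposition hΩ_open hfat (fun i => (ha0 i).trans (hab i)) hab hbc hχ hχ0
      hχ1 hvan hone (hf_mem h hhI) hgC (ne_top_of_le_ne_top (by finiteness) hg2) hgu2 hZtop hD
  refine ⟨fC, fL, fH, h1, h2, h3, h4, h5, h6, h7, ⟨G, hG1, hG2, ?_⟩, h8⟩
  refine CuspMetropolis.eLpNorm_two_le (hG3.trans ?_)
  have hne : (d * Z : ENNReal) ≠ ⊤ := by finiteness
  refine (ENNReal.ofReal_toReal hne).symm.le.trans ?_
  rw [← ENNReal.ofReal_pow (by positivity)]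
  exact ENNReal.ofReal_le_ofReal (by nlinarith)
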